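/- Let $0<\alpha<1$, $1<\beta\le 2$, $K_\alpha\ge 0$, $K_\beta>0$, $L,T>0$, and let $u$ solve the Riesz space fractional advection-dispersion equation $$\frac{\partial u}{\partial t}=K_\alpha\frac{\partial^\alpha u}{\partial|x|^\alpha}+K_\beta\frac{\partial^\beta u}{\partial|x|^\beta}+f(x,t),\quad 0<x<L,\ 0<t\le T,$$ with $u(x,0)=\psi(x)$ for $0\le x\le L$ and $u(0,t)=u(L,t)=0$ for $0\le t\le T$ (the case $f=0$, the equation without source, is included). Here $\frac{\partial^\gamma v}{\partial|x|^\gamma}=-c_\gamma\left({}_0D_x^\gamma v+{}_xD_L^\gamma v\right)$ with $c_\gamma=\frac{1}{2\cos(\pi\gamma/2)}$ and the left and right Riemann-Liouville derivatives of order $\gamma$ on $[0,L]$; for $\gamma=2$ both are $v''$. Assume that $u$ is smooth in the following sense, for $\gamma=\beta$ and, if $K_\alpha\ne0$, also for $\gamma=\alpha$: each $u(\cdot,t)$, $t\in[0,T]$, is continuous on $[0,L]$; if $\gamma<2$, the Fourier transform $\hat u(\cdot,t)$ of the extension of $u(\cdot,t)$ by zero to $\mathbb R$ satisfies $\sup_{0\le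 t\le T}\int_{\mathbb R}|\xi|^{\gamma+2}|\hat u(\xi,t)|\,d\xi<\infty$; if $\gamma=2$, $u(\cdot,t)\in C^4([0,L])$ with $\partial_x^4u$ bounded uniformly in $t\in[0,T]$. Assume also that for each $x\in(0,L)$ one has $u(x,\cdot)\in C^3([0,T])$ and $f(x,\cdot)\in C^2([0,T])$, with $\partial_t^3u$ and $\partial_t^2f$ bounded uniformly on $(0,L)\times[0,T]$. For integers $m,N\ge1$ put $h=L/m$, $\tau=T/N$, $x_i=ih$, $t_n=n\tau$, $t_{n-1/2}=(n-\frac12)\tau$. Let $g_k^{(\gamma)}=(-1)^k\binom{\gamma}{k}$, $w_0^{(\gamma)}=\frac\gamma2g_0^{(\gamma)}$, $w_k^{(\gamma)}=\frac\gamma2g_k^{(\gamma)}+\frac{2-\gamma}2g_{k-1}^{(\gamma)}$ for $k\ge1$. Let $A$ and $B$ be the $(m-1)\times(m-1)$ matrices with entries $A_{ij}=w^{(\alpha)}_{i-j+1}$ and $B_{ij}=w^{(\beta)}_{i-j+1}$ for $j\le i+1$, and $0$ otherwise. Let $$D=\mu_\alpha(A+A^{T})+\mu_\beta(B+B^{T}),\qquad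 \mu_\gamma=\frac{\tau K_\gamma c_\gamma}{2h^\gamma}.$$ The Crank-Nicolson scheme is $U^0=[\psi(x_i)]_{i=1}^{m-1}$ and $$(I+D)U^n=(I-D)U^{n-1}+\tau\,[f(x_i,t_{n-1/2})]_{i=1}^{m-1},\qquad 1\le n\le N.$$ Then, with $u^n=[u(x_1,t_n),\dots,u(x_{m-1},t_n)]^T$: the matrix $I+D$ is invertible for all $m,N\ge1$, so that the scheme is uniquely solvable; there is a constant $C>0$, not depending on $m$, $N$, $n$, such that for all $m,N\ge1$ and $0\le n\le N$ $$\|U^n-u^n\|_\infty\le C(\tau^2+h^2);$$ and $\max_{0\le n\le N}\|U^n-u^n\|_\infty\to0$ as $h$ and $\tau$ tend to zero, with no condition linking $\tau$ and $h$. -/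

import Mathlib

open Set MeasureTheory
open scoped FourierTransform Matrix

namespace RieszFADE

/-! ### Riemann-Liouville and Riesz fractional derivatives on an interval -/

/-- Left Riemann-Liouville derivative of order `γ` with base point `a`,
`(1 / Γ(n - γ)) (d/dx)^n ∫_a^x (x - ξ)^(n - γ - 1) v(ξ) dξ`, where `n - 1 ≤ γ < n`.
For `γ = 2` (so `n = 3`) this is the ordinary second derivative `v''(x)`. -/
noncomputable def leftRL (a γ : ℝ) (v : ℝ → ℝ) (x : ℝ) : ℝ :=
  1 / Real.Gamma ((⌊γ⌋₊ + 1 : ℕ) - γ) *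
    iteratedDeriv (⌊γ⌋₊ + 1)
      (fun y => ∫ ξ in a..y, (y - ξ) ^ (((⌊γ⌋₊ + 1 : ℕ) : ℝ) - γ - 1) * v ξ) x

/-- Right Riemann-Liouville derivative of order `γ` with end point `b`,
`((-1)^n / Γ(n - γ)) (d/dx)^n ∫_x^b (ξ - x)^(n - γ - 1) v(ξ) dξ`, where `n - 1 ≤ γ < n`.
For `γ = 2` (so `n = 3`) this is the ordinary second derivative `v''(x)`. -/
noncomputable def rightRL (b γ : ℝ) (v : ℝ → ℝ) (x : ℝ) : ℝ :=
  (-1) ^ (⌊γ⌋₊ + 1) / Real.Gamma ((⌊γ⌋₊ + 1 : ℕ) - γ) *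
    iteratedDeriv (⌊γ⌋₊ + 1)
      (fun y => ∫ ξ in y..b, (ξ - y) ^ (((⌊γ⌋₊ + 1 : ℕ) : ℝ) - γ - 1) * v ξ) x

/-- The constant `c_γ = 1 / (2 cos (π γ / 2))`. -/
noncomputable def rieszConst (γ : ℝ) : ℝ := 1 / (2 * Real.cos (Real.pi * γ / 2))

/-- The Riesz derivative of order `γ` on `[0, L]`. -/
noncomputable def rieszDeriv (L γ : ℝ) (v : ℝ → ℝ) (x : ℝ) : ℝ :=
  -rieszConst γ * (leftRL 0 γ v x + rightRL L γ v x)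

/-! ### The initial-boundary value problem -/

/-- `u` solves `∂ₜ u = Kα ∂^α u/∂|x|^α + Kβ ∂^β u/∂|x|^β + f` for `0 < x < L`, `0 < t ≤ T`,
with `u(x, 0) = ψ(x)` and `u(0, t) = u(L, t) = 0`.  (The time derivative is one-sided at `T`.) -/
structure IsSolution (α β Kα Kβ L T : ℝ) (f : ℝ → ℝ → ℝ) (ψ : ℝ → ℝ) (u : ℝ → ℝ → ℝ) :
    Prop where
  equation : ∀ x ∈ Ioo 0 L, ∀ t ∈ Ioc 0 T,
    HasDerivWithinAt (fun s => u x s)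
      (Kα * rieszDeriv L α (fun y => u y t) x + Kβ * rieszDeriv L β (fun y => u y t) x + f x t)
      (Icc 0 T) t
  initial : ∀ x ∈ Icc 0 L, u x 0 = ψ x
  left_boundary : ∀ t ∈ Icc 0 T, u 0 t = 0
  right_boundary : ∀ t ∈ Icc 0 T, u L t = 0

/-- Extension by zero of a function on `[0, L]` to the line (with complex values, as the Fourier
transform requires). -/
noncomputable def zeroExt (L : ℝ) (v : ℝ → ℝ) : ℝ → ℂ :=
  (Icc 0 L).indicator (fun x => (v x : ℂ))

/-- The smoothness in space attached to the Riesz derivative of order `γ`, uniformly for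
`t ∈ [0, T]`.  For `γ ≠ 2`: the derivative of order `γ + 2` of the extension of `u(·, t)` by zero
has an integrable Fourier transform.  For `γ = 2`, where the operator `∂²/∂x²` is local and
nothing has to be extended: `u(·, t)` is `C⁴` on `[0, L]`. -/
def SpaceRegular (γ L T : ℝ) (u : ℝ → ℝ → ℝ) : Prop :=
  (∀ t ∈ Icc 0 T, ContinuousOn (fun x => u x t) (Icc 0 L)) ∧
  (γ ≠ 2 → ∃ B : ℝ, ∀ t ∈ Icc 0 T,
    Integrable (fun ξ : ℝ => |ξ| ^ (γ + 2) * ‖𝓕 (zeroExt L fun x => u x t) ξ‖) ∧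
    ∫ ξ : ℝ, |ξ| ^ (γ + 2) * ‖𝓕 (zeroExt L fun x => u x t) ξ‖ ≤ B) ∧
  (γ = 2 → ∃ B : ℝ, ∀ t ∈ Icc 0 T,
    ContDiffOn ℝ 4 (fun x => u x t) (Icc 0 L) ∧
    ∀ x ∈ Icc 0 L, |iteratedDerivWithin 4 (fun y => u y t) (Icc 0 L) x| ≤ B)

/-- For each `x ∈ (0, L)` the function `g(x, ·)` is `C^k` on `[0, T]`, and `∂ₜ^k g` is bounded. -/
def TimeRegular (k : ℕ) (L T : ℝ) (g : ℝ → ℝ → ℝ) : Prop :=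
  ∃ B : ℝ, ∀ x ∈ Ioo 0 L,
    ContDiffOn ℝ k (fun t => g x t) (Icc 0 T) ∧
    ∀ t ∈ Icc 0 T, |iteratedDerivWithin k (fun s => g x s) (Icc 0 T) t| ≤ B

/-! ### The weighted and shifted Grünwald difference scheme -/

/-- Grünwald coefficients: `g_k = (-1)^k (γ choose k)`, the coefficients of `(1 - z)^γ`. -/
noncomputable def grunwald (γ : ℝ) : ℕ → ℝ
  | 0 => 1
  | k + 1 => (1 - (γ + 1) / ((k + 1 : ℕ) : ℝ)) * grunwald γ k

/-- Weights `w_0 = (γ/2) g_0`, `w_k = (γ/2) g_k + ((2 - γ)/2) g_{k-1}` for `k ≥ 1`. -/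
noncomputable def wsgd (γ : ℝ) : ℕ → ℝ
  | 0 => γ / 2 * grunwald γ 0
  | k + 1 => γ / 2 * grunwald γ (k + 1) + (2 - γ) / 2 * grunwald γ k

/-- The `(m-1) × (m-1)` Toeplitz matrix with entries `w_{i-j+1}` (and `0` if `i - j + 1 < 0`). -/
noncomputable def wsgdMatrix (γ : ℝ) (m : ℕ) : Matrix (Fin (m - 1)) (Fin (m - 1)) ℝ :=
  Matrix.of fun i j =>
    if (j : ℕ) ≤ (i : ℕ) + 1 then wsgd γ ((i : ℕ) + 1 - (j : ℕ)) else 0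

/-- `μ_γ = τ K c_γ / (2 h^γ)`. -/
noncomputable def mu (γ K h τ : ℝ) : ℝ := τ * K * rieszConst γ / (2 * h ^ γ)

/-- `D = μ_α (A + Aᵀ) + μ_β (B + Bᵀ)` for the space step `h = L / m` and time step `τ`. -/
noncomputable def matD (α β Kα Kβ L : ℝ) (m : ℕ) (τ : ℝ) :
    Matrix (Fin (m - 1)) (Fin (m - 1)) ℝ :=
  mu α Kα (L / m) τ • (wsgdMatrix α m + (wsgdMatrix α m)ᵀ) +
    mu β Kβ (L / m) τ • (wsgdMatrix β m + (wsgdMatrix β m)ᵀ)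

/-- The values `[v(x_1), …, v(x_{m-1})]` at the interior nodes `x_i = i L / m`. -/
noncomputable def gridValues (L : ℝ) (m : ℕ) (v : ℝ → ℝ) : Fin (m - 1) → ℝ :=
  fun i => v (((i : ℕ) + 1 : ℝ) * (L / m))

/-- `U⁰, …, U^N` is computed by the Crank-Nicolson scheme with `τ = T / N`, `h = L / m`:
`U⁰ = [ψ(x_i)]` and `(I + D) Uⁿ = (I - D) Uⁿ⁻¹ + τ [f(x_i, t_{n-1/2})]` for `1 ≤ n ≤ N`. -/
def IsCrankNicolson (α β Kα Kβ L T : ℝ) (f : ℝ → ℝ → ℝ) (ψ : ℝ → ℝ) (m N : ℕ)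
    (U : ℕ → Fin (m - 1) → ℝ) : Prop :=
  U 0 = gridValues L m ψ ∧
  ∀ n : ℕ, n < N →
    (1 + matD α β Kα Kβ L m (T / N)) *ᵥ U (n + 1) =
      (1 - matD α β Kα Kβ L m (T / N)) *ᵥ U n +
        (T / N) • gridValues L m (fun x => f x (((n : ℝ) + 1 / 2) * (T / N)))

end RieszFADE

namespace RieszFADE

/-! ### Grünwald coefficients -/

/-! The proof is "stability plus consistency", with stability measured in the quadratic form of D
instead of the Euclidean norm.

Stability. The error satisfies (e' - e) + D(e' + e) = τρ from one time level to the next. Pairing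
with e' - e and using the symmetry of D shows that Q(e) = eᵀDe grows by at most τ²|ρ|²/4 per step
(`form_le_of_crankNicolson_step`). The partial sums of Grünwald coefficients of order γ are the
coefficients of order γ - 1; this fixes the signs of the off-diagonal entries and row sums of A + Aᵀ
and B + Bᵀ. Together with c_α > 0 > c_β it bounds Q(e) below by a multiple of τ h^(-β) ∑ s(|i - j|)
(e_i - e_j)², a discrete H^(β/2) seminorm (`mul_toeplitzEnergy_le_form`). Since β > 1, a discrete
Sobolev inequality bounds the maximum norm by that energy (`sq_le_toeplitzEnergy`). All powers of m
and τ cancel, so max |e| ≤ C max |ρ| with no condition on the steps (`norm_le_of_crankNicolson`).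

Consistency in space. For γ < 2 the left Riemann-Liouville derivative is the Fourier multiplier
(iω)^γ acting on the extension by zero, and the weighted Grünwald sum is a multiplier with an
explicit symbol (`IsRegularFunction.leftRL_eq_integral`, `IsRegularFunction.sum_wsgd_eq_integral`).
The weights cancel the first order term in the quotient of the two symbols, leaving an error O(h²
|ω|^(γ+2)) (`norm_wsgdSymbol_sub_le`). The right derivative follows by the reflection x ↦ L - x. For
γ = 2 the scheme is the usual second difference and Taylor's formula applies.

Consistency in time. The equation replaces the space operator at both time levels by ∂ₜu - f up to
O(h²), so the remaining terms are trapezoidal and midpoint errors of u and f in t alone; no time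
regularity of the fractional derivatives is needed (`crankNicolson_time_bound`). -/

theorem grunwald_zero (γ : ℝ) : grunwald γ 0 = 1 := rfl

theorem grunwald_succ (γ : ℝ) (k : ℕ) :
    grunwald γ (k + 1) = (1 - (γ + 1) / ((k : ℝ) + 1)) * grunwald γ k := by
  simp [grunwald]

/-- The absorption identity for binomial coefficients. Used once for γ < 1 and twice for 1 < γ ≤ 2,
it lowers the order to a nonpositive one, where all coefficients are nonnegative; every sign fact
below comes from this. -/
theorem grunwald_succ_eq_mul_sub_one (γ : ℝ) (n : ℕ) :
    grunwald γ (n + 1) = -γ / ((n : ℝ) + 1) * grunwald (γ - 1) n := by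
  induction n with
  | zero => simp [grunwald]
  | succ n ih =>
    rw [grunwald_succ, ih, grunwald_succ (γ - 1)]
    have h1 : (n : ℝ) + 1 ≠ 0 := by positivity
    have h2 : (n : ℝ) + 1 + 1 ≠ 0 := by positivity
    push_cast
    field_simp
    ring

/-- Compare coefficients in (1 - z)^γ / (1 - z) = (1 - z)^(γ - 1). -/
theorem sum_grunwald (γ : ℝ) (n : ℕ) :
    ∑ k ∈ Finset.range (n + 1), grunwald γ k = grunwald (γ - 1) n := by
  induction n with
  | zero => simp [grunwald]
  | succ n ih =>
    rw [Finset.sum_range_succ, ih, grunwald_succ_eq_mul_sub_one, grunwald_succ (γ - 1)]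
    have h1 : (n : ℝ) + 1 ≠ 0 := by positivity
    field_simp
    ring

theorem grunwald_nonneg_of_nonpos {δ : ℝ} (h : δ ≤ 0) (n : ℕ) : 0 ≤ grunwald δ n := by
  induction n with
  | zero => simp [grunwald]
  | succ n ih =>
    rw [grunwald_succ]
    refine mul_nonneg ?_ ih
    rw [sub_nonneg, div_le_one (by positivity)]
    have : (0 : ℝ) ≤ n := n.cast_nonneg
    linarith

theorem grunwald_succ_nonpos {γ : ℝ} (h0 : 0 < γ) (h1 : γ < 1) (n : ℕ) :
    grunwald γ (n + 1) ≤ 0 := by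
  rw [grunwald_succ_eq_mul_sub_one]
  exact mul_nonpos_of_nonpos_of_nonneg (div_nonpos_of_nonpos_of_nonneg (by linarith)
    (by positivity)) (grunwald_nonneg_of_nonpos (by linarith) n)

theorem grunwald_add_two_nonneg {γ : ℝ} (h1 : 1 < γ) (h2 : γ ≤ 2) (n : ℕ) :
    0 ≤ grunwald γ (n + 2) := by
  rw [grunwald_succ_eq_mul_sub_one, grunwald_succ_eq_mul_sub_one, ← mul_assoc]
  refine mul_nonneg (mul_nonneg_of_nonpos_of_nonpos ?_ ?_)
    (grunwald_nonneg_of_nonpos (by linarith) n) <;>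
  exact div_nonpos_of_nonpos_of_nonneg (by linarith) (by positivity)

theorem sum_grunwald_nonneg {γ : ℝ} (h1 : γ < 1) (n : ℕ) :
    0 ≤ ∑ k ∈ Finset.range (n + 1), grunwald γ k := by
  rw [sum_grunwald]
  exact grunwald_nonneg_of_nonpos (by linarith) n

theorem sum_grunwald_nonpos {γ : ℝ} (h1 : 1 < γ) (h2 : γ ≤ 2) (n : ℕ) :
    ∑ k ∈ Finset.range (n + 2), grunwald γ k ≤ 0 := by
  rw [sum_grunwald, grunwald_succ_eq_mul_sub_one]
  exact mul_nonpos_of_nonpos_of_nonneg (div_nonpos_of_nonpos_of_nonneg (by linarith)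
    (by positivity)) (grunwald_nonneg_of_nonpos (by linarith) n)

/-- After the first one or two terms the coefficients have constant sign, and the sign of the
partial sums bounds the rest by those initial terms. -/
theorem summable_norm_grunwald {γ : ℝ} (h0 : 0 < γ) (h2 : γ ≤ 2) (h1 : γ ≠ 1) :
    Summable fun k => ‖grunwald γ k‖ := by
  rcases lt_or_gt_of_ne h1 with h | h
  · rw [← summable_nat_add_iff 1]
    refine summable_of_sum_range_le (c := 1) (fun n => norm_nonneg _) fun n => ?_
    have h3 := sum_grunwald_nonneg h n
    rw [Finset.sum_range_succ', grunwald_zero] at h3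
    have h4 : ∑ k ∈ Finset.range n, ‖grunwald γ (k + 1)‖ =
        -∑ k ∈ Finset.range n, grunwald γ (k + 1) := by
      rw [← Finset.sum_neg_distrib]
      exact Finset.sum_congr rfl fun k _ => by
        rw [Real.norm_eq_abs, abs_of_nonpos (grunwald_succ_nonpos h0 h k)]
    linarith
  · rw [← summable_nat_add_iff 2]
    refine summable_of_sum_range_le (c := γ) (fun n => norm_nonneg _) fun n => ?_
    have h3 := sum_grunwald_nonpos h h2 n
    rw [Finset.sum_range_succ', Finset.sum_range_succ', grunwald_zero, zero_add, grunwald_succ,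
      grunwald_zero] at h3
    have h4 : ∑ k ∈ Finset.range n, ‖grunwald γ (k + 2)‖ =
        ∑ k ∈ Finset.range n, grunwald γ (k + 2) :=
      Finset.sum_congr rfl fun k _ => by
        rw [Real.norm_eq_abs, abs_of_nonneg (grunwald_add_two_nonneg h h2 k)]
    norm_num at h3
    rw [h4]
    linarith

/-- The power decays at least as fast as the coefficients: with x = n + 2 - γ, consecutive
coefficients have ratio x / (x + 1 + γ), which is at least (x / (x + 1))^(1 + γ). The constant gives
equality at n = 0. -/
theorem grunwald_lower_bound {γ : ℝ} (h1 : 1 < γ) (h2 : γ < 2) (n : ℕ) :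
    γ * (γ - 1) / 2 * (2 - γ) ^ (1 + γ) * ((n : ℝ) + 2 - γ) ^ (-(1 + γ)) ≤ grunwald γ (n + 2) := by
  induction n with
  | zero =>
    have h3 : (0 : ℝ) < 2 - γ := by linarith
    have : (2 - γ) ^ (1 + γ) * (2 - γ) ^ (-(1 + γ)) = 1 := by
      rw [← Real.rpow_add h3]; simp
    rw [Nat.cast_zero, zero_add, mul_assoc, this, grunwald_succ_eq_mul_sub_one,
      grunwald_succ_eq_mul_sub_one, grunwald_zero]
    norm_num
    linarith
  | succ n ih =>
    have hn : (0 : ℝ) ≤ n := n.cast_nonneg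
    set x : ℝ := (n : ℝ) + 2 - γ with hx
    have hx0 : 0 < x := by linarith
    rw [show (((n + 1 : ℕ) : ℝ) + 2 - γ) = x + 1 by push_cast; ring, grunwald_succ]
    have h3 : (1 - (γ + 1) / (((n + 1 + 1 : ℕ) : ℝ) + 1)) = x / (x + 1 + γ) := by
      have : (n : ℝ) + 1 + 1 + 1 ≠ 0 := by positivity
      have h4 : x + 1 + γ = n + 1 + 1 + 1 := by rw [hx]; ring
      rw [h4]; push_cast; field_simp; rw [hx]; ring
    have h5 : (x + 1) ^ (-(1 + γ)) ≤ x / (x + 1 + γ) * x ^ (-(1 + γ)) := by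
      -- Bernoulli's inequality with the real exponent 1 + γ.
      have h6 : 1 + (1 + γ) * (1 / x) ≤ (1 + 1 / x) ^ (1 + γ) :=
        one_add_mul_self_le_rpow_one_add (by have : 0 < 1 / x := by positivity
                                             linarith) (by linarith)
      have h7 : (1 + 1 / x) ^ (1 + γ) = (x + 1) ^ (1 + γ) / x ^ (1 + γ) := by
        rw [← Real.div_rpow (by linarith) hx0.le]; congr 1; field_simp
      rw [h7, le_div_iff₀ (by positivity)] at h6
      rw [Real.rpow_neg (by linarith), Real.rpow_neg hx0.le, ← div_eq_mul_inv, div_div,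
        inv_eq_one_div, div_le_div_iff₀ (by positivity) (by positivity)]
      calc 1 * ((x + 1 + γ) * x ^ (1 + γ)) = x * ((1 + (1 + γ) * (1 / x)) * x ^ (1 + γ)) := by
            field_simp
            ring
        _ ≤ x * (x + 1) ^ (1 + γ) := by gcongr
    have h8 : 0 ≤ γ * (γ - 1) / 2 * (2 - γ) ^ (1 + γ) := by
      have : 0 ≤ (2 - γ) ^ (1 + γ) := Real.rpow_nonneg (by linarith) _
      have : 0 ≤ γ * (γ - 1) := mul_nonneg (by linarith) (by linarith)
      positivity
    rw [h3]
    calc _ ≤ γ * (γ - 1) / 2 * (2 - γ) ^ (1 + γ) * (x / (x + 1 + γ) * x ^ (-(1 + γ))) := by gcongr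
      _ = x / (x + 1 + γ) * (γ * (γ - 1) / 2 * (2 - γ) ^ (1 + γ) * x ^ (-(1 + γ))) := by ring
      _ ≤ _ := by
        refine mul_le_mul_of_nonneg_left ih ?_
        exact div_nonneg hx0.le (by linarith)

theorem grunwald_eq_ringChoose (γ : ℝ) (k : ℕ) :
    (grunwald γ k : ℂ) = (-1) ^ k * Ring.choose (γ : ℂ) k := by
  induction k with
  | zero => simp [grunwald]
  | succ k ih =>
    have h : Ring.choose (γ : ℂ) (k + 1) =
        ((γ : ℂ) - k) / ((k : ℂ) + 1) * Ring.choose (γ : ℂ) k := by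
      have hk : (k : ℂ) + 1 ≠ 0 := by norm_cast
      rw [Ring.choose_eq_smul, Ring.choose_eq_smul, descPochhammer_succ_right,
        Polynomial.smeval_mul, Polynomial.smeval_sub, Polynomial.smeval_X,
        Polynomial.smeval_natCast, Nat.factorial_succ]
      have hk' : (k.factorial : ℂ) ≠ 0 := by exact_mod_cast k.factorial_ne_zero
      simp only [smul_eq_mul, pow_one, pow_zero, nsmul_eq_mul, mul_one]
      push_cast
      field_simp
    rw [grunwald_succ, h, Complex.ofReal_mul, ih]
    have hk : (k : ℂ) + 1 ≠ 0 := by norm_cast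
    push_cast
    field_simp
    ring

theorem hasSum_grunwald_of_norm_lt_one (γ : ℝ) {z : ℂ} (hz : ‖z‖ < 1) :
    HasSum (fun k => (grunwald γ k : ℂ) * z ^ k) ((1 - z) ^ (γ : ℂ)) := by
  have h := (Complex.one_add_cpow_hasFPowerSeriesOnBall_zero (a := (γ : ℂ))).hasSum
    (y := -z) (by simpa [enorm_eq_nnnorm, ← NNReal.coe_lt_one] using hz)
  have hf : (fun k => (grunwald γ k : ℂ) * z ^ k) =
      fun k => binomialSeries ℂ (γ : ℂ) k fun _ => -z := by
    ext k
    rw [binomialSeries_apply, grunwald_eq_ringChoose, List.ofFn_const, List.prod_replicate,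
      neg_pow z, smul_eq_mul]
    ring
  rw [hf, show 1 - z = 1 + (0 + -z) by ring]
  exact h

/-- The unit circle is where the Fourier symbol lives. Absolute summability makes the series
continuous along the radius to z, so the identity inside the disc passes to the limit, as in Abel's
theorem. -/
theorem hasSum_grunwald {γ : ℝ} (h0 : 0 < γ) (h2 : γ ≤ 2) (h1 : γ ≠ 1) {z : ℂ} (hz : ‖z‖ ≤ 1) :
    HasSum (fun k => (grunwald γ k : ℂ) * z ^ k) ((1 - z) ^ (γ : ℂ)) := by
  have hs := summable_norm_grunwald h0 h2 h1
  have hbound : ∀ r ∈ Icc (0 : ℝ) 1, ∀ k,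
      ‖(grunwald γ k : ℂ) * ((r : ℂ) * z) ^ k‖ ≤ ‖grunwald γ k‖ := by
    intro r hr k
    rw [norm_mul, Complex.norm_real, norm_pow, norm_mul, Complex.norm_real]
    refine mul_le_of_le_one_right (norm_nonneg _) (pow_le_one₀ (by positivity) ?_)
    rw [Real.norm_eq_abs, abs_of_nonneg hr.1]
    exact mul_le_one₀ hr.2 (norm_nonneg _) hz
  have hsum : Summable fun k => (grunwald γ k : ℂ) * z ^ k :=
    Summable.of_norm_bounded hs (by simpa using hbound 1 (by simp))
  have hcont : ContinuousOn (fun r : ℝ => ∑' k, (grunwald γ k : ℂ) * ((r : ℂ) * z) ^ k) (Icc 0 1) :=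
    continuousOn_tsum (fun k => by fun_prop) hs fun k r hr => hbound r hr k
  have hlim := (hcont 1 (by simp)).mono (Ico_subset_Icc_self)
  have hne : (nhdsWithin (1 : ℝ) (Ico 0 1)).NeBot := by
    rw [← mem_closure_iff_nhdsWithin_neBot, closure_Ico (by norm_num)]
    simp
  have hcpow : ContinuousWithinAt (fun r : ℝ => (1 - (r : ℂ) * z) ^ (γ : ℂ)) (Ico 0 1) 1 := by
    apply ContinuousAt.continuousWithinAt
    refine ContinuousAt.comp (g := fun w : ℂ => w ^ (γ : ℂ)) (f := fun r : ℝ => 1 - (r : ℂ) * z)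
      ?_ (by fun_prop)
    simp only [Complex.ofReal_one, one_mul]
    -- At z = 1 the base of the power vanishes and continuity comes from γ > 0. Elsewhere 1 - z is
    -- nonzero with nonnegative real part, hence off the branch cut.
    by_cases hz1 : 1 - z = 0
    · rw [hz1]
      exact Complex.continuousAt_cpow_const_of_re_pos (by simp) (by simpa using h0)
    · refine continuousAt_cpow_const ?_
      rw [Complex.mem_slitPlane_iff]
      have hre := Complex.re_le_norm z
      by_contra hcon
      push Not at hcon
      have h3 : (1 - z).re = 0 := by
        have : 0 ≤ (1 - z).re := by simp; linarith
        linarith [hcon.1]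
      exact hz1 (Complex.ext (by simpa using h3) (by simpa using hcon.2))
  have heq : Filter.Tendsto (fun r : ℝ => ∑' k, (grunwald γ k : ℂ) * ((r : ℂ) * z) ^ k)
      (nhdsWithin (1 : ℝ) (Ico 0 1)) (nhds ((1 - z) ^ (γ : ℂ))) := by
    have := hcpow.tendsto
    simp only [Complex.ofReal_one, one_mul] at this
    refine this.congr' ?_
    filter_upwards [self_mem_nhdsWithin] with r hr
    refine (HasSum.tsum_eq (hasSum_grunwald_of_norm_lt_one γ ?_)).symm
    rw [norm_mul, Complex.norm_real, Real.norm_eq_abs, abs_of_nonneg hr.1]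
    calc r * ‖z‖ ≤ r * 1 := mul_le_mul_of_nonneg_left hz hr.1
      _ < 1 := by linarith [hr.2]
  have h := tendsto_nhds_unique hlim.tendsto heq
  simp only [Complex.ofReal_one, one_mul] at h
  rw [← h]
  exact hsum.hasSum

/-! ### Toeplitz coefficients of the symmetrised scheme -/

/-- The entries of the symmetric Toeplitz matrix `A + Aᵀ`, indexed by the distance to the
diagonal. -/
noncomputable def toeplitzCoeff (γ : ℝ) : ℕ → ℝ
  | 0 => 2 * wsgd γ 1
  | 1 => wsgd γ 0 + wsgd γ 2
  | k + 2 => wsgd γ (k + 3)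

theorem wsgdMatrix_add_transpose (γ : ℝ) (m : ℕ) (i j : Fin (m - 1)) :
    (wsgdMatrix γ m + (wsgdMatrix γ m)ᵀ) i j =
      toeplitzCoeff γ ((i - j : ℕ) + (j - i : ℕ)) := by
  obtain ⟨i, hi⟩ := i
  obtain ⟨j, hj⟩ := j
  simp only [Matrix.add_apply, Matrix.transpose_apply, wsgdMatrix, Matrix.of_apply]
  rcases lt_trichotomy i j with h | h | h
  · obtain ⟨d, rfl⟩ := Nat.exists_eq_add_of_lt h
    rw [show (i - (i + d + 1) + (i + d + 1 - i)) = d + 1 by omega]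
    rcases d with _ | d
    · rw [if_pos (by omega), if_pos (by omega),
        show i + 1 - (i + 0 + 1) = 0 by omega, show i + 0 + 1 + 1 - i = 2 by omega]
      rfl
    · rw [if_neg (by omega), if_pos (by omega),
        show i + (d + 1) + 1 + 1 - i = d + 3 by omega]
      simp [toeplitzCoeff]
  · subst h
    simp [toeplitzCoeff]
    ring
  · obtain ⟨d, rfl⟩ := Nat.exists_eq_add_of_lt h
    rw [show ((j + d + 1) - j + (j - (j + d + 1))) = d + 1 by omega]
    rcases d with _ | d
    · rw [if_pos (by omega), if_pos (by omega), show j + 1 - (j + 0 + 1) = 0 by omega,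
        show j + 0 + 1 + 1 - j = 2 by omega, add_comm]
      rfl
    · rw [if_pos (by omega), if_neg (by omega),
        show j + (d + 1) + 1 + 1 - j = d + 3 by omega]
      simp [toeplitzCoeff]

theorem wsgd_succ (γ : ℝ) (k : ℕ) :
    wsgd γ (k + 1) = γ / 2 * grunwald γ (k + 1) + (2 - γ) / 2 * grunwald γ k := rfl

theorem toeplitzCoeff_one (γ : ℝ) :
    toeplitzCoeff γ 1 = γ * (γ - 1) * (γ + 2) / 4 := by
  simp only [toeplitzCoeff, wsgd, grunwald]
  norm_num
  ring

theorem toeplitzCoeff_zero (γ : ℝ) : toeplitzCoeff γ 0 = (1 - γ) * (γ + 2) := by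
  simp only [toeplitzCoeff, wsgd, grunwald]
  norm_num
  ring

theorem toeplitzCoeff_succ_nonneg {γ : ℝ} (h1 : 1 < γ) (h2 : γ ≤ 2) (k : ℕ) :
    0 ≤ toeplitzCoeff γ (k + 1) := by
  rcases k with _ | k
  · rw [zero_add, toeplitzCoeff_one]
    have : 0 ≤ γ * (γ - 1) := mul_nonneg (by linarith) (by linarith)
    have : 0 ≤ γ * (γ - 1) * (γ + 2) := mul_nonneg this (by linarith)
    linarith
  · change 0 ≤ wsgd γ (k + 2 + 1)
    rw [wsgd_succ]
    have := grunwald_add_two_nonneg h1 h2 (k + 1)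
    have := grunwald_add_two_nonneg h1 h2 k
    exact add_nonneg (mul_nonneg (by linarith) (by assumption))
      (mul_nonneg (by linarith) (by assumption))

theorem toeplitzCoeff_succ_nonpos {γ : ℝ} (h0 : 0 < γ) (h1 : γ < 1) (k : ℕ) :
    toeplitzCoeff γ (k + 1) ≤ 0 := by
  rcases k with _ | k
  · rw [zero_add, toeplitzCoeff_one]
    have : γ * (γ - 1) ≤ 0 := mul_nonpos_of_nonneg_of_nonpos (by linarith) (by linarith)
    have : γ * (γ - 1) * (γ + 2) ≤ 0 := mul_nonpos_of_nonpos_of_nonneg this (by linarith)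
    linarith
  · change wsgd γ (k + 2 + 1) ≤ 0
    rw [wsgd_succ]
    have := grunwald_succ_nonpos h0 h1 (k + 2)
    have := grunwald_succ_nonpos h0 h1 (k + 1)
    exact add_nonpos (mul_nonpos_of_nonneg_of_nonpos (by linarith) (by assumption))
      (mul_nonpos_of_nonneg_of_nonpos (by linarith) (by assumption))

/-- For 0 ≤ γ ≤ 2 this is a convex combination of two consecutive Grünwald partial sums, so it
inherits their common sign. -/
theorem sum_wsgd (γ : ℝ) (n : ℕ) :
    ∑ k ∈ Finset.range (n + 1), wsgd γ k =
      γ / 2 * ∑ k ∈ Finset.range (n + 1), grunwald γ k +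
        (2 - γ) / 2 * ∑ k ∈ Finset.range n, grunwald γ k := by
  rw [Finset.sum_range_succ', Finset.sum_range_succ' (grunwald γ)]
  simp only [wsgd_succ, Finset.sum_add_distrib, ← Finset.mul_sum]
  simp only [wsgd]
  ring

/-- Half the central coefficient plus the first `K` off-diagonal ones. -/
noncomputable def halfRowSum (s : ℕ → ℝ) (K : ℕ) : ℝ :=
  s 0 / 2 + ∑ k ∈ Finset.range K, s (k + 1)

/-- Distance 1 carries both w_0 and w_2, so going out to distance K + 1 uses up exactly the weights
of index at most K + 2. -/
theorem halfRowSum_toeplitzCoeff_succ (γ : ℝ) (K : ℕ) :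
    halfRowSum (toeplitzCoeff γ) (K + 1) = ∑ k ∈ Finset.range (K + 3), wsgd γ k := by
  induction K with
  | zero => simp [halfRowSum, toeplitzCoeff, Finset.sum_range_succ]; ring
  | succ K ih =>
    have h : halfRowSum (toeplitzCoeff γ) (K + 1 + 1) =
        halfRowSum (toeplitzCoeff γ) (K + 1) + wsgd γ (K + 3) := by
      rw [halfRowSum, Finset.sum_range_succ, ← add_assoc]
      rfl
    rw [h, ih, ← Finset.sum_range_succ]

theorem halfRowSum_toeplitzCoeff_nonpos {γ : ℝ} (h1 : 1 < γ) (h2 : γ ≤ 2) (K : ℕ) :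
    halfRowSum (toeplitzCoeff γ) K ≤ 0 := by
  rcases K with _ | K
  · rw [halfRowSum, toeplitzCoeff_zero]
    have := mul_nonneg (show 0 ≤ γ - 1 by linarith) (show 0 ≤ γ + 2 by linarith)
    simp
    linarith
  · rw [halfRowSum_toeplitzCoeff_succ, sum_wsgd]
    exact add_nonpos
      (mul_nonpos_of_nonneg_of_nonpos (by linarith) (sum_grunwald_nonpos h1 h2 (K + 1)))
      (mul_nonpos_of_nonneg_of_nonpos (by linarith) (sum_grunwald_nonpos h1 h2 K))

theorem halfRowSum_toeplitzCoeff_nonneg {γ : ℝ} (h0 : 0 < γ) (h1 : γ < 1) (K : ℕ) :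
    0 ≤ halfRowSum (toeplitzCoeff γ) K := by
  rcases K with _ | K
  · rw [halfRowSum, toeplitzCoeff_zero]
    have := mul_nonneg (show 0 ≤ 1 - γ by linarith) (show 0 ≤ γ + 2 by linarith)
    simp
    linarith
  · rw [halfRowSum_toeplitzCoeff_succ, sum_wsgd]
    exact add_nonneg
      (mul_nonneg (by linarith) (sum_grunwald_nonneg h1 (K + 2)))
      (mul_nonneg (by linarith) (sum_grunwald_nonneg h1 (K + 1)))

/-- Beyond the nearest neighbour the term with the later Grünwald coefficient suffices; the nearest
neighbour has its own constant. At γ = 2 such a bound is false, the weights being zero from index 3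
on. -/
theorem toeplitzCoeff_lower_bound {γ : ℝ} (h1 : 1 < γ) (h2 : γ < 2) :
    ∃ c : ℝ, 0 < c ∧ ∀ k : ℕ, c * ((k : ℝ) + 1) ^ (-(1 + γ)) ≤ toeplitzCoeff γ (k + 1) := by
  have hγ : 0 < γ * (γ - 1) := mul_pos (by linarith) (by linarith)
  have h3 : 0 < (2 - γ) ^ (1 + γ) := Real.rpow_pos_of_pos (by linarith) _
  set c₁ := γ * (γ - 1) * (γ + 2) / 4 with hc₁
  set c₂ := γ / 2 * (γ * (γ - 1) / 2 * (2 - γ) ^ (1 + γ)) with hc₂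
  have hc₁' : 0 < c₁ := by positivity
  have hc₂' : 0 < c₂ := by positivity
  refine ⟨min c₁ c₂, lt_min hc₁' hc₂', fun k => ?_⟩
  rcases k with _ | k
  · simp [toeplitzCoeff_one, ← hc₁]
  · change _ ≤ wsgd γ (k + 2 + 1)
    rw [wsgd_succ]
    have h4 := grunwald_add_two_nonneg h1 h2.le k
    have h5 := grunwald_lower_bound h1 h2 (k + 1)
    have h6 : (((k + 1 : ℕ) : ℝ) + 1) ^ (-(1 + γ)) ≤ (((k + 1 : ℕ) : ℝ) + 2 - γ) ^ (-(1 + γ)) := by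
      have : (0 : ℝ) ≤ ((k + 1 : ℕ) : ℝ) := Nat.cast_nonneg _
      exact Real.rpow_le_rpow_of_nonpos (by linarith) (by linarith) (by linarith)
    have h7 : 0 ≤ (((k + 1 : ℕ) : ℝ) + 1) ^ (-(1 + γ)) := by positivity
    calc _ ≤ c₂ * (((k + 1 : ℕ) : ℝ) + 1) ^ (-(1 + γ)) := by
          gcongr
          exact min_le_right _ _
      _ ≤ c₂ * (((k + 1 : ℕ) : ℝ) + 2 - γ) ^ (-(1 + γ)) := by gcongr
      _ = γ / 2 * (γ * (γ - 1) / 2 * (2 - γ) ^ (1 + γ) *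
            (((k + 1 : ℕ) : ℝ) + 2 - γ) ^ (-(1 + γ))) := by rw [hc₂]; ring
      _ ≤ γ / 2 * grunwald γ (k + 1 + 2) := by gcongr
      _ ≤ _ := le_add_of_nonneg_right (mul_nonneg (by linarith) h4)

/-! ### Toeplitz quadratic forms -/

/-- The entries left and right of the diagonal form two half rows, each taking half of the diagonal
entry. -/
theorem sum_toeplitz_row (s : ℕ → ℝ) {i M : ℕ} (hi : i < M) :
    ∑ j ∈ Finset.range M, s ((i - j) + (j - i)) =
      halfRowSum s i + halfRowSum s (M - 1 - i) := by
  obtain ⟨K, rfl⟩ := Nat.exists_eq_add_of_lt hi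
  rw [show i + K + 1 = (i + 1) + K by ring, Finset.sum_range_add,
    ← Finset.sum_range_reflect, Finset.sum_range_succ', halfRowSum, halfRowSum]
  have h1 : ∀ k ∈ Finset.range i,
      s ((i - (i + 1 - 1 - (k + 1))) + ((i + 1 - 1 - (k + 1)) - i)) = s (k + 1) := by
    intro k hk
    rw [Finset.mem_range] at hk
    congr 1
    omega
  have h2 : ∀ k ∈ Finset.range K, s ((i - (i + 1 + k)) + ((i + 1 + k) - i)) = s (k + 1) := by
    intro k _
    congr 1
    omega
  rw [Finset.sum_congr rfl h1, Finset.sum_congr rfl h2]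
  rw [show i + 1 + K - 1 - i = K by omega]
  simp
  ring

/-- Write 2 e_i e_j = e_i² + e_j² - (e_i - e_j)². The squares are weighted by row sums, which are
nonpositive. -/
theorem toeplitz_form_le (s : ℕ → ℝ) (hs : ∀ K, halfRowSum s K ≤ 0) (M : ℕ) (e : ℕ → ℝ) :
    ∑ i ∈ Finset.range M, ∑ j ∈ Finset.range M, s ((i - j) + (j - i)) * e i * e j ≤
      -(1 / 2) * ∑ i ∈ Finset.range M, ∑ j ∈ Finset.range M,
        s ((i - j) + (j - i)) * (e i - e j) ^ 2 := by
  have h1 : ∑ i ∈ Finset.range M, ∑ j ∈ Finset.range M, s ((i - j) + (j - i)) * e i ^ 2 ≤ 0 := by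
    refine Finset.sum_nonpos fun i hi => ?_
    rw [← Finset.sum_mul, sum_toeplitz_row s (Finset.mem_range.1 hi)]
    exact mul_nonpos_of_nonpos_of_nonneg (add_nonpos (hs _) (hs _)) (sq_nonneg _)
  have h2 : ∑ i ∈ Finset.range M, ∑ j ∈ Finset.range M, s ((i - j) + (j - i)) * e j ^ 2 =
      ∑ i ∈ Finset.range M, ∑ j ∈ Finset.range M, s ((i - j) + (j - i)) * e i ^ 2 := by
    rw [Finset.sum_comm]
    simp_rw [add_comm]
  have h3 : ∑ i ∈ Finset.range M, ∑ j ∈ Finset.range M, s ((i - j) + (j - i)) * (e i - e j) ^ 2 =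
      ∑ i ∈ Finset.range M, ∑ j ∈ Finset.range M, s ((i - j) + (j - i)) * e i ^ 2 +
      ∑ i ∈ Finset.range M, ∑ j ∈ Finset.range M, s ((i - j) + (j - i)) * e j ^ 2 -
      2 * ∑ i ∈ Finset.range M, ∑ j ∈ Finset.range M, s ((i - j) + (j - i)) * e i * e j := by
    simp only [Finset.mul_sum, ← Finset.sum_add_distrib, ← Finset.sum_sub_distrib]
    refine Finset.sum_congr rfl fun i _ => Finset.sum_congr rfl fun j _ => ?_
    ring
  linarith

/-! ### A discrete fractional Sobolev inequality -/

/-- The Toeplitz energy of `a` on `{0, …, M - 1}`. -/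
noncomputable def toeplitzEnergy (s : ℕ → ℝ) (M : ℕ) (a : ℕ → ℝ) : ℝ :=
  ∑ i ∈ Finset.range M, ∑ j ∈ Finset.range M, s ((i - j) + (j - i)) * (a i - a j) ^ 2

theorem toeplitz_summand_nonneg {s : ℕ → ℝ} (hs : ∀ k, 0 ≤ s (k + 1)) (a : ℕ → ℝ) (i j : ℕ) :
    0 ≤ s ((i - j) + (j - i)) * (a i - a j) ^ 2 := by
  rcases eq_or_ne i j with rfl | h
  · simp
  · obtain ⟨k, hk⟩ : ∃ k, (i - j) + (j - i) = k + 1 :=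
      ⟨(i - j) + (j - i) - 1, by omega⟩
    rw [hk]
    exact mul_nonneg (hs k) (sq_nonneg _)

theorem toeplitzEnergy_nonneg {s : ℕ → ℝ} (hs : ∀ k, 0 ≤ s (k + 1)) (M : ℕ) (a : ℕ → ℝ) :
    0 ≤ toeplitzEnergy s M a :=
  Finset.sum_nonneg fun i _ => Finset.sum_nonneg fun j _ => toeplitz_summand_nonneg hs a i j

theorem sum_range_shift_le {f : ℕ → ℝ} (hf : ∀ x, 0 ≤ f x) {i n M : ℕ} (h : i + n ≤ M) :
    ∑ p ∈ Finset.range n, f (i + p) ≤ ∑ x ∈ Finset.range M, f x := by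
  have := Finset.sum_Ico_eq_sum_range f i (i + n)
  rw [Nat.add_sub_cancel_left] at this
  rw [← this]
  refine Finset.sum_le_sum_of_subset_of_nonneg (fun x hx => ?_) fun x _ _ => hf x
  simp only [Finset.mem_Ico, Finset.mem_range] at hx ⊢
  omega

/-- Points of two adjacent blocks of length n are at distance between 1 and 2n - 1, so each pair
enters the energy with weight at least c (2n)^(-(1 + β)). -/
theorem sum_block_le_energy {β c : ℝ} (hβ : 0 < β) (hc : 0 < c) {s : ℕ → ℝ}
    (hs : ∀ k : ℕ, c * ((k : ℝ) + 1) ^ (-(1 + β)) ≤ s (k + 1)) (a : ℕ → ℝ) {i n M : ℕ}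
    (h : i + 2 * n ≤ M) :
    ∑ p ∈ Finset.range n, ∑ q ∈ Finset.range n, (a (i + p) - a (i + n + q)) ^ 2 ≤
      (2 * n : ℝ) ^ (1 + β) / c * toeplitzEnergy s M a := by
  rcases Nat.eq_zero_or_pos n with rfl | hn
  · simp [Real.zero_rpow (by linarith : 1 + β ≠ 0)]
  have hn' : (0 : ℝ) < n := by exact_mod_cast hn
  have hs0 : ∀ k, 0 ≤ s (k + 1) := fun k =>
    le_trans (mul_nonneg hc.le (Real.rpow_nonneg (by positivity) _)) (hs k)
  have h1 : ∀ p ∈ Finset.range n, ∀ q ∈ Finset.range n,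
      c * (2 * n : ℝ) ^ (-(1 + β)) * (a (i + p) - a (i + n + q)) ^ 2 ≤
        s ((i + p) - (i + n + q) + ((i + n + q) - (i + p))) * (a (i + p) - a (i + n + q)) ^ 2 := by
    intro p hp q hq
    rw [Finset.mem_range] at hp hq
    refine mul_le_mul_of_nonneg_right ?_ (sq_nonneg _)
    obtain ⟨k, hk⟩ : ∃ k, (i + p) - (i + n + q) + ((i + n + q) - (i + p)) = k + 1 :=
      ⟨n + q - p - 1, by omega⟩
    rw [hk]
    refine le_trans ?_ (hs k)
    refine mul_le_mul_of_nonneg_left ?_ hc.le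
    refine Real.rpow_le_rpow_of_nonpos (by positivity) ?_ (by linarith)
    have : k + 1 ≤ 2 * n := by omega
    exact_mod_cast this
  have h2 : c * (2 * n : ℝ) ^ (-(1 + β)) *
      ∑ p ∈ Finset.range n, ∑ q ∈ Finset.range n, (a (i + p) - a (i + n + q)) ^ 2 ≤
        toeplitzEnergy s M a := by
    simp only [Finset.mul_sum]
    calc _ ≤ ∑ p ∈ Finset.range n, ∑ q ∈ Finset.range n,
          s ((i + p) - (i + n + q) + ((i + n + q) - (i + p))) *
            (a (i + p) - a (i + n + q)) ^ 2 :=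
          Finset.sum_le_sum fun p hp => Finset.sum_le_sum fun q hq => h1 p hp q hq
      _ ≤ ∑ p ∈ Finset.range n, ∑ y ∈ Finset.range M,
          s ((i + p) - y + (y - (i + p))) * (a (i + p) - a y) ^ 2 :=
          Finset.sum_le_sum fun p _ => sum_range_shift_le
            (f := fun y => s ((i + p) - y + (y - (i + p))) * (a (i + p) - a y) ^ 2)
            (fun y => toeplitz_summand_nonneg hs0 a _ y) (by omega)
      _ ≤ _ := sum_range_shift_le
            (f := fun x => ∑ y ∈ Finset.range M, s (x - y + (y - x)) * (a x - a y) ^ 2)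
            (fun x => Finset.sum_nonneg fun y _ => toeplitz_summand_nonneg hs0 a x y) (by omega)
  have h3 : 0 < (2 * n : ℝ) ^ (1 + β) := by positivity
  rw [Real.rpow_neg (by positivity)] at h2
  rw [div_mul_eq_mul_div, le_div_iff₀ hc]
  calc _ = (2 * n : ℝ) ^ (1 + β) * (c * ((2 * n : ℝ) ^ (1 + β))⁻¹ *
      ∑ p ∈ Finset.range n, ∑ q ∈ Finset.range n, (a (i + p) - a (i + n + q)) ^ 2) := by
        field_simp
    _ ≤ _ := mul_le_mul_of_nonneg_left h2 h3.le

theorem sq_sum_sub_sum_le (n : ℕ) (b c : ℕ → ℝ) :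
    ((n : ℝ) * (∑ p ∈ Finset.range n, b p - ∑ q ∈ Finset.range n, c q)) ^ 2 ≤
      (n : ℝ) ^ 2 * ∑ p ∈ Finset.range n, ∑ q ∈ Finset.range n, (b p - c q) ^ 2 := by
  have h1 : (n : ℝ) * (∑ p ∈ Finset.range n, b p - ∑ q ∈ Finset.range n, c q) =
      ∑ x ∈ Finset.range n ×ˢ Finset.range n, (b x.1 - c x.2) := by
    rw [Finset.sum_product]
    simp [Finset.sum_sub_distrib, ← Finset.mul_sum]
    ring
  rw [h1, ← Finset.sum_product (f := fun x => (b x.1 - c x.2) ^ 2)]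
  have := sq_sum_le_card_mul_sum_sq (s := Finset.range n ×ˢ Finset.range n)
    (f := fun x => b x.1 - c x.2)
  rw [Finset.card_product, Finset.card_range] at this
  push_cast at this
  rw [← sq] at this
  exact this

/-- Dyadic averaging. The mean over a block starting at i and the mean over the next block of the
same length 2^j differ by at most K q^j, where K² is a multiple of the energy. The mean over the
doubled block is half the sum of the two, so a_i is compared with longer and longer means through a
geometric series, until the next block lies wholly where a vanishes. -/
theorem sq_le_energy_of_lower_bound {β c : ℝ} (hβ : 1 < β) (hc : 0 < c) {s : ℕ → ℝ}
    (hs : ∀ k : ℕ, c * ((k : ℝ) + 1) ^ (-(1 + β)) ≤ s (k + 1)) :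
    ∃ C : ℝ, 0 < C ∧ ∀ (m : ℕ) (a : ℕ → ℝ), (∀ i, m ≤ i → a i = 0) →
      ∀ i, a i ^ 2 ≤ C * (m : ℝ) ^ (β - 1) * toeplitzEnergy s (5 * m) a := by
  -- The growth of the mean differences per doubling. Here β > 1 enters: q > 1 makes the geometric
  -- sum comparable to its largest term, and (q^J)² is of order m^(β - 1).
  set q : ℝ := 2 ^ ((β - 1) / 2) with hq
  have hq1 : 1 < q := Real.one_lt_rpow (by norm_num) (by linarith)
  have hs0 : ∀ k, 0 ≤ s (k + 1) := fun k =>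
    le_trans (mul_nonneg hc.le (Real.rpow_nonneg (by positivity) _)) (hs k)
  have hr : 0 < 1 + 1 / (q - 1) := by
    have : 0 < 1 / (q - 1) := one_div_pos.2 (by linarith)
    linarith
  refine ⟨2 ^ (1 + β) / c * (1 + 1 / (q - 1)) ^ 2 * 2 ^ (β - 1), by positivity,
    fun m a ha i => ?_⟩
  set E := toeplitzEnergy s (5 * m) a with hE
  have hE0 : 0 ≤ E := toeplitzEnergy_nonneg hs0 _ _
  rcases le_or_gt m i with him | him
  · rw [ha i him, zero_pow two_ne_zero]
    positivity
  set K : ℝ := Real.sqrt (2 ^ (1 + β) / c * E) with hK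
  set A : ℕ → ℝ := fun n => (∑ p ∈ Finset.range n, a (i + p)) / n with hA
  set A' : ℕ → ℝ := fun n => (∑ p ∈ Finset.range n, a (i + n + p)) / n with hA'
  have hblock : ∀ j : ℕ, i + 2 * 2 ^ j ≤ 5 * m → |A (2 ^ j) - A' (2 ^ j)| ≤ K * q ^ j := by
    intro j hj
    have h1 := sum_block_le_energy (by linarith) hc hs a hj
    have h2 := sq_sum_sub_sum_le (2 ^ j) (fun p => a (i + p)) (fun p => a (i + 2 ^ j + p))
    set n : ℕ := 2 ^ j with hn
    have hn0 : (0 : ℝ) < n := by rw [hn]; positivity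
    have h3 : A n - A' n = (n * (∑ p ∈ Finset.range n, a (i + p) -
        ∑ p ∈ Finset.range n, a (i + n + p))) / (n : ℝ) ^ 2 := by
      simp only [hA, hA']
      field_simp
    have h4 : (2 * n : ℝ) ^ (1 + β) = 2 ^ (1 + β) * (n ^ 2 * (q ^ j) ^ 2) := by
      rw [Real.mul_rpow (by norm_num) hn0.le]
      congr 1
      have h5 : (q ^ j) ^ 2 = (n : ℝ) ^ (β - 1) := by
        rw [hq, hn, ← pow_mul, ← Real.rpow_natCast, ← Real.rpow_mul (by norm_num)]
        push_cast
        rw [← Real.rpow_natCast 2 j, ← Real.rpow_mul (by norm_num)]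
        congr 1
        ring
      rw [h5, ← Real.rpow_natCast (n : ℝ) 2, ← Real.rpow_add hn0]
      congr 1
      push_cast
      ring
    rw [← Real.sqrt_sq (show 0 ≤ q ^ j by positivity), hK, ← Real.sqrt_mul (by positivity)]
    refine Real.abs_le_sqrt ?_
    rw [h3, div_pow, div_le_iff₀ (by positivity)]
    refine h2.trans ?_
    calc (n : ℝ) ^ 2 * ∑ p ∈ Finset.range n, ∑ r ∈ Finset.range n, (a (i + p) - a (i + n + r)) ^ 2
        ≤ (n : ℝ) ^ 2 * ((2 * n : ℝ) ^ (1 + β) / c * E) := by gcongr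
      _ = _ := by rw [h4]; ring
  have hstep : ∀ j : ℕ, A (2 ^ (j + 1)) = (A (2 ^ j) + A' (2 ^ j)) / 2 := by
    intro j
    simp only [hA, hA']
    rw [pow_succ, mul_two, Finset.sum_range_add]
    simp only [add_assoc]
    push_cast
    field_simp
    ring
  have hind : ∀ J : ℕ, i + 2 ^ J ≤ 5 * m → |a i| ≤ |A (2 ^ J)| + K * ((q ^ J - 1) / (q - 1)) := by
    intro J
    induction J with
    | zero => intro _; simp [hA]
    | succ J ih =>
      intro hJ
      have h1 := hblock J (by rw [pow_succ] at hJ; omega)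
      have h2 := ih (by rw [pow_succ] at hJ; omega)
      have h3 : |A (2 ^ J)| ≤ |A (2 ^ (J + 1))| + K * q ^ J := by
        have h4 : A (2 ^ J) = A (2 ^ (J + 1)) + (A (2 ^ J) - A' (2 ^ J)) / 2 := by
          rw [hstep]; ring
        rw [h4]
        refine (abs_add_le _ _).trans ?_
        have h6 : |(A (2 ^ J) - A' (2 ^ J)) / 2| = |A (2 ^ J) - A' (2 ^ J)| / 2 := by
          rw [abs_div (A (2 ^ J) - A' (2 ^ J)), abs_two]
        rw [h6]
        have := abs_nonneg (A (2 ^ J) - A' (2 ^ J))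
        linarith
      have h5 : (q ^ (J + 1) - 1) / (q - 1) = q ^ J + (q ^ J - 1) / (q - 1) := by
        have : q - 1 ≠ 0 := by linarith
        field_simp
        ring
      rw [h5]
      linarith
  -- The lower bound on 2^J puts the neighbouring block beyond m. The upper bound keeps both blocks
  -- inside the window, since i + 2 · 2^J < m + 4m; hence the length 5m.
  obtain ⟨J, hJ1, hJ2⟩ : ∃ J : ℕ, m ≤ 2 ^ J ∧ 2 ^ J ≤ 2 * m := by
    refine ⟨Nat.clog 2 m, Nat.le_pow_clog (by norm_num) m, ?_⟩
    rcases Nat.lt_or_ge 1 m with h | h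
    · have h1 := Nat.pow_pred_clog_lt_self (b := 2) (by norm_num) h
      have h2 : 0 < Nat.clog 2 m := Nat.clog_pos (by norm_num) h
      obtain ⟨k, hk⟩ : ∃ k, Nat.clog 2 m = k + 1 := ⟨Nat.clog 2 m - 1, by omega⟩
      rw [hk] at h1 ⊢
      simp only [Nat.pred_succ] at h1
      rw [pow_succ]
      omega
    · have : m = 1 := by omega
      subst this
      simp
  have hlast : |A (2 ^ J)| ≤ K * q ^ J := by
    have h1 : A' (2 ^ J) = 0 := by
      simp only [hA']
      rw [Finset.sum_eq_zero, zero_div]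
      intro p _
      exact ha _ (by omega)
    have := hblock J (by omega)
    rwa [h1, sub_zero] at this
  have hfin : |a i| ≤ K * q ^ J * (1 + 1 / (q - 1)) := by
    have h1 := hind J (by omega)
    have h2 : (q ^ J - 1) / (q - 1) ≤ q ^ J * (1 / (q - 1)) := by
      rw [mul_one_div]
      gcongr
      · linarith
    have h3 : K * ((q ^ J - 1) / (q - 1)) ≤ K * (q ^ J * (1 / (q - 1))) := by gcongr
    linarith
  have hqJ : (q ^ J) ^ 2 ≤ 2 ^ (β - 1) * (m : ℝ) ^ (β - 1) := by
    have h5 : (q ^ J) ^ 2 = ((2 : ℝ) ^ J) ^ (β - 1) := by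
      rw [hq, ← pow_mul, ← Real.rpow_natCast, ← Real.rpow_mul (by norm_num),
        ← Real.rpow_natCast 2 J, ← Real.rpow_mul (by norm_num)]
      congr 1
      push_cast
      ring
    rw [h5, ← Real.mul_rpow (by norm_num) (by positivity)]
    refine Real.rpow_le_rpow (by positivity) ?_ (by linarith)
    exact_mod_cast hJ2
  calc a i ^ 2 = |a i| ^ 2 := (sq_abs _).symm
    _ ≤ (K * q ^ J * (1 + 1 / (q - 1))) ^ 2 := by gcongr
    _ = 2 ^ (1 + β) / c * E * (q ^ J) ^ 2 * (1 + 1 / (q - 1)) ^ 2 := by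
      rw [mul_pow, mul_pow, hK, Real.sq_sqrt (by positivity)]
    _ ≤ 2 ^ (1 + β) / c * E * (2 ^ (β - 1) * (m : ℝ) ^ (β - 1)) * (1 + 1 / (q - 1)) ^ 2 := by
      gcongr
    _ = _ := by ring

/-- Serves β = 2, where only neighbours interact: telescope from i to the zero at m and apply
Cauchy-Schwarz. The factor m is m^(β - 1) for β = 2. -/
theorem sq_le_energy_of_one_pos {s : ℕ → ℝ} (hs : ∀ k, 0 ≤ s (k + 1)) (h1 : 0 < s 1)
    (m : ℕ) (a : ℕ → ℝ) (ha : ∀ i, m ≤ i → a i = 0) (i : ℕ) :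
    a i ^ 2 ≤ (1 / s 1) * m * toeplitzEnergy s (5 * m) a := by
  have hE0 : 0 ≤ toeplitzEnergy s (5 * m) a := toeplitzEnergy_nonneg hs _ _
  rcases le_or_gt m i with him | him
  · rw [ha i him, zero_pow two_ne_zero]
    positivity
  have h2 : s 1 * ∑ k ∈ Finset.range m, (a k - a (k + 1)) ^ 2 ≤ toeplitzEnergy s (5 * m) a := by
    rw [Finset.mul_sum]
    calc _ ≤ ∑ k ∈ Finset.range m, ∑ j ∈ Finset.range (5 * m),
          s ((k - j) + (j - k)) * (a k - a j) ^ 2 := by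
          refine Finset.sum_le_sum fun k hk => ?_
          rw [Finset.mem_range] at hk
          have := Finset.single_le_sum
            (f := fun j => s ((k - j) + (j - k)) * (a k - a j) ^ 2)
            (fun j _ => toeplitz_summand_nonneg hs a k j)
            (Finset.mem_range.2 (by omega : k + 1 < 5 * m))
          simpa using this
      _ ≤ _ := Finset.sum_le_sum_of_subset_of_nonneg
          (Finset.range_subset_range.2 (by omega)) fun k _ _ =>
            Finset.sum_nonneg fun j _ => toeplitz_summand_nonneg hs a k j
  have h3 : a i = ∑ k ∈ Finset.Ico i m, (a k - a (k + 1)) := by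
    have := Finset.sum_Ico_sub a him.le
    rw [ha m le_rfl] at this
    rw [← neg_inj, ← Finset.sum_neg_distrib]
    simp only [neg_sub]
    linarith
  have h4 : a i ^ 2 ≤ m * ∑ k ∈ Finset.range m, (a k - a (k + 1)) ^ 2 := by
    calc a i ^ 2 = (∑ k ∈ Finset.Ico i m, (a k - a (k + 1))) ^ 2 := by rw [← h3]
      _ ≤ (Finset.Ico i m).card * ∑ k ∈ Finset.Ico i m, (a k - a (k + 1)) ^ 2 :=
        sq_sum_le_card_mul_sum_sq
      _ ≤ _ := by
        gcongr
        · simp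
        · intro x
          simp
  calc a i ^ 2 ≤ m * ∑ k ∈ Finset.range m, (a k - a (k + 1)) ^ 2 := h4
    _ = (1 / s 1) * m * (s 1 * ∑ k ∈ Finset.range m, (a k - a (k + 1)) ^ 2) := by
      field_simp
    _ ≤ _ := by gcongr

theorem sq_le_toeplitzEnergy {β : ℝ} (h1 : 1 < β) (h2 : β ≤ 2) :
    ∃ C : ℝ, 0 < C ∧ ∀ (m : ℕ) (a : ℕ → ℝ), (∀ i, m ≤ i → a i = 0) →
      ∀ i, a i ^ 2 ≤ C * (m : ℝ) ^ (β - 1) * toeplitzEnergy (toeplitzCoeff β) (5 * m) a := by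
  rcases h2.lt_or_eq with h | rfl
  · obtain ⟨c, hc, hs⟩ := toeplitzCoeff_lower_bound h1 h
    exact sq_le_energy_of_lower_bound h1 hc hs
  · have h3 : 0 < toeplitzCoeff 2 1 := by rw [toeplitzCoeff_one]; norm_num
    refine ⟨1 / toeplitzCoeff 2 1, by positivity, fun m a ha i => ?_⟩
    rw [show (2 : ℝ) - 1 = 1 by norm_num, Real.rpow_one]
    exact sq_le_energy_of_one_pos (toeplitzCoeff_succ_nonneg h1 h2) h3 m a ha i

/-! ### Stability of the Crank-Nicolson scheme -/

/-- Extension by zero of a vector to a sequence. -/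
noncomputable def seqExt {n : ℕ} (e : Fin n → ℝ) (i : ℕ) : ℝ :=
  if h : i < n then e ⟨i, h⟩ else 0

theorem seqExt_of_le {n : ℕ} (e : Fin n → ℝ) {i : ℕ} (h : n ≤ i) : seqExt e i = 0 :=
  dif_neg (by omega)

theorem seqExt_val {n : ℕ} (e : Fin n → ℝ) (i : Fin n) : seqExt e i = e i :=
  dif_pos i.2

theorem sum_range_seqExt {n M : ℕ} (h : n ≤ M) (e : Fin n → ℝ) (F : ℕ → ℝ) :
    ∑ i ∈ Finset.range M, F i * seqExt e i = ∑ i : Fin n, F i * e i := by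
  rw [← Finset.sum_subset (Finset.range_subset_range.2 h) (fun i _ hi => by
    rw [seqExt_of_le e (by simpa using hi), mul_zero]), Finset.sum_range]
  simp [seqExt_val]

/-- The range M is left free so that the form can be read on a window padded with zeros, as the
Sobolev inequality requires. -/
theorem dotProduct_wsgdMatrix (γ : ℝ) (m : ℕ) (e : Fin (m - 1) → ℝ) {M : ℕ} (hM : m - 1 ≤ M) :
    e ⬝ᵥ (wsgdMatrix γ m + (wsgdMatrix γ m)ᵀ) *ᵥ e =
      ∑ i ∈ Finset.range M, ∑ j ∈ Finset.range M,
        toeplitzCoeff γ ((i - j) + (j - i)) * seqExt e i * seqExt e j := by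
  have h1 : ∀ i, ∑ j ∈ Finset.range M, toeplitzCoeff γ ((i - j) + (j - i)) * seqExt e i * seqExt e j
      = (∑ j : Fin (m - 1), toeplitzCoeff γ ((i - j) + (j - i)) * e j) * seqExt e i := by
    intro i
    rw [sum_range_seqExt hM, Finset.sum_mul]
    exact Finset.sum_congr rfl fun j _ => by ring
  simp_rw [h1]
  rw [sum_range_seqExt hM]
  simp only [dotProduct, Matrix.mulVec, wsgdMatrix_add_transpose]
  exact Finset.sum_congr rfl fun i _ => mul_comm _ _

theorem matD_isSymm (α β Kα Kβ L : ℝ) (m : ℕ) (τ : ℝ) : (matD α β Kα Kβ L m τ).IsSymm := by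
  unfold matD Matrix.IsSymm
  simp [Matrix.transpose_add, add_comm]

theorem rieszConst_pos {α : ℝ} (h0 : 0 < α) (h1 : α < 1) : 0 < rieszConst α := by
  have : 0 < Real.cos (Real.pi * α / 2) := Real.cos_pos_of_mem_Ioo
    ⟨by nlinarith [Real.pi_pos], by nlinarith [Real.pi_pos]⟩
  unfold rieszConst
  positivity

theorem rieszConst_neg {β : ℝ} (h1 : 1 < β) (h2 : β ≤ 2) : rieszConst β < 0 := by
  have : Real.cos (Real.pi * β / 2) < 0 := Real.cos_neg_of_pi_div_two_lt_of_lt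
    (by nlinarith [Real.pi_pos]) (by nlinarith [Real.pi_pos])
  exact div_neg_of_pos_of_neg one_pos (by linarith)

/-- The α part has a nonnegative coefficient and a nonnegative form, so it is dropped. In the β part
both the coefficient and the form are nonpositive, and their product carries the energy. -/
theorem mul_toeplitzEnergy_le_form {α β Kα Kβ L : ℝ} (hα0 : 0 < α) (hα1 : α < 1) (hβ1 : 1 < β)
    (hβ2 : β ≤ 2) (hKα : 0 ≤ Kα) (hKβ : 0 ≤ Kβ) (hL : 0 ≤ L) {τ : ℝ} (hτ : 0 ≤ τ) (m : ℕ)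
    (e : Fin (m - 1) → ℝ) :
    -mu β Kβ (L / m) τ / 2 * toeplitzEnergy (toeplitzCoeff β) (5 * m) (seqExt e) ≤
      e ⬝ᵥ matD α β Kα Kβ L m τ *ᵥ e := by
  have hmα : 0 ≤ mu α Kα (L / m) τ := by
    have := rieszConst_pos hα0 hα1
    have : 0 ≤ (L / m) ^ α := Real.rpow_nonneg (by positivity) _
    unfold mu
    positivity
  have hmβ : mu β Kβ (L / m) τ ≤ 0 := by
    have h1 := rieszConst_neg hβ1 hβ2
    have h2 : 0 ≤ (L / m) ^ β := Real.rpow_nonneg (by positivity) _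
    exact div_nonpos_of_nonpos_of_nonneg
      (mul_nonpos_of_nonneg_of_nonpos (by positivity) h1.le) (by positivity)
  have hm : m - 1 ≤ 5 * m := by omega
  have hA : 0 ≤ e ⬝ᵥ (wsgdMatrix α m + (wsgdMatrix α m)ᵀ) *ᵥ e := by
    rw [dotProduct_wsgdMatrix α m e hm]
    have h1 := toeplitz_form_le (fun k => -toeplitzCoeff α k) (fun K => by
      have := halfRowSum_toeplitzCoeff_nonneg hα0 hα1 K
      simp only [halfRowSum, Finset.sum_neg_distrib] at this ⊢
      linarith) (5 * m) (seqExt e)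
    have h2 : 0 ≤ toeplitzEnergy (fun k => -toeplitzCoeff α k) (5 * m) (seqExt e) :=
      toeplitzEnergy_nonneg (fun k => by
        have := toeplitzCoeff_succ_nonpos hα0 hα1 k
        linarith) _ _
    rw [toeplitzEnergy] at h2
    simp only [neg_mul, Finset.sum_neg_distrib] at h1 h2
    linarith
  have hB : e ⬝ᵥ (wsgdMatrix β m + (wsgdMatrix β m)ᵀ) *ᵥ e ≤
      -(1 / 2) * toeplitzEnergy (toeplitzCoeff β) (5 * m) (seqExt e) := by
    rw [dotProduct_wsgdMatrix β m e hm]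
    exact toeplitz_form_le _ (halfRowSum_toeplitzCoeff_nonpos hβ1 hβ2) _ _
  rw [matD, Matrix.add_mulVec, Matrix.smul_mulVec, Matrix.smul_mulVec, dotProduct_add,
    dotProduct_smul, dotProduct_smul, smul_eq_mul, smul_eq_mul]
  have h3 := mul_nonneg hmα hA
  have h4 := mul_le_mul_of_nonpos_left hB hmβ
  linarith

theorem dotProduct_matD_nonneg {α β Kα Kβ L : ℝ} (hα0 : 0 < α) (hα1 : α < 1) (hβ1 : 1 < β)
    (hβ2 : β ≤ 2) (hKα : 0 ≤ Kα) (hKβ : 0 ≤ Kβ) (hL : 0 ≤ L) {τ : ℝ} (hτ : 0 ≤ τ) (m : ℕ)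
    (e : Fin (m - 1) → ℝ) : 0 ≤ e ⬝ᵥ matD α β Kα Kβ L m τ *ᵥ e := by
  refine le_trans ?_ (mul_toeplitzEnergy_le_form hα0 hα1 hβ1 hβ2 hKα hKβ hL hτ m e)
  refine mul_nonneg ?_ (toeplitzEnergy_nonneg (toeplitzCoeff_succ_nonneg hβ1 hβ2) _ _)
  have h1 := rieszConst_neg hβ1 hβ2
  have h2 : 0 ≤ (L / m) ^ β := Real.rpow_nonneg (by positivity) _
  have : mu β Kβ (L / m) τ ≤ 0 := div_nonpos_of_nonpos_of_nonneg
    (mul_nonpos_of_nonneg_of_nonpos (by positivity) h1.le) (by positivity)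
  linarith

/-- If (1 + D)z = 0, then 0 = |z|² + zᵀDz ≥ |z|². -/
theorem isUnit_one_add_of_form_nonneg {n : ℕ} {D : Matrix (Fin n) (Fin n) ℝ}
    (hD : ∀ e, 0 ≤ e ⬝ᵥ D *ᵥ e) : IsUnit (1 + D) := by
  rw [← Matrix.mulVec_injective_iff_isUnit]
  intro x y hxy
  have h1 : (1 + D) *ᵥ (x - y) = 0 := by
    rw [Matrix.mulVec_sub, sub_eq_zero]
    exact hxy
  have h2 : (x - y) ⬝ᵥ ((1 + D) *ᵥ (x - y)) = 0 := by rw [h1, dotProduct_zero]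
  rw [Matrix.add_mulVec, Matrix.one_mulVec, dotProduct_add] at h2
  have h3 : 0 ≤ (x - y) ⬝ᵥ (x - y) := Finset.sum_nonneg fun i _ => mul_self_nonneg _
  have h4 : (x - y) ⬝ᵥ (x - y) = 0 := by linarith [hD (x - y)]
  exact sub_eq_zero.1 (dotProduct_self_eq_zero.1 h4)

/-- Pair (y - x) + D(y + x) = r with y - x. By symmetry the D term is the difference of the two
forms, and |y - x|² absorbs the right side by Young's inequality. -/
theorem form_le_of_crankNicolson_step {n : ℕ} {D : Matrix (Fin n) (Fin n) ℝ} (hD : D.IsSymm)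
    {x y r : Fin n → ℝ} (h : (1 + D) *ᵥ y = (1 - D) *ᵥ x + r) :
    y ⬝ᵥ D *ᵥ y ≤ x ⬝ᵥ D *ᵥ x + r ⬝ᵥ r / 4 := by
  have h1 : y - x + D *ᵥ (y + x) = r := by
    rw [Matrix.add_mulVec, Matrix.sub_mulVec, Matrix.one_mulVec, Matrix.one_mulVec] at h
    rw [Matrix.mulVec_add]
    have : y + D *ᵥ y + D *ᵥ x - x = r := by rw [h]; abel
    rw [← this]
    abel
  have h2 : (y - x) ⬝ᵥ D *ᵥ (y + x) = y ⬝ᵥ D *ᵥ y - x ⬝ᵥ D *ᵥ x := by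
    have h3 : x ⬝ᵥ D *ᵥ y = y ⬝ᵥ D *ᵥ x := by
      rw [Matrix.dotProduct_mulVec, dotProduct_comm, ← Matrix.mulVec_transpose, hD.eq]
    rw [Matrix.mulVec_add, dotProduct_add, sub_dotProduct, sub_dotProduct, h3]
    ring
  have h4 : (y - x) ⬝ᵥ (y - x) + (y - x) ⬝ᵥ D *ᵥ (y + x) = (y - x) ⬝ᵥ r := by
    rw [← dotProduct_add, h1]
  have h5 : (y - x) ⬝ᵥ r ≤ (y - x) ⬝ᵥ (y - x) + r ⬝ᵥ r / 4 := by
    simp only [dotProduct]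
    rw [Finset.sum_div, ← Finset.sum_add_distrib]
    refine Finset.sum_le_sum fun i _ => ?_
    nlinarith [sq_nonneg ((y - x) i - r i / 2)]
  linarith

/-- Summing the one-step estimate gives Q(eⁿ) ≤ nτ · τmδ²/4 ≤ Tτmδ²/4. Since Q dominates a multiple
of τ h^(-β) times the energy, τ drops out, and the Sobolev factor m^(β - 1) turns m h^β into L^β. -/
theorem norm_le_of_crankNicolson {α β Kα Kβ L T : ℝ} (hα0 : 0 < α) (hα1 : α < 1) (hβ1 : 1 < β)
    (hβ2 : β ≤ 2) (hKα : 0 ≤ Kα) (hKβ : 0 < Kβ) (hL : 0 < L) (hT : 0 < T) :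
    ∃ C : ℝ, 0 < C ∧ ∀ m N : ℕ, 0 < m → 0 < N → ∀ (e ρ : ℕ → Fin (m - 1) → ℝ) (δ : ℝ),
      e 0 = 0 →
      (∀ n < N, (1 + matD α β Kα Kβ L m (T / N)) *ᵥ e (n + 1) =
        (1 - matD α β Kα Kβ L m (T / N)) *ᵥ e n + (T / N) • ρ n) →
      (∀ n < N, ∀ i, |ρ n i| ≤ δ) → 0 ≤ δ → ∀ n ≤ N, ‖e n‖ ≤ C * δ := by
  obtain ⟨C₀, hC₀, hemb⟩ := sq_le_toeplitzEnergy hβ1 hβ2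
  have hc := rieszConst_neg hβ1 hβ2
  set κ : ℝ := Kβ * (-rieszConst β) with hκ
  have hκ0 : 0 < κ := mul_pos hKβ (by linarith)
  refine ⟨Real.sqrt (C₀ * T * L ^ β / κ), by positivity, ?_⟩
  intro m N hm hN e ρ δ he0 hstep hρ hδ n hn
  have hmR : (0 : ℝ) < m := by exact_mod_cast hm
  have hNR : (0 : ℝ) < N := by exact_mod_cast hN
  set τ : ℝ := T / N with hτ
  have hτ0 : 0 < τ := by positivity
  set D := matD α β Kα Kβ L m τ with hD
  have hQ : ∀ n ≤ N, e n ⬝ᵥ D *ᵥ e n ≤ n * (τ ^ 2 * (m * δ ^ 2) / 4) := by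
    intro n
    induction n with
    | zero => intro _; simp [he0]
    | succ n ih =>
      intro hn
      have h1 := form_le_of_crankNicolson_step (matD_isSymm α β Kα Kβ L m τ) (hstep n (by omega))
      have h2 : (τ • ρ n) ⬝ᵥ (τ • ρ n) ≤ τ ^ 2 * (m * δ ^ 2) := by
        rw [smul_dotProduct, dotProduct_smul, smul_eq_mul, smul_eq_mul, ← mul_assoc, ← sq]
        refine mul_le_mul_of_nonneg_left ?_ (sq_nonneg _)
        calc ρ n ⬝ᵥ ρ n ≤ ∑ _i : Fin (m - 1), δ ^ 2 := by
              refine Finset.sum_le_sum fun i _ => ?_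
              rw [← sq, ← sq_abs]
              have := hρ n (by omega) i
              gcongr
          _ = ((m - 1 : ℕ) : ℝ) * δ ^ 2 := by simp
          _ ≤ m * δ ^ 2 := by
              gcongr
              omega
      have h3 := ih (by omega)
      push_cast
      linarith
  have hE := mul_toeplitzEnergy_le_form hα0 hα1 hβ1 hβ2 hKα hKβ.le hL.le hτ0.le m (e n)
  set E := toeplitzEnergy (toeplitzCoeff β) (5 * m) (seqExt (e n)) with hEdef
  have hLm : 0 < (L / m) ^ β := by positivity
  have hE2 : E ≤ T * m * (L / m) ^ β * δ ^ 2 / κ := by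
    have h1 : -mu β Kβ (L / m) τ / 2 = τ * κ / (4 * (L / m) ^ β) := by
      rw [mu, hκ]
      field_simp
      ring
    rw [h1] at hE
    have h2 := hE.trans (hQ n hn)
    have h3 : (n : ℝ) * (τ ^ 2 * (m * δ ^ 2) / 4) ≤ T * τ * (m * δ ^ 2) / 4 := by
      have h4 : (n : ℝ) * τ ≤ T := by
        calc (n : ℝ) * τ ≤ N * τ := by gcongr
          _ = T := by rw [hτ]; field_simp
      calc (n : ℝ) * (τ ^ 2 * (m * δ ^ 2) / 4) = (n * τ) * τ * (m * δ ^ 2) / 4 := by ring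
        _ ≤ _ := by gcongr
    have h5 := h2.trans h3
    rw [div_mul_eq_mul_div, div_le_iff₀ (by positivity)] at h5
    rw [le_div_iff₀ hκ0]
    have h6 : τ * (E * κ) ≤ τ * (T * m * (L / m) ^ β * δ ^ 2) := by linarith
    exact le_of_mul_le_mul_left h6 hτ0
  have hfin : ∀ i, (e n i) ^ 2 ≤ C₀ * T * L ^ β / κ * δ ^ 2 := by
    intro i
    have h1 := hemb m (seqExt (e n)) (fun i hi => seqExt_of_le _ (by omega)) i
    rw [seqExt_val] at h1
    refine h1.trans ?_
    have h2 : (m : ℝ) ^ (β - 1) * (m * (L / m) ^ β) = L ^ β := by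
      rw [Real.div_rpow hL.le hmR.le, Real.rpow_sub_one hmR.ne']
      have : (m : ℝ) ^ β ≠ 0 := (Real.rpow_pos_of_pos hmR _).ne'
      field_simp
    calc C₀ * (m : ℝ) ^ (β - 1) * E
        ≤ C₀ * (m : ℝ) ^ (β - 1) * (T * m * (L / m) ^ β * δ ^ 2 / κ) := by gcongr
      _ = C₀ * T * ((m : ℝ) ^ (β - 1) * (m * (L / m) ^ β)) / κ * δ ^ 2 := by ring
      _ = _ := by rw [h2]
  rw [pi_norm_le_iff_of_nonneg (by positivity)]
  intro i
  rw [Real.norm_eq_abs, ← Real.sqrt_sq hδ, ← Real.sqrt_mul (by positivity)]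
  exact Real.abs_le_sqrt (hfin i)

/-! ### The symbol of the weighted and shifted Grünwald operator -/

/-- `f z = 1 + a z + O(z²)` as `z → 0`, `z ≠ 0`. -/
def FirstOrderExpansion (f : ℂ → ℂ) (a : ℂ) : Prop :=
  (fun z => f z - 1 - a * z) =O[nhdsWithin 0 {0}ᶜ] fun z => z ^ 2

theorem isBigO_sq_id : (fun z : ℂ => z ^ 2) =O[nhdsWithin 0 {0}ᶜ] fun z => z := by
  refine Asymptotics.IsBigO.of_bound 1 ?_
  filter_upwards [nhdsWithin_le_nhds (Metric.ball_mem_nhds (0 : ℂ) one_pos)] with z hz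
  rw [norm_pow, sq]
  have : ‖z‖ < 1 := by simpa using hz
  gcongr

theorem tendsto_id_punctured_zero :
    Filter.Tendsto (fun z : ℂ => z) (nhdsWithin 0 {0}ᶜ) (nhds 0) :=
  Filter.tendsto_id.mono_left nhdsWithin_le_nhds

theorem FirstOrderExpansion.isBigO_sub_one {f : ℂ → ℂ} {a : ℂ} (hf : FirstOrderExpansion f a) :
    (fun z => f z - 1) =O[nhdsWithin 0 {0}ᶜ] fun z => z := by
  have h1 := (hf.trans isBigO_sq_id).add
    (Asymptotics.isBigO_const_mul_self a (fun z : ℂ => z) (nhdsWithin 0 {0}ᶜ))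
  simpa using h1

theorem FirstOrderExpansion.tendsto_one {f : ℂ → ℂ} {a : ℂ} (hf : FirstOrderExpansion f a) :
    Filter.Tendsto f (nhdsWithin 0 {0}ᶜ) (nhds 1) := by
  have := hf.isBigO_sub_one.trans_tendsto tendsto_id_punctured_zero
  simpa using this.add_const 1

theorem FirstOrderExpansion.mul {f g : ℂ → ℂ} {a b : ℂ} (hf : FirstOrderExpansion f a)
    (hg : FirstOrderExpansion g b) : FirstOrderExpansion (fun z => f z * g z) (a + b) := by
  have h1 : (fun z => f z * (g z - 1 - b * z)) =O[nhdsWithin 0 {0}ᶜ] fun z => z ^ 2 := by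
    simpa using (hf.tendsto_one.isBigO_one ℂ).mul hg
  have h2 : Filter.Tendsto (fun z : ℂ => 1 + b * z) (nhdsWithin 0 {0}ᶜ) (nhds 1) := by
    simpa using (tendsto_id_punctured_zero.const_mul b).const_add 1
  have h3 : (fun z => (1 + b * z) * (f z - 1 - a * z)) =O[nhdsWithin 0 {0}ᶜ] fun z => z ^ 2 := by
    simpa using (h2.isBigO_one ℂ).mul hf
  have h4 := (h1.add h3).add
    (Asymptotics.isBigO_const_mul_self (a * b) (fun z : ℂ => z ^ 2) (nhdsWithin 0 {0}ᶜ))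
  refine h4.congr_left fun z => ?_
  ring

theorem firstOrderExpansion_exp : FirstOrderExpansion Complex.exp 1 := by
  refine Asymptotics.IsBigO.of_bound 1 ?_
  filter_upwards [nhdsWithin_le_nhds (Metric.closedBall_mem_nhds (0 : ℂ) one_pos)] with z hz
  rw [one_mul, one_mul, norm_pow]
  exact Complex.norm_exp_sub_one_sub_id_le (by simpa using hz)

theorem FirstOrderExpansion.comp_neg {f : ℂ → ℂ} {a : ℂ} (hf : FirstOrderExpansion f a) :
    FirstOrderExpansion (fun z => f (-z)) (-a) := by
  have h : Filter.Tendsto (fun z : ℂ => -z) (nhdsWithin 0 {0}ᶜ) (nhdsWithin 0 {0}ᶜ) := by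
    refine tendsto_nhdsWithin_of_tendsto_nhds_of_eventually_within _ ?_ ?_
    · simpa using tendsto_id_punctured_zero.neg
    · filter_upwards [self_mem_nhdsWithin] with z hz
      simpa using hz
  have := Asymptotics.IsBigO.comp_tendsto hf h
  simpa [FirstOrderExpansion, Function.comp_def] using this

/-- The reason for punctured neighbourhoods: at z = 0 the quotient is 0 by convention, not its limit
1. -/
theorem firstOrderExpansion_one_sub_exp_div :
    FirstOrderExpansion (fun z => (1 - Complex.exp (-z)) / z) (-(1 / 2)) := by
  refine Asymptotics.IsBigO.of_bound 1 ?_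
  filter_upwards [nhdsWithin_le_nhds (Metric.closedBall_mem_nhds (0 : ℂ) one_pos),
    self_mem_nhdsWithin] with z hz hz0
  have hz0 : z ≠ 0 := hz0
  have h := Complex.exp_bound (x := -z) (by simpa using hz) (n := 3) (by norm_num)
  simp only [Finset.sum_range_succ, Finset.sum_range_zero, norm_neg] at h
  norm_num [Nat.factorial] at h
  have h2 : (1 - Complex.exp (-z)) / z - 1 - -(1 / 2) * z =
      -(Complex.exp (-z) - (1 + -z + z ^ 2 / 2)) / z := by
    field_simp
    ring
  rw [h2, norm_div, norm_neg, div_le_iff₀ (norm_pos_iff.2 hz0), one_mul, norm_pow]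
  refine h.trans ?_
  have : 0 ≤ ‖z‖ ^ 3 := by positivity
  nlinarith

theorem FirstOrderExpansion.cpow {f : ℂ → ℂ} {a : ℂ} (hf : FirstOrderExpansion f a) (γ : ℂ) :
    FirstOrderExpansion (fun z => f z ^ γ) (γ * a) := by
  have h1 := (Complex.one_add_cpow_hasFPowerSeriesAt_zero (a := γ)).isBigO_sub_partialSum_pow 2
  simp only [FormalMultilinearSeries.partialSum, Finset.sum_range_succ, Finset.sum_range_zero,
    binomialSeries_apply, zero_add, Ring.choose_zero_right, Ring.choose_one_right, List.ofFn_const,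
    List.prod_replicate, pow_zero, pow_one, smul_eq_mul, one_mul] at h1
  have h2 : Filter.Tendsto (fun z => f z - 1) (nhdsWithin 0 {0}ᶜ) (nhds 0) := by
    simpa using hf.tendsto_one.sub_const 1
  have h3 := h1.comp_tendsto h2
  have h4 : (fun z => f z ^ γ - (1 + γ * (f z - 1))) =O[nhdsWithin 0 {0}ᶜ] fun z => z ^ 2 := by
    have h5 : (fun z => ‖f z - 1‖ ^ 2) =O[nhdsWithin 0 {0}ᶜ] fun z => z ^ 2 := by
      simpa using (hf.isBigO_sub_one.norm_left.pow 2)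
    refine (h3.trans h5).congr_left fun z => ?_
    simp
  have h6 := h4.add (hf.const_mul_left γ)
  refine h6.congr_left fun z => ?_
  ring

theorem norm_I_mul (t : ℝ) : ‖Complex.I * t‖ = |t| := by simp

theorem norm_exp_I_mul (t : ℝ) : ‖Complex.exp (Complex.I * t)‖ = 1 := by
  rw [mul_comm, Complex.norm_exp_ofReal_mul_I]

theorem norm_exp_neg_I_mul (t : ℝ) : ‖Complex.exp (-(Complex.I * t))‖ = 1 := by
  have := norm_exp_I_mul (-t)
  simpa using this

/-- The symbol of the (unscaled) weighted and shifted Grünwald operator. -/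
noncomputable def wsgdSymbol (γ : ℝ) (t : ℝ) : ℂ :=
  Complex.exp (Complex.I * t) * (1 - Complex.exp (-(Complex.I * t))) ^ (γ : ℂ) *
    ((γ / 2 : ℝ) + ((2 - γ) / 2 : ℝ) * Complex.exp (-(Complex.I * t)))

/-- With z = it, divide the symbol by z^γ: the quotient is e^z ψ(z)^γ times the weight factor. It
has to be 1 + O(z²), which is what the choice of weights achieves. -/
theorem norm_wsgdSymbol_sub_le_of_small (γ : ℝ) :
    ∃ r C : ℝ, 0 < r ∧ 0 < C ∧ ∀ t : ℝ, t ≠ 0 → |t| < r →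
      ‖wsgdSymbol γ t - (Complex.I * t) ^ (γ : ℂ)‖ ≤ C * |t| ^ (γ + 2) := by
  set ψ : ℂ → ℂ := fun z => (1 - Complex.exp (-z)) / z with hψ
  have hexp : FirstOrderExpansion (fun z => (γ / 2 : ℝ) + ((2 - γ) / 2 : ℝ) * Complex.exp (-z))
      (-((2 - γ) / 2 : ℝ)) := by
    refine (firstOrderExpansion_exp.comp_neg.const_mul_left (((2 - γ) / 2 : ℝ) : ℂ)).congr_left
      fun z => ?_
    push_cast
    ring
  have hG : FirstOrderExpansion (fun z => Complex.exp z * ψ z ^ (γ : ℂ) *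
      ((γ / 2 : ℝ) + ((2 - γ) / 2 : ℝ) * Complex.exp (-z))) 0 := by
    -- First order coefficients add under products: 1 - γ/2 - (2 - γ)/2 = 0.
    have := (firstOrderExpansion_exp.mul (firstOrderExpansion_one_sub_exp_div.cpow γ)).mul hexp
    convert this using 1
    push_cast
    ring
  obtain ⟨C, hC, hbound⟩ := hG.exists_pos
  have hbound := hbound.bound
  have hre : ∀ᶠ z in nhdsWithin (0 : ℂ) {0}ᶜ, 0 < (ψ z).re := by
    have h1 := firstOrderExpansion_one_sub_exp_div.tendsto_one
    have h2 := (Complex.continuous_re.tendsto 1).comp h1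
    exact h2.eventually (lt_mem_nhds (show (0 : ℝ) < (1 : ℂ).re by simp))
  obtain ⟨r, hr, hball⟩ := Metric.mem_nhdsWithin_iff.1 (hbound.and hre)
  refine ⟨r, C, hr, hC, fun t ht htr => ?_⟩
  set z : ℂ := Complex.I * t with hz
  have hz0 : z ≠ 0 := by simp [hz, ht]
  obtain ⟨h1, h2⟩ := hball (show z ∈ Metric.ball 0 r ∩ {0}ᶜ from
    ⟨by rw [mem_ball_zero_iff, hz, norm_I_mul]; exact htr, hz0⟩)
  have hψ0 : ψ z ≠ 0 := by
    intro h
    rw [h] at h2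
    simp at h2
  -- Splitting the complex power is legitimate because |arg z| ≤ π/2 and |arg ψ(z)| < π/2, so the
  -- arguments add without crossing the cut.
  have hmul : (1 - Complex.exp (-z)) ^ (γ : ℂ) = z ^ (γ : ℂ) * ψ z ^ (γ : ℂ) := by
    have h3 : 1 - Complex.exp (-z) = z * ψ z := by
      simp only [hψ]
      field_simp
    have h4 : Complex.log (z * ψ z) = Complex.log z + Complex.log (ψ z) := by
      refine Complex.log_mul hz0 hψ0 ?_
      have h5 : |Complex.arg (ψ z)| < Real.pi / 2 := Complex.abs_arg_lt_pi_div_two_iff.2 (Or.inl h2)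
      have h6 : |Complex.arg z| ≤ Real.pi / 2 := Complex.abs_arg_le_pi_div_two_iff.2 (by simp [hz])
      rw [abs_lt] at h5
      rw [abs_le] at h6
      constructor <;> linarith
    rw [h3, Complex.cpow_def_of_ne_zero (mul_ne_zero hz0 hψ0), Complex.cpow_def_of_ne_zero hz0,
      Complex.cpow_def_of_ne_zero hψ0, h4, add_mul, Complex.exp_add]
  have hfac : wsgdSymbol γ t - z ^ (γ : ℂ) = z ^ (γ : ℂ) * (Complex.exp z * ψ z ^ (γ : ℂ) *
      ((γ / 2 : ℝ) + ((2 - γ) / 2 : ℝ) * Complex.exp (-z)) - 1 - 0 * z) := by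
    rw [wsgdSymbol, ← hz, hmul]
    ring
  have hzt : ‖z‖ = |t| := norm_I_mul t
  have h5 : |t| ^ (γ + 2) = |t| ^ γ * |t| ^ 2 := by
    rw [Real.rpow_add (abs_pos.2 ht)]
    norm_cast
  rw [norm_pow, hzt] at h1
  rw [hfac, norm_mul, Complex.norm_cpow_real, hzt, h5]
  exact (mul_le_mul_of_nonneg_left h1 (by positivity)).trans_eq (mul_left_comm _ _ _)

theorem norm_wsgdSymbol_le {γ : ℝ} (h0 : 0 < γ) (h2 : γ ≤ 2) (t : ℝ) :
    ‖wsgdSymbol γ t‖ ≤ 2 ^ γ := by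
  rw [wsgdSymbol, norm_mul, norm_mul, norm_exp_I_mul, one_mul, Complex.norm_cpow_real]
  have h3 : ‖1 - Complex.exp (-(Complex.I * t))‖ ≤ 2 := by
    refine (norm_sub_le _ _).trans ?_
    rw [norm_exp_neg_I_mul, norm_one]
    norm_num
  have h4 : ‖((γ / 2 : ℝ) : ℂ) + ((2 - γ) / 2 : ℝ) * Complex.exp (-(Complex.I * t))‖ ≤ 1 := by
    refine (norm_add_le _ _).trans ?_
    rw [norm_mul, norm_exp_neg_I_mul, Complex.norm_real, Complex.norm_real, Real.norm_eq_abs,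
      Real.norm_eq_abs, abs_of_nonneg (by linarith), abs_of_nonneg (by linarith)]
    linarith
  calc _ ≤ (2 : ℝ) ^ γ * 1 := by gcongr
    _ = _ := mul_one _

/-- Away from 0 no cancellation is needed: the symbol is bounded by 2^γ and |it|^γ = |t|^γ, both at
most a constant times |t|^(γ+2) for |t| ≥ r. -/
theorem norm_wsgdSymbol_sub_le {γ : ℝ} (h0 : 0 < γ) (h2 : γ ≤ 2) :
    ∃ C : ℝ, 0 < C ∧ ∀ t : ℝ,
      ‖wsgdSymbol γ t - (Complex.I * t) ^ (γ : ℂ)‖ ≤ C * |t| ^ (γ + 2) := by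
  obtain ⟨r, C, hr, hC, h⟩ := norm_wsgdSymbol_sub_le_of_small γ
  have hrp : 0 < r ^ (γ + 2) := by positivity
  have hr2 : 0 < r ^ 2 := by positivity
  refine ⟨C + (2 ^ γ / r ^ (γ + 2) + 1 / r ^ 2), by positivity, fun t => ?_⟩
  have ht0 : 0 ≤ |t| ^ (γ + 2) := by positivity
  have hc0 : 0 ≤ (2 : ℝ) ^ γ / r ^ (γ + 2) + 1 / r ^ 2 := by positivity
  rcases eq_or_ne t 0 with rfl | ht
  · have : (γ : ℂ) ≠ 0 := by exact_mod_cast h0.ne'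
    simp [wsgdSymbol, this]
    positivity
  rcases lt_or_ge |t| r with htr | htr
  · refine (h t ht htr).trans ?_
    gcongr
    linarith
  · refine (norm_sub_le _ _).trans ?_
    rw [Complex.norm_cpow_real, norm_I_mul]
    have h3 : (2 : ℝ) ^ γ ≤ 2 ^ γ / r ^ (γ + 2) * |t| ^ (γ + 2) := by
      rw [div_mul_eq_mul_div, le_div_iff₀ hrp]
      gcongr
    have h4 : |t| ^ γ ≤ 1 / r ^ 2 * |t| ^ (γ + 2) := by
      have h5 : |t| ^ (γ + 2) = |t| ^ γ * |t| ^ 2 := by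
        rw [Real.rpow_add (abs_pos.2 ht)]
        norm_cast
      rw [h5, div_mul_eq_mul_div, le_div_iff₀ hr2, one_mul]
      gcongr
    have h6 := norm_wsgdSymbol_le h0 h2 t
    have h7 := mul_nonneg hC.le ht0
    calc _ ≤ 2 ^ γ / r ^ (γ + 2) * |t| ^ (γ + 2) + 1 / r ^ 2 * |t| ^ (γ + 2) := by linarith
      _ ≤ _ := by rw [add_mul C, add_mul]; linarith

theorem summable_norm_wsgd {γ : ℝ} (h0 : 0 < γ) (h2 : γ ≤ 2) (h1 : γ ≠ 1) :
    Summable fun k => ‖wsgd γ k‖ := by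
  have hs := summable_norm_grunwald h0 h2 h1
  rw [← summable_nat_add_iff 1]
  refine Summable.of_nonneg_of_le (fun k => norm_nonneg _) (fun k => ?_)
    ((((summable_nat_add_iff 1).2 hs).mul_left (γ / 2)).add (hs.mul_left ((2 - γ) / 2)))
  rw [wsgd_succ]
  refine (norm_add_le _ _).trans ?_
  rw [norm_mul, norm_mul, Real.norm_of_nonneg (by linarith : 0 ≤ γ / 2),
    Real.norm_of_nonneg (by linarith : 0 ≤ (2 - γ) / 2)]

/-- The weights have generating function (1 - z)^γ (γ/2 + (2 - γ)z/2). The factor e^(it) in the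
symbol is the shift by one node. -/
theorem hasSum_wsgd {γ : ℝ} (h0 : 0 < γ) (h2 : γ ≤ 2) (h1 : γ ≠ 1) (t : ℝ) :
    HasSum (fun k : ℕ => (wsgd γ k : ℂ) * Complex.exp (Complex.I * t * (1 - k)))
      (wsgdSymbol γ t) := by
  set z := Complex.exp (-(Complex.I * t)) with hz
  have h3 := hasSum_grunwald h0 h2 h1 (z := z) (norm_exp_neg_I_mul t).le
  have h4 : HasSum (fun k : ℕ => (wsgd γ k : ℂ) * z ^ k)
      ((1 - z) ^ (γ : ℂ) * ((γ / 2 : ℝ) + ((2 - γ) / 2 : ℝ) * z)) := by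
    rw [← hasSum_nat_add_iff' 1] at h3 ⊢
    have h5 := (hasSum_nat_add_iff' 1).1 h3
    have h6 := (h3.mul_left ((γ / 2 : ℝ) : ℂ)).add (h5.mul_left ((((2 - γ) / 2 : ℝ) : ℂ) * z))
    convert! h6 using 1
    · ext k
      rw [wsgd_succ]
      push_cast
      ring
    · simp [wsgd, grunwald]
      ring
  have h7 := h4.mul_left (Complex.exp (Complex.I * t))
  rw [← mul_assoc] at h7
  have h8 : (fun k : ℕ => (wsgd γ k : ℂ) * Complex.exp (Complex.I * t * (1 - k))) =
      fun k => Complex.exp (Complex.I * t) * ((wsgd γ k : ℂ) * z ^ k) := by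
    ext k
    rw [hz, ← Complex.exp_nat_mul, mul_left_comm, ← Complex.exp_add]
    congr 2
    ring
  rw [h8]
  exact h7

/-! ### The Gamma integral with a complex rate -/

theorem integrableOn_rpow_mul_exp_neg_mul {a s : ℝ} (ha : 0 < a) (hs : 0 < s) :
    IntegrableOn (fun t : ℝ => t ^ (a - 1) * Real.exp (-(s * t))) (Ioi 0) := by
  have := integrableOn_rpow_mul_exp_neg_mul_rpow (p := 1) (s := a - 1) (b := s) (by linarith)
    one_pos hs
  simpa using this

theorem integrableOn_rpow_mul_cexp_neg_mul {a : ℝ} (ha : 0 < a) {r : ℂ} (hr : 0 < r.re) :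
    IntegrableOn (fun t : ℝ => ((t ^ (a - 1) : ℝ) : ℂ) * Complex.exp (-(r * t))) (Ioi 0) := by
  refine Integrable.mono' (integrableOn_rpow_mul_exp_neg_mul ha hr) ?_ ?_
  · exact (by fun_prop : Measurable fun t : ℝ =>
      ((t ^ (a - 1) : ℝ) : ℂ) * Complex.exp (-(r * t))).aestronglyMeasurable
  · filter_upwards [ae_restrict_mem measurableSet_Ioi] with t ht
    have ht : 0 < t := ht
    rw [norm_mul, Complex.norm_real, Complex.norm_exp, Real.norm_of_nonneg (by positivity)]
    simp

theorem differentiableOn_integral_rpow_mul_cexp {a : ℝ} (ha : 0 < a) :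
    DifferentiableOn ℂ (fun r : ℂ => ∫ t in Ioi (0 : ℝ),
      ((t ^ (a - 1) : ℝ) : ℂ) * Complex.exp (-(r * t))) {r | 0 < r.re} := by
  intro r₀ hr₀
  have hr₀ : 0 < r₀.re := hr₀
  refine DifferentiableAt.differentiableWithinAt ?_
  have h := hasDerivAt_integral_of_dominated_loc_of_deriv_le
    (μ := volume.restrict (Ioi (0 : ℝ))) (𝕜 := ℂ)
    (F := fun (r : ℂ) (t : ℝ) => ((t ^ (a - 1) : ℝ) : ℂ) * Complex.exp (-(r * t)))
    (F' := fun (r : ℂ) (t : ℝ) => ((t ^ (a - 1) : ℝ) : ℂ) * (Complex.exp (-(r * t)) * (-t)))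
    (x₀ := r₀) (s := {r : ℂ | r₀.re / 2 < r.re})
    -- Differentiation brings down a factor t, and Re r > Re r₀ / 2 on the chosen neighbourhood.
    (bound := fun t => t ^ (a + 1 - 1) * Real.exp (-(r₀.re / 2 * t)))
    ?_ ?_ ?_ ?_ ?_ ?_ ?_
  · exact h.2.differentiableAt
  · exact (isOpen_lt continuous_const Complex.continuous_re).mem_nhds
      (show r₀.re / 2 < r₀.re by linarith)
  · exact Filter.Eventually.of_forall fun r => (by fun_prop : Measurable fun t : ℝ =>
      ((t ^ (a - 1) : ℝ) : ℂ) * Complex.exp (-(r * t))).aestronglyMeasurable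
  · exact integrableOn_rpow_mul_cexp_neg_mul ha hr₀
  · exact (by fun_prop : Measurable fun t : ℝ => ((t ^ (a - 1) : ℝ) : ℂ) *
      (Complex.exp (-(r₀ * t)) * (-t))).aestronglyMeasurable
  · filter_upwards [ae_restrict_mem measurableSet_Ioi] with t ht r hr
    have ht : 0 < t := ht
    have hr : r₀.re / 2 < r.re := hr
    rw [norm_mul, norm_mul, Complex.norm_real, Complex.norm_exp,
      Real.norm_of_nonneg (by positivity), norm_neg, Complex.norm_real, Real.norm_of_nonneg ht.le,
      Real.rpow_sub_one ht.ne', Real.rpow_sub_one ht.ne', Real.rpow_add_one ht.ne']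
    have h1 : (-(r * (t : ℂ))).re = -(r.re * t) := by simp
    rw [h1]
    calc _ = t ^ a * Real.exp (-(r.re * t)) := by field_simp
      _ ≤ t ^ a * Real.exp (-(r₀.re / 2 * t)) := by gcongr
      _ = _ := by field_simp
  · exact integrableOn_rpow_mul_exp_neg_mul (by linarith) (by linarith)
  · refine Filter.Eventually.of_forall fun t r _ => ?_
    have h1 : HasDerivAt (fun r : ℂ => -(r * (t : ℂ))) (-(t : ℂ)) r := by
      simpa using ((hasDerivAt_id r).mul_const (t : ℂ)).fun_neg
    exact h1.cexp.const_mul _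

/-- Analytic continuation from real rates: both sides are analytic on the right half-plane and agree
at the points 1 + 1/(n + 1), which accumulate at 1. -/
theorem integral_rpow_mul_cexp_neg_mul {a : ℝ} (ha : 0 < a) {r : ℂ} (hr : 0 < r.re) :
    ∫ t in Ioi (0 : ℝ), ((t ^ (a - 1) : ℝ) : ℂ) * Complex.exp (-(r * t)) =
      Real.Gamma a * r ^ (-(a : ℂ)) := by
  have hopen : IsOpen {r : ℂ | 0 < r.re} := isOpen_lt continuous_const Complex.continuous_re
  have hconv : IsPreconnected {r : ℂ | 0 < r.re} := (convex_halfSpace_re_gt 0).isPreconnected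
  refine AnalyticOnNhd.eqOn_of_preconnected_of_frequently_eq (z₀ := 1)
    (g := fun r : ℂ => (Real.Gamma a : ℂ) * r ^ (-(a : ℂ)))
    ((differentiableOn_integral_rpow_mul_cexp ha).analyticOnNhd hopen) ?_ hconv (by simp) ?_ hr
  · refine DifferentiableOn.analyticOnNhd ?_ hopen
    refine DifferentiableOn.const_mul ?_ _
    intro z hz
    exact (DifferentiableAt.cpow_const differentiableAt_id
      (Or.inl hz)).differentiableWithinAt
  · have h1 : Filter.Tendsto (fun n : ℕ => ((1 + 1 / ((n : ℝ) + 1) : ℝ) : ℂ)) Filter.atTop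
        (nhdsWithin 1 {1}ᶜ) := by
      refine tendsto_nhdsWithin_of_tendsto_nhds_of_eventually_within _ ?_ ?_
      · have h2 := (tendsto_one_div_add_atTop_nhds_zero_nat (𝕜 := ℝ)).const_add 1
        rw [add_zero] at h2
        exact (Complex.continuous_ofReal.tendsto 1).comp h2
      · refine Filter.Eventually.of_forall fun n => ?_
        have : (0 : ℝ) < 1 / ((n : ℝ) + 1) := by positivity
        intro h
        have := Complex.ofReal_injective (h.trans Complex.ofReal_one.symm)
        linarith
    refine h1.frequently (Filter.Eventually.frequently (Filter.Eventually.of_forall fun n => ?_))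
    set s : ℝ := 1 + 1 / ((n : ℝ) + 1) with hs
    have hs0 : 0 < s := by positivity
    have h3 := Complex.integral_cpow_mul_exp_neg_mul_Ioi (a := (a : ℂ)) (by simpa using ha) hs0
    rw [Complex.Gamma_ofReal, one_div, Complex.inv_cpow _ _ (by
      rw [Complex.arg_ofReal_of_nonneg hs0.le]; exact Real.pi_pos.ne), ← Complex.cpow_neg,
      mul_comm] at h3
    rw [← h3]
    refine setIntegral_congr_fun measurableSet_Ioi fun t ht => ?_
    have ht : 0 < t := ht
    rw [Complex.ofReal_cpow ht.le]
    push_cast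
    rfl

/-! ### The extension by zero and its Fourier transform -/

theorem continuous_zeroExt {L : ℝ} {v : ℝ → ℝ} (hv : ContinuousOn v (Icc 0 L)) (h0 : v 0 = 0)
    (hL : v L = 0) : Continuous (zeroExt L v) := by
  refine continuous_indicator (fun a ha => ?_) ?_
  · rcases le_or_gt 0 L with h | h
    · rw [frontier_Icc h] at ha
      rcases ha with rfl | ha
      · simp [h0]
      · rw [mem_singleton_iff.1 ha]
        simp [hL]
    · simp [Icc_eq_empty_of_lt h] at ha
  · rw [isClosed_Icc.closure_eq]
    exact Complex.continuous_ofReal.comp_continuousOn hv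

theorem hasCompactSupport_zeroExt (L : ℝ) (v : ℝ → ℝ) : HasCompactSupport (zeroExt L v) :=
  HasCompactSupport.of_support_subset_isCompact isCompact_Icc support_indicator_subset

theorem continuous_fourier_of_integrable {V : ℝ → ℂ} (hV : Integrable V) : Continuous (𝓕 V) :=
  VectorFourier.fourierIntegral_continuous Real.continuous_fourierChar
    (by exact continuous_inner) hV

theorem norm_fourier_le (V : ℝ → ℂ) (ξ : ℝ) : ‖𝓕 V ξ‖ ≤ ∫ x, ‖V x‖ :=
  VectorFourier.norm_fourierIntegral_le_integral_norm _ _ _ _ _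

theorem integrableOn_abs_rpow {s : ℝ} (hs : -1 < s) :
    IntegrableOn (fun ξ : ℝ => |ξ| ^ s) (Icc (-1) 1) := by
  have h1 : IntegrableOn (fun ξ : ℝ => |ξ| ^ s) (Ioc 0 1) := by
    have := (intervalIntegrable_iff_integrableOn_Ioc_of_le zero_le_one).1
      (intervalIntegral.intervalIntegrable_rpow' (a := 0) (b := 1) hs)
    refine this.congr_fun (fun x hx => ?_) measurableSet_Ioc
    rw [abs_of_pos hx.1]
  have h2 : IntegrableOn (fun ξ : ℝ => |ξ| ^ s) (Ico (-1) 0) := by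
    rw [← Measure.map_neg_eq_self (volume : Measure ℝ)]
    let m : MeasurableEmbedding fun x : ℝ => -x := (Homeomorph.neg ℝ).measurableEmbedding
    rw [m.integrableOn_map_iff]
    simpa [Function.comp_def] using h1
  have h3 : IntegrableOn (fun ξ : ℝ => |ξ| ^ s) {0} := by simp
  refine ((h2.union h3).union h1).mono_set fun x hx => ?_
  rcases lt_trichotomy x 0 with h | h | h
  · exact Or.inl (Or.inl ⟨hx.1, h⟩)
  · exact Or.inl (Or.inr h)
  · exact Or.inr ⟨h, hx.2⟩

/-- Near 0 the bound on W and s > -1 suffice; for |ξ| ≥ 1 the weight |ξ|^p dominates. The negative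
exponents are needed for fractional integrals. -/
theorem integrable_abs_rpow_mul {W : ℝ → ℂ} (hW : Continuous W) {M : ℝ} (hM : ∀ ξ, ‖W ξ‖ ≤ M)
    {p s : ℝ} (hp : Integrable fun ξ : ℝ => |ξ| ^ p * ‖W ξ‖) (hs : -1 < s) (hsp : s ≤ p) :
    Integrable fun ξ : ℝ => |ξ| ^ s * ‖W ξ‖ := by
  have hb : Integrable fun ξ : ℝ => (Icc (-1) 1).indicator (fun ξ : ℝ => |ξ| ^ s) ξ * M +
      |ξ| ^ p * ‖W ξ‖ :=
    (((integrable_indicator_iff measurableSet_Icc).2 (integrableOn_abs_rpow hs)).mul_const M).add hp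
  refine hb.mono' ?_ (Filter.Eventually.of_forall fun ξ => ?_)
  · have := hW.measurable
    exact (by fun_prop : Measurable fun ξ : ℝ => |ξ| ^ s * ‖W ξ‖).aestronglyMeasurable
  · have h1 : 0 ≤ |ξ| ^ p * ‖W ξ‖ := by positivity
    rw [Real.norm_of_nonneg (by positivity)]
    by_cases hξ : ξ ∈ Icc (-1 : ℝ) 1
    · rw [indicator_of_mem hξ]
      have : |ξ| ^ s * ‖W ξ‖ ≤ |ξ| ^ s * M := by
        gcongr
        exact hM ξ
      linarith
    · rw [indicator_of_notMem hξ, zero_mul, zero_add]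
      have : 1 ≤ |ξ| := by
        by_contra h
        exact hξ (abs_le.1 (not_le.1 h).le)
      gcongr

/-- A continuous function supported in `[0, L]`, vanishing at the end points, with a Fourier
transform `W` such that `|ξ|^p W(ξ)` is integrable. -/
structure IsRegularFunction (L p : ℝ) (v : ℝ → ℝ) : Prop where
  continuousOn : ContinuousOn v (Icc 0 L)
  left : v 0 = 0
  right : v L = 0
  integrable : Integrable fun ξ : ℝ => |ξ| ^ p * ‖𝓕 (zeroExt L v) ξ‖

namespace IsRegularFunction

variable {L p : ℝ} {v : ℝ → ℝ}

theorem continuous_ext (h : IsRegularFunction L p v) : Continuous (zeroExt L v) :=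
  continuous_zeroExt h.continuousOn h.left h.right

theorem integrable_ext (h : IsRegularFunction L p v) : Integrable (zeroExt L v) :=
  h.continuous_ext.integrable_of_hasCompactSupport (hasCompactSupport_zeroExt L v)

theorem continuous_fourier (h : IsRegularFunction L p v) : Continuous (𝓕 (zeroExt L v)) :=
  continuous_fourier_of_integrable h.integrable_ext

theorem integrable_abs_rpow (h : IsRegularFunction L p v) {s : ℝ} (hs : -1 < s) (hsp : s ≤ p) :
    Integrable fun ξ : ℝ => |ξ| ^ s * ‖𝓕 (zeroExt L v) ξ‖ :=
  integrable_abs_rpow_mul h.continuous_fourier (norm_fourier_le _) h.integrable hs hsp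

theorem integrable_fourier (h : IsRegularFunction L p v) (hp : 0 ≤ p) :
    Integrable (𝓕 (zeroExt L v)) := by
  have := h.integrable_abs_rpow (s := 0) (by norm_num) hp
  simp only [Real.rpow_zero, one_mul] at this
  exact (integrable_norm_iff h.continuous_fourier.aestronglyMeasurable).1 this

theorem ext_eq_integral (h : IsRegularFunction L p v) (hp : 0 ≤ p) (x : ℝ) :
    zeroExt L v x = ∫ ξ : ℝ, Complex.exp (Complex.I * ((2 * Real.pi * ξ : ℝ) : ℂ) * x) *
      𝓕 (zeroExt L v) ξ := by
  have h1 := congrFun (h.continuous_ext.fourierInv_fourier_eq h.integrable_ext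
    (h.integrable_fourier hp)) x
  rw [← h1, Real.fourierInv_eq']
  congr 1
  ext ξ
  rw [smul_eq_mul]
  congr 2
  simp
  ring

end IsRegularFunction

/-! ### Riemann-Liouville integrals on the Fourier side -/

theorem norm_exp_I_mul_mul (ω x : ℝ) : ‖Complex.exp (Complex.I * (ω : ℂ) * x)‖ = 1 := by
  have := norm_exp_I_mul (ω * x)
  push_cast at this
  rw [← this]
  congr 2
  ring

/-- The damping e^(-εr) makes the kernel r^(a - 1) integrable at infinity, so Fubini applies; the
inner integral is a Gamma integral with rate ε + iω. -/
theorem integral_damped_eq {V W : ℝ → ℂ} (hW : Integrable W)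
    (hVW : ∀ x : ℝ, V x = ∫ ξ : ℝ, Complex.exp (Complex.I * ((2 * Real.pi * ξ : ℝ) : ℂ) * x) * W ξ)
    {a ε : ℝ} (ha : 0 < a) (hε : 0 < ε) (y : ℝ) :
    ∫ r in Ioi (0 : ℝ), ((r ^ (a - 1) : ℝ) : ℂ) * Complex.exp (-(ε * r)) * V (y - r) =
      Real.Gamma a * ∫ ξ : ℝ, (ε + Complex.I * ((2 * Real.pi * ξ : ℝ) : ℂ)) ^ (-(a : ℂ)) *
        (Complex.exp (Complex.I * ((2 * Real.pi * ξ : ℝ) : ℂ) * y) * W ξ) := by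
  have hk : IntegrableOn (fun r : ℝ => ((r ^ (a - 1) : ℝ) : ℂ) * Complex.exp (-((ε : ℂ) * r)))
      (Ioi 0) := integrableOn_rpow_mul_cexp_neg_mul ha (by simpa using hε)
  have hint : Integrable (Function.uncurry fun (r ξ : ℝ) =>
      (((r ^ (a - 1) : ℝ) : ℂ) * Complex.exp (-((ε : ℂ) * r))) *
        (Complex.exp (Complex.I * ((2 * Real.pi * ξ : ℝ) : ℂ) * (y - r : ℝ)) * W ξ))
      ((volume.restrict (Ioi 0)).prod volume) := by
    have h1 := (hk.integrable.mul_prod hW).bdd_mul (c := 1)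
      (f := fun z : ℝ × ℝ =>
        Complex.exp (Complex.I * ((2 * Real.pi * z.2 : ℝ) : ℂ) * (y - z.1 : ℝ)))
      (by fun_prop : Continuous fun z : ℝ × ℝ =>
        Complex.exp (Complex.I * ((2 * Real.pi * z.2 : ℝ) : ℂ) * (y - z.1 : ℝ))).aestronglyMeasurable
      (Filter.Eventually.of_forall fun z => (norm_exp_I_mul_mul _ _).le)
    refine h1.congr (Filter.Eventually.of_forall fun z => ?_)
    simp only [Function.uncurry]
    ring
  calc _ = ∫ r in Ioi (0 : ℝ), ∫ ξ : ℝ, (((r ^ (a - 1) : ℝ) : ℂ) * Complex.exp (-((ε : ℂ) * r))) *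
        (Complex.exp (Complex.I * ((2 * Real.pi * ξ : ℝ) : ℂ) * (y - r : ℝ)) * W ξ) := by
        refine setIntegral_congr_fun measurableSet_Ioi fun r _ => ?_
        rw [hVW, integral_const_mul]
    _ = ∫ ξ : ℝ, ∫ r in Ioi (0 : ℝ), (((r ^ (a - 1) : ℝ) : ℂ) * Complex.exp (-((ε : ℂ) * r))) *
        (Complex.exp (Complex.I * ((2 * Real.pi * ξ : ℝ) : ℂ) * (y - r : ℝ)) * W ξ) :=
        integral_integral_swap hint
    _ = _ := by
        rw [← integral_const_mul]
        congr 1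
        ext ξ
        rw [← mul_assoc, ← integral_rpow_mul_cexp_neg_mul ha
          (r := ε + Complex.I * ((2 * Real.pi * ξ : ℝ) : ℂ)) (by simpa using hε),
          ← integral_mul_const]
        congr 1
        ext r
        have : Complex.exp (-((ε : ℂ) * r)) *
            Complex.exp (Complex.I * ((2 * Real.pi * ξ : ℝ) : ℂ) * (y - r : ℝ)) =
            Complex.exp (-((ε + Complex.I * ((2 * Real.pi * ξ : ℝ) : ℂ)) * r)) *
              Complex.exp (Complex.I * ((2 * Real.pi * ξ : ℝ) : ℂ) * y) := by
          rw [← Complex.exp_add, ← Complex.exp_add]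
          congr 1
          push_cast
          ring
        linear_combination ((r ^ (a - 1) : ℝ) : ℂ) * W ξ * this

/-- Let ε → 0 in the damped identity. On the left V(y - r) vanishes for r > y, so the integration is
over a bounded interval; on the right |ε + iω|^(-a) ≤ |ω|^(-a) dominates. -/
theorem integral_rpow_mul_comp_sub {V W : ℝ → ℂ} (hV : Continuous V) {M : ℝ}
    (hM : ∀ x, ‖V x‖ ≤ M) (hV0 : ∀ x < 0, V x = 0) (hW : Integrable W)
    (hVW : ∀ x : ℝ, V x = ∫ ξ : ℝ, Complex.exp (Complex.I * ((2 * Real.pi * ξ : ℝ) : ℂ) * x) * W ξ)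
    {a : ℝ} (ha : 0 < a) (hWa : Integrable fun ξ : ℝ => |ξ| ^ (-a) * ‖W ξ‖) (y : ℝ) :
    ∫ r in Ioi (0 : ℝ), ((r ^ (a - 1) : ℝ) : ℂ) * V (y - r) =
      Real.Gamma a * ∫ ξ : ℝ, (Complex.I * ((2 * Real.pi * ξ : ℝ) : ℂ)) ^ (-(a : ℂ)) *
        (Complex.exp (Complex.I * ((2 * Real.pi * ξ : ℝ) : ℂ) * y) * W ξ) := by
  have hleft : Filter.Tendsto (fun ε : ℝ => ∫ r in Ioi (0 : ℝ),
      ((r ^ (a - 1) : ℝ) : ℂ) * Complex.exp (-(ε * r)) * V (y - r)) (nhdsWithin 0 (Ioi 0))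
      (nhds (∫ r in Ioi (0 : ℝ), ((r ^ (a - 1) : ℝ) : ℂ) * V (y - r))) := by
    refine tendsto_integral_filter_of_dominated_convergence
      ((Ioc 0 y).indicator fun r => r ^ (a - 1) * M) ?_ ?_ ?_ ?_
    · refine Filter.Eventually.of_forall fun ε => ?_
      have := hV.measurable
      exact (by fun_prop : Measurable fun r : ℝ => ((r ^ (a - 1) : ℝ) : ℂ) *
        Complex.exp (-(ε * r)) * V (y - r)).aestronglyMeasurable
    · filter_upwards [self_mem_nhdsWithin] with ε hε
      filter_upwards [ae_restrict_mem measurableSet_Ioi] with r hr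
      have hr : 0 < r := hr
      have hε : 0 < ε := hε
      rcases le_or_gt r y with h | h
      · rw [indicator_of_mem (show r ∈ Ioc 0 y from ⟨hr, h⟩), norm_mul, norm_mul,
          Complex.norm_real, Real.norm_of_nonneg (by positivity), Complex.norm_exp]
        have h1 : Real.exp (-((ε : ℂ) * r)).re ≤ 1 := by
          rw [Real.exp_le_one_iff]
          simp
          positivity
        calc _ ≤ r ^ (a - 1) * 1 * M := by
              gcongr
              exact hM _
          _ = _ := by ring
      · rw [hV0 _ (by linarith), mul_zero, norm_zero,
          indicator_of_notMem (fun h' => absurd h'.2 (by linarith))]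
    · refine Integrable.restrict ?_
      rw [integrable_indicator_iff measurableSet_Ioc]
      rcases le_or_gt y 0 with h | h
      · simp [Ioc_eq_empty (by linarith : ¬ 0 < y)]
      · exact ((intervalIntegrable_iff_integrableOn_Ioc_of_le h.le).1
          (intervalIntegral.intervalIntegrable_rpow' (by linarith))).mul_const M
    · refine Filter.Eventually.of_forall fun r => ?_
      have h1 : Continuous fun ε : ℝ => ((r ^ (a - 1) : ℝ) : ℂ) * Complex.exp (-(ε * r)) *
          V (y - r) := by fun_prop
      have h2 := (h1.tendsto 0).mono_left (nhdsWithin_le_nhds (s := Ioi 0))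
      simpa using h2
  have hright : Filter.Tendsto (fun ε : ℝ => Real.Gamma a *
      ∫ ξ : ℝ, (ε + Complex.I * ((2 * Real.pi * ξ : ℝ) : ℂ)) ^ (-(a : ℂ)) *
        (Complex.exp (Complex.I * ((2 * Real.pi * ξ : ℝ) : ℂ) * y) * W ξ)) (nhdsWithin 0 (Ioi 0))
      (nhds (Real.Gamma a * ∫ ξ : ℝ, (Complex.I * ((2 * Real.pi * ξ : ℝ) : ℂ)) ^ (-(a : ℂ)) *
        (Complex.exp (Complex.I * ((2 * Real.pi * ξ : ℝ) : ℂ) * y) * W ξ))) := by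
    refine Filter.Tendsto.const_mul _ (tendsto_integral_filter_of_dominated_convergence
      (fun ξ => (2 * Real.pi) ^ (-a) * (|ξ| ^ (-a) * ‖W ξ‖)) ?_ ?_ (hWa.const_mul _) ?_)
    · refine Filter.Eventually.of_forall fun ε => AEStronglyMeasurable.mul ?_
        (AEStronglyMeasurable.mul ?_ hW.aestronglyMeasurable)
      · exact (by fun_prop : Measurable fun ξ : ℝ =>
          (ε + Complex.I * ((2 * Real.pi * ξ : ℝ) : ℂ)) ^ (-(a : ℂ))).aestronglyMeasurable
      · exact (by fun_prop : Continuous fun ξ : ℝ =>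
          Complex.exp (Complex.I * ((2 * Real.pi * ξ : ℝ) : ℂ) * y)).aestronglyMeasurable
    · filter_upwards [self_mem_nhdsWithin] with ε hε
      have hne : ∀ᵐ ξ : ℝ, ξ ≠ 0 := by simp [ae_iff]
      filter_upwards [hne] with ξ hξ
      rw [norm_mul, norm_mul, norm_exp_I_mul_mul, one_mul, ← mul_assoc,
        ← Real.mul_rpow (by positivity) (abs_nonneg ξ)]
      refine mul_le_mul_of_nonneg_right ?_ (norm_nonneg _)
      rw [← Complex.ofReal_neg, Complex.norm_cpow_real]
      have h1 : 2 * Real.pi * |ξ| = |(ε + Complex.I * ((2 * Real.pi * ξ : ℝ) : ℂ)).im| := by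
        simp [abs_mul, abs_of_pos Real.pi_pos]
      rw [h1]
      refine Real.rpow_le_rpow_of_nonpos ?_ (Complex.abs_im_le_norm _) (by linarith)
      rw [← h1]
      have := abs_pos.2 hξ
      positivity
    · have hne : ∀ᵐ ξ : ℝ, ξ ≠ 0 := by simp [ae_iff]
      filter_upwards [hne] with ξ hξ
      refine Filter.Tendsto.mul_const _ ?_
      have h1 : ContinuousAt (fun ε : ℝ =>
          ((ε : ℂ) + Complex.I * ((2 * Real.pi * ξ : ℝ) : ℂ)) ^ (-(a : ℂ))) 0 := by
        refine ContinuousAt.comp (g := fun w : ℂ => w ^ (-(a : ℂ)))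
          (f := fun ε : ℝ => (ε : ℂ) + Complex.I * ((2 * Real.pi * ξ : ℝ) : ℂ)) ?_ (by fun_prop)
        refine continuousAt_cpow_const ?_
        rw [Complex.mem_slitPlane_iff]
        right
        simp [hξ, Real.pi_ne_zero]
      have h2 := h1.tendsto.mono_left (nhdsWithin_le_nhds (s := Ioi 0))
      simpa using h2
  refine tendsto_nhds_unique hleft (hright.congr' ?_)
  filter_upwards [self_mem_nhdsWithin] with ε hε
  exact (integral_damped_eq hW hVW ha hε y).symm

theorem contDiff_fourierInv {f : ℝ → ℂ} {n : ℕ}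
    (hf : ∀ k ≤ n, Integrable fun x : ℝ => |x| ^ k * ‖f x‖) : ContDiff ℝ n (𝓕⁻ f) := by
  rw [Real.fourierInv_eq_fourier_comp_neg]
  refine Real.contDiff_fourier (N := (n : ℕ∞)) fun k hk => ?_
  have := (hf k (by exact_mod_cast hk)).comp_neg
  simpa using this

theorem iteratedDeriv_fourierInv {f : ℝ → ℂ} {n : ℕ} (hm : AEStronglyMeasurable f)
    (hf : ∀ k ≤ n, Integrable fun x : ℝ => |x| ^ k * ‖f x‖) :
    iteratedDeriv n (𝓕⁻ f) =
      𝓕⁻ fun x : ℝ => (Complex.I * ((2 * Real.pi * x : ℝ) : ℂ)) ^ n * f x := by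
  have hm' : AEStronglyMeasurable fun x => f (-x) :=
    hm.comp_measurePreserving (Measure.measurePreserving_neg volume)
  rw [Real.fourierInv_eq_fourier_comp_neg, Real.fourierInv_eq_fourier_comp_neg,
    Real.iteratedDeriv_fourier (N := (n : ℕ∞)) (fun k hk => ?_) le_rfl]
  · congr 1
    ext x
    rw [smul_eq_mul]
    congr 2
    push_cast
    ring
  · have h1 := (hf k (by exact_mod_cast hk)).comp_neg
    refine (integrable_norm_iff ?_).1 ?_
    · exact ((continuous_pow k).aestronglyMeasurable).smul hm'
    · refine h1.congr (Filter.Eventually.of_forall fun x => ?_)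
      simp

theorem iteratedDeriv_re {H : ℝ → ℂ} {n : ℕ} (hH : ContDiff ℝ n H) (x : ℝ) :
    iteratedDeriv n (fun y => (H y).re) x = (iteratedDeriv n H x).re := by
  have := Complex.reCLM.iteratedFDeriv_comp_left (x := x) hH.contDiffAt (le_refl _)
  have h1 : (fun y => (H y).re) = Complex.reCLM ∘ H := rfl
  rw [h1, iteratedDeriv, this]
  rfl

theorem ofReal_integral_eq_integral_comp_sub {L : ℝ} {v : ℝ → ℝ} {a y : ℝ} (hy : y ∈ Ioo 0 L) :
    ((∫ ξ in (0 : ℝ)..y, (y - ξ) ^ (a - 1) * v ξ : ℝ) : ℂ) =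
      ∫ r in Ioi (0 : ℝ), ((r ^ (a - 1) : ℝ) : ℂ) * zeroExt L v (y - r) := by
  have h1 : ∫ r in Ioi (0 : ℝ), ((r ^ (a - 1) : ℝ) : ℂ) * zeroExt L v (y - r) =
      ∫ r in Ioc (0 : ℝ) y, ((r ^ (a - 1) : ℝ) : ℂ) * zeroExt L v (y - r) := by
    refine setIntegral_eq_of_subset_of_forall_sdiff_eq_zero measurableSet_Ioi
      (fun r hr => hr.1) fun r hr => ?_
    have : ¬ r ≤ y := fun h => hr.2 ⟨hr.1, h⟩
    rw [zeroExt, indicator_of_notMem (fun h => this (by linarith [h.1])), mul_zero]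
  rw [h1, ← intervalIntegral.integral_of_le hy.1.le, ← intervalIntegral.integral_ofReal]
  have h2 := intervalIntegral.integral_comp_sub_left (a := 0) (b := y)
    (fun ξ : ℝ => (((y - ξ) ^ (a - 1) * v ξ : ℝ) : ℂ)) y
  rw [sub_self, sub_zero] at h2
  rw [← h2]
  refine intervalIntegral.integral_congr fun r hr => ?_
  rw [uIcc_of_le hy.1.le] at hr
  simp only [sub_sub_cancel, Complex.ofReal_mul]
  rw [zeroExt, indicator_of_mem (show y - r ∈ Icc 0 L from
    ⟨by linarith [hr.2], by linarith [hr.1, hy.2]⟩)]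

namespace IsRegularFunction

variable {L γ : ℝ} {v : ℝ → ℝ}

theorem integral_rpow_mul_comp_sub (h : IsRegularFunction L (γ + 2) v) (hγ : 0 < γ) {a : ℝ}
    (ha : 0 < a) (ha1 : a < 1) (y : ℝ) :
    ∫ r in Ioi (0 : ℝ), ((r ^ (a - 1) : ℝ) : ℂ) * zeroExt L v (y - r) =
      Real.Gamma a * ∫ ξ : ℝ, (Complex.I * ((2 * Real.pi * ξ : ℝ) : ℂ)) ^ (-(a : ℂ)) *
        (Complex.exp (Complex.I * ((2 * Real.pi * ξ : ℝ) : ℂ) * y) * 𝓕 (zeroExt L v) ξ) := by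
  obtain ⟨M, hM⟩ := (hasCompactSupport_zeroExt L v).exists_bound_of_continuous h.continuous_ext
  refine RieszFADE.integral_rpow_mul_comp_sub h.continuous_ext hM (fun x hx => ?_)
    (h.integrable_fourier (by linarith)) (h.ext_eq_integral (by linarith)) ha
    (h.integrable_abs_rpow (by linarith) (by linarith)) y
  exact indicator_of_notMem (fun h' => absurd h'.1 (by linarith)) _

/-- The fractional integral of order a = n - γ has multiplier (iω)^(-a), and n derivatives
contribute (iω)^n. Excluding γ = 1 and γ = 2 keeps a below 1, so that |ξ|^(-a) is integrable at 0.
-/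
theorem leftRL_eq_integral (h : IsRegularFunction L (γ + 2) v) (h0 : 0 < γ) (h2 : γ < 2)
    (h1 : γ ≠ 1) {x : ℝ} (hx : x ∈ Ioo 0 L) :
    leftRL 0 γ v x = (∫ ξ : ℝ, (Complex.I * ((2 * Real.pi * ξ : ℝ) : ℂ)) ^ (γ : ℂ) *
      (Complex.exp (Complex.I * ((2 * Real.pi * ξ : ℝ) : ℂ) * x) * 𝓕 (zeroExt L v) ξ)).re := by
  set n : ℕ := ⌊γ⌋₊ + 1 with hn
  set a : ℝ := (n : ℝ) - γ with ha
  set W := 𝓕 (zeroExt L v) with hW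
  obtain ⟨ha0, ha1, hn2⟩ : 0 < a ∧ a < 1 ∧ (n : ℝ) ≤ 2 := by
    rcases lt_or_gt_of_ne h1 with hlt | hgt
    · have : ⌊γ⌋₊ = 0 := Nat.floor_eq_zero.2 hlt
      rw [ha, hn, this]
      norm_num
      exact ⟨hlt, h0⟩
    · have : ⌊γ⌋₊ = 1 := (Nat.floor_eq_iff h0.le).2 ⟨by simpa using hgt.le, by norm_num; exact h2⟩
      rw [ha, hn, this]
      norm_num
      exact ⟨h2, by linarith⟩
  set f : ℝ → ℂ := fun ξ => (Complex.I * ((2 * Real.pi * ξ : ℝ) : ℂ)) ^ (-(a : ℂ)) * W ξ with hf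
  have hfm : AEStronglyMeasurable f := by
    have := h.continuous_fourier.measurable
    exact (by fun_prop : Measurable f).aestronglyMeasurable
  have hne : ∀ᵐ ξ : ℝ, ξ ≠ 0 := by simp [ae_iff]
  have hfint : ∀ k ≤ n, Integrable fun ξ : ℝ => |ξ| ^ k * ‖f ξ‖ := by
    intro k hk
    have hk' : (k : ℝ) ≤ 2 := le_trans (by exact_mod_cast hk) hn2
    -- Here -1 < k - a since a < 1, and k - a < 2 < γ + 2.
    have h3 := (h.integrable_abs_rpow (s := (k : ℝ) - a)
      (by have : (0 : ℝ) ≤ k := k.cast_nonneg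
          linarith) (by linarith)).const_mul ((2 * Real.pi) ^ (-a))
    refine h3.congr ?_
    filter_upwards [hne] with ξ hξ
    have hξ' := abs_pos.2 hξ
    rw [hf, norm_mul, ← Complex.ofReal_neg, Complex.norm_cpow_real, norm_I_mul, abs_mul,
      abs_of_pos (by positivity : 0 < 2 * Real.pi), Real.mul_rpow (by positivity) (abs_nonneg _),
      Real.rpow_sub hξ', Real.rpow_natCast, Real.rpow_neg (abs_nonneg ξ)]
    ring
  have hH : ∀ y, 𝓕⁻ f y = ∫ ξ : ℝ, (Complex.I * ((2 * Real.pi * ξ : ℝ) : ℂ)) ^ (-(a : ℂ)) *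
      (Complex.exp (Complex.I * ((2 * Real.pi * ξ : ℝ) : ℂ) * y) * W ξ) := by
    intro y
    rw [Real.fourierInv_eq']
    congr 1
    ext ξ
    rw [smul_eq_mul, hf, mul_left_comm]
    congr 3
    simp
    ring
  have hΓ : Real.Gamma a ≠ 0 := (Real.Gamma_pos_of_pos ha0).ne'
  have hEq : (fun y => ∫ ξ in (0 : ℝ)..y, (y - ξ) ^ (((⌊γ⌋₊ + 1 : ℕ) : ℝ) - γ - 1) * v ξ) =ᶠ[nhds x]
      fun y => Real.Gamma a * (𝓕⁻ f y).re := by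
    filter_upwards [Ioo_mem_nhds hx.1 hx.2] with y hy
    have h3 := ofReal_integral_eq_integral_comp_sub (v := v) (a := a) hy
    rw [h.integral_rpow_mul_comp_sub h0 ha0 ha1, ← hH] at h3
    have h4 := congrArg Complex.re h3
    rwa [Complex.ofReal_re, Complex.re_ofReal_mul] at h4
  rw [leftRL, ← hn, ← ha, hEq.iteratedDeriv_eq, iteratedDeriv_const_mul_field,
    iteratedDeriv_re (contDiff_fourierInv hfint), iteratedDeriv_fourierInv hfm hfint, ← mul_assoc,
    one_div, inv_mul_cancel₀ hΓ, one_mul, Real.fourierInv_eq']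
  congr 1
  refine integral_congr_ae ?_
  filter_upwards [hne] with ξ hξ
  have hz : Complex.I * ((2 * Real.pi * ξ : ℝ) : ℂ) ≠ 0 := by
    simp [hξ, Real.pi_ne_zero]
  have h5 : (Complex.I * ((2 * Real.pi * ξ : ℝ) : ℂ)) ^ (γ : ℂ) =
      (Complex.I * ((2 * Real.pi * ξ : ℝ) : ℂ)) ^ n *
        (Complex.I * ((2 * Real.pi * ξ : ℝ) : ℂ)) ^ (-(a : ℂ)) := by
    rw [← Complex.cpow_natCast, ← Complex.cpow_add _ _ hz]
    congr 1
    rw [ha]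
    push_cast
    ring
  have h6 : ((2 * Real.pi * inner ℝ ξ x : ℝ) : ℂ) * Complex.I =
      Complex.I * ((2 * Real.pi * ξ : ℝ) : ℂ) * x := by
    simp
    ring
  rw [h5, h6, smul_eq_mul, hf]
  ring

/-- Translation by (k - 1)s multiplies the transform by a unimodular exponential. The sum is finite
only because the extension vanishes to the left of 0, so it may be completed to the full series,
whose absolute convergence lets it be summed under the integral. -/
theorem sum_wsgd_eq_integral (h : IsRegularFunction L (γ + 2) v) (h0 : 0 < γ) (h2 : γ < 2)
    (h1 : γ ≠ 1) (x s : ℝ) {K : ℕ} (hK : ∀ k, K ≤ k → zeroExt L v (x - ((k : ℝ) - 1) * s) = 0) :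
    ∑ k ∈ Finset.range K, (wsgd γ k : ℂ) * zeroExt L v (x - ((k : ℝ) - 1) * s) =
      ∫ ξ : ℝ, wsgdSymbol γ (2 * Real.pi * ξ * s) *
        (Complex.exp (Complex.I * ((2 * Real.pi * ξ : ℝ) : ℂ) * x) * 𝓕 (zeroExt L v) ξ) := by
  set W := 𝓕 (zeroExt L v) with hW
  have hWi : Integrable W := h.integrable_fourier (by linarith)
  set F : ℕ → ℝ → ℂ := fun k ξ => (wsgd γ k : ℂ) *
    (Complex.exp (Complex.I * ((2 * Real.pi * ξ : ℝ) : ℂ) * (x - ((k : ℝ) - 1) * s : ℝ)) * W ξ)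
    with hF
  have hnorm : ∀ k ξ, ‖F k ξ‖ = ‖wsgd γ k‖ * ‖W ξ‖ := by
    intro k ξ
    simp only [hF]
    rw [norm_mul, norm_mul, norm_exp_I_mul_mul, one_mul, Complex.norm_real]
  have hFint : ∀ k, Integrable (F k) := fun k => by
    refine Integrable.const_mul ?_ _
    exact hWi.bdd_mul (c := 1) (by fun_prop : Continuous fun ξ : ℝ =>
      Complex.exp (Complex.I * ((2 * Real.pi * ξ : ℝ) : ℂ) *
        (x - ((k : ℝ) - 1) * s : ℝ))).aestronglyMeasurable
      (Filter.Eventually.of_forall fun ξ => (norm_exp_I_mul_mul _ _).le)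
  have hsum : Summable fun k => ∫ ξ, ‖F k ξ‖ := by
    simp only [hnorm, integral_const_mul]
    exact (summable_norm_wsgd h0 h2.le h1).mul_right _
  have hhas := hasSum_integral_of_summable_integral_norm hFint hsum
  have hFk : ∀ k, ∫ ξ, F k ξ = (wsgd γ k : ℂ) * zeroExt L v (x - ((k : ℝ) - 1) * s) := by
    intro k
    simp only [hF]
    rw [integral_const_mul, ← h.ext_eq_integral (by linarith)]
  simp only [hFk] at hhas
  have hfin : HasSum (fun k : ℕ => (wsgd γ k : ℂ) * zeroExt L v (x - ((k : ℝ) - 1) * s))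
      (∑ k ∈ Finset.range K, (wsgd γ k : ℂ) * zeroExt L v (x - ((k : ℝ) - 1) * s)) :=
    hasSum_sum_of_ne_finset_zero (fun k hk => by rw [hK k (by simpa using hk), mul_zero])
  rw [hfin.unique hhas]
  congr 1
  ext ξ
  have h3 := (hasSum_wsgd h0 h2.le h1 (2 * Real.pi * ξ * s)).mul_right
    (Complex.exp (Complex.I * ((2 * Real.pi * ξ : ℝ) : ℂ) * x) * W ξ)
  rw [← h3.tsum_eq]
  congr 1
  ext k
  have h4 : Complex.exp (Complex.I * ((2 * Real.pi * ξ : ℝ) : ℂ) * (x - ((k : ℝ) - 1) * s : ℝ)) =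
      Complex.exp (Complex.I * ((2 * Real.pi * ξ * s : ℝ) : ℂ) * (1 - k)) *
        Complex.exp (Complex.I * ((2 * Real.pi * ξ : ℝ) : ℂ) * x) := by
    rw [← Complex.exp_add]
    congr 1
    push_cast
    ring
  simp only [hF]
  rw [h4]
  ring

end IsRegularFunction

theorem cpow_mul_ofReal_of_pos {s : ℝ} (hs : 0 < s) (z : ℂ) {γ : ℝ} (hγ : γ ≠ 0) :
    (z * s) ^ (γ : ℂ) = ((s ^ γ : ℝ) : ℂ) * z ^ (γ : ℂ) := by
  have hγ' : (γ : ℂ) ≠ 0 := by exact_mod_cast hγ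
  have hs' : (s : ℂ) ≠ 0 := by exact_mod_cast hs.ne'
  rcases eq_or_ne z 0 with rfl | hz
  · simp [hγ']
  · rw [Complex.cpow_def_of_ne_zero (mul_ne_zero hz hs'), Complex.log_mul_ofReal s hs z hz, add_mul,
      Complex.exp_add, Complex.cpow_def_of_ne_zero hz, Complex.ofReal_cpow hs.le,
      Complex.cpow_def_of_ne_zero hs', Complex.ofReal_log hs.le]

/-- Both terms are Fourier integrals of the same function. By homogeneity of (iω)^γ the multipliers
differ by s^(-γ) times the symbol error at ωs, which is at most C s² |ω|^(γ+2). -/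
theorem leftRL_sub_wsgd_le {γ : ℝ} (h0 : 0 < γ) (h2 : γ < 2) (h1 : γ ≠ 1) :
    ∃ C : ℝ, 0 < C ∧ ∀ (L : ℝ) (v : ℝ → ℝ), IsRegularFunction L (γ + 2) v →
      ∀ x ∈ Ioo 0 L, ∀ s : ℝ, 0 < s → ∀ K : ℕ,
        (∀ k : ℕ, K ≤ k → (Icc 0 L).indicator v (x - ((k : ℝ) - 1) * s) = 0) →
        |leftRL 0 γ v x - (∑ k ∈ Finset.range K,
          wsgd γ k * (Icc 0 L).indicator v (x - ((k : ℝ) - 1) * s)) / s ^ γ| ≤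
            C * s ^ 2 * ∫ ξ : ℝ, |ξ| ^ (γ + 2) * ‖𝓕 (zeroExt L v) ξ‖ := by
  obtain ⟨C, hC, hsym⟩ := norm_wsgdSymbol_sub_le h0 h2.le
  refine ⟨C * (2 * Real.pi) ^ (γ + 2), by positivity, fun L v h x hx s hs K hK => ?_⟩
  have hV : ∀ y, zeroExt L v y = (((Icc 0 L).indicator v y : ℝ) : ℂ) := fun y => by
    by_cases hy : y ∈ Icc 0 L <;> simp [zeroExt, hy]
  have hsγ : 0 < s ^ γ := Real.rpow_pos_of_pos hs _
  set W := 𝓕 (zeroExt L v) with hW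
  have hWi : Integrable W := h.integrable_fourier (by linarith)
  have hsum := h.sum_wsgd_eq_integral h0 h2 h1 x s (K := K) fun k hk => by
    rw [hV, hK k hk, Complex.ofReal_zero]
  have hWm := h.continuous_fourier.measurable
  have hexp : AEStronglyMeasurable fun ξ : ℝ =>
      Complex.exp (Complex.I * ((2 * Real.pi * ξ : ℝ) : ℂ) * x) * W ξ :=
    (by fun_prop : Measurable fun ξ : ℝ =>
      Complex.exp (Complex.I * ((2 * Real.pi * ξ : ℝ) : ℂ) * x) * W ξ).aestronglyMeasurable
  have hint1 : Integrable fun ξ : ℝ => (Complex.I * ((2 * Real.pi * ξ : ℝ) : ℂ)) ^ (γ : ℂ) *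
      (Complex.exp (Complex.I * ((2 * Real.pi * ξ : ℝ) : ℂ) * x) * W ξ) := by
    refine Integrable.mono' ((h.integrable_abs_rpow (s := γ) (by linarith)
      (by linarith)).const_mul ((2 * Real.pi) ^ γ)) ?_ ?_
    · exact ((by fun_prop : Measurable fun ξ : ℝ =>
        (Complex.I * ((2 * Real.pi * ξ : ℝ) : ℂ)) ^ (γ : ℂ)).aestronglyMeasurable).mul hexp
    · refine Filter.Eventually.of_forall fun ξ => ?_
      rw [norm_mul, norm_mul, norm_exp_I_mul_mul, one_mul, Complex.norm_cpow_real, norm_I_mul,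
        abs_mul, abs_of_pos (by positivity : 0 < 2 * Real.pi),
        Real.mul_rpow (by positivity) (abs_nonneg _), mul_assoc]
  have hint2 : Integrable fun ξ : ℝ => wsgdSymbol γ (2 * Real.pi * ξ * s) *
      (Complex.exp (Complex.I * ((2 * Real.pi * ξ : ℝ) : ℂ) * x) * W ξ) := by
    refine Integrable.mono' (hWi.norm.const_mul (2 ^ γ)) ?_ ?_
    · refine AEStronglyMeasurable.mul (Measurable.aestronglyMeasurable ?_) hexp
      unfold wsgdSymbol
      fun_prop
    · refine Filter.Eventually.of_forall fun ξ => ?_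
      rw [norm_mul, norm_mul, norm_exp_I_mul_mul, one_mul]
      gcongr
      exact norm_wsgdSymbol_le h0 h2.le _
  have hdiff : leftRL 0 γ v x - (∑ k ∈ Finset.range K,
      wsgd γ k * (Icc 0 L).indicator v (x - ((k : ℝ) - 1) * s)) / s ^ γ =
      (∫ ξ : ℝ, ((Complex.I * ((2 * Real.pi * ξ : ℝ) : ℂ)) ^ (γ : ℂ) *
        (Complex.exp (Complex.I * ((2 * Real.pi * ξ : ℝ) : ℂ) * x) * W ξ) -
        (((s ^ γ)⁻¹ : ℝ) : ℂ) * (wsgdSymbol γ (2 * Real.pi * ξ * s) *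
          (Complex.exp (Complex.I * ((2 * Real.pi * ξ : ℝ) : ℂ) * x) * W ξ)))).re := by
    rw [integral_sub hint1 (hint2.const_mul _), Complex.sub_re,
      ← h.leftRL_eq_integral h0 h2 h1 hx, integral_const_mul, ← hsum, Complex.re_ofReal_mul]
    simp only [hV]
    rw [← Complex.ofReal_re (∑ k ∈ Finset.range K, _), div_eq_inv_mul]
    push_cast
    rfl
  rw [hdiff]
  refine (Complex.abs_re_le_norm _).trans ?_
  rw [← integral_const_mul]
  refine norm_integral_le_of_norm_le (h.integrable.const_mul _)
    (Filter.Eventually.of_forall fun ξ => ?_)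
  have h3 : (Complex.I * ((2 * Real.pi * ξ * s : ℝ) : ℂ)) ^ (γ : ℂ) =
      ((s ^ γ : ℝ) : ℂ) * (Complex.I * ((2 * Real.pi * ξ : ℝ) : ℂ)) ^ (γ : ℂ) := by
    rw [← cpow_mul_ofReal_of_pos hs _ h0.ne']
    congr 1
    push_cast
    ring
  have h4 := hsym (2 * Real.pi * ξ * s)
  rw [h3] at h4
  have hsγ' : ((s ^ γ : ℝ) : ℂ) ≠ 0 := by exact_mod_cast hsγ.ne'
  have h5 : (Complex.I * ((2 * Real.pi * ξ : ℝ) : ℂ)) ^ (γ : ℂ) *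
        (Complex.exp (Complex.I * ((2 * Real.pi * ξ : ℝ) : ℂ) * x) * W ξ) -
        (((s ^ γ)⁻¹ : ℝ) : ℂ) * (wsgdSymbol γ (2 * Real.pi * ξ * s) *
          (Complex.exp (Complex.I * ((2 * Real.pi * ξ : ℝ) : ℂ) * x) * W ξ)) =
      -((((s ^ γ)⁻¹ : ℝ) : ℂ) * ((wsgdSymbol γ (2 * Real.pi * ξ * s) -
        ((s ^ γ : ℝ) : ℂ) * (Complex.I * ((2 * Real.pi * ξ : ℝ) : ℂ)) ^ (γ : ℂ)) *
          (Complex.exp (Complex.I * ((2 * Real.pi * ξ : ℝ) : ℂ) * x) * W ξ))) := by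
    rw [Complex.ofReal_inv]
    field_simp
    ring
  rw [h5, norm_neg, norm_mul, norm_mul, norm_mul, norm_exp_I_mul_mul, one_mul, Complex.norm_real,
    Real.norm_of_nonneg (by positivity)]
  have h6 : |2 * Real.pi * ξ * s| ^ (γ + 2) =
      (2 * Real.pi) ^ (γ + 2) * |ξ| ^ (γ + 2) * (s ^ γ * s ^ 2) := by
    rw [abs_mul, abs_mul, abs_of_pos (by positivity : 0 < 2 * Real.pi), abs_of_pos hs,
      Real.mul_rpow (by positivity) hs.le, Real.mul_rpow (by positivity) (abs_nonneg _),
      Real.rpow_add hs]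
    norm_cast
  rw [h6] at h4
  calc _ ≤ (s ^ γ)⁻¹ * ((C * ((2 * Real.pi) ^ (γ + 2) * |ξ| ^ (γ + 2) * (s ^ γ * s ^ 2))) *
        ‖W ξ‖) := by gcongr
    _ = _ := by field_simp

/-! ### Second order consistency in space -/

theorem node_mem_Ioo {L : ℝ} (hL : 0 < L) {m : ℕ} (i : Fin (m - 1)) :
    ((i : ℕ) + 1 : ℝ) * (L / m) ∈ Ioo 0 L := by
  have hi := i.2
  have hm : (0 : ℝ) < m := by exact_mod_cast (by omega : 0 < m)
  refine ⟨by positivity, ?_⟩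
  rw [mul_div_assoc', div_lt_iff₀ hm, mul_comm]
  have : ((i : ℕ) + 1 : ℝ) < m := by exact_mod_cast (by omega : (i : ℕ) + 1 < m)
  gcongr

/-- A matrix row is a truncated convolution on the line. The boundary nodes 0 (k = i + 2) and L do
not occur in the matrix, but v vanishes there. -/
theorem wsgdMatrix_mulVec_gridValues (γ : ℝ) {L : ℝ} (hL : 0 < L) {v : ℝ → ℝ} (h0 : v 0 = 0)
    (hvL : v L = 0) {m : ℕ} (i : Fin (m - 1)) :
    (wsgdMatrix γ m *ᵥ gridValues L m v) i = ∑ k ∈ Finset.range ((i : ℕ) + 3),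
      wsgd γ k * (Icc 0 L).indicator v (((i : ℕ) + 1 : ℝ) * (L / m) - ((k : ℝ) - 1) * (L / m)) := by
  have hi := i.2
  have hm : (m : ℝ) ≠ 0 := by exact_mod_cast (by omega : m ≠ 0)
  set V := (Icc 0 L).indicator v with hV
  set h := L / m with hh
  have hV0 : V 0 = 0 := by simp [hV, hL.le, h0]
  have hVL : V L = 0 := by simp [hV, hL.le, hvL]
  set G : ℕ → ℝ := fun j => if j ≤ (i : ℕ) + 1 then wsgd γ ((i : ℕ) + 1 - j) * V (((j : ℝ) + 1) * h)
    else 0 with hG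
  have h1 : (wsgdMatrix γ m *ᵥ gridValues L m v) i = ∑ j ∈ Finset.range m, G j := by
    obtain ⟨m', rfl⟩ : ∃ m', m = m' + 1 := ⟨m - 1, by omega⟩
    rw [Finset.sum_range_succ, Finset.sum_range]
    have h2 : G m' = 0 := by
      have h3 : ((m' : ℝ) + 1) * h = L := by
        rw [hh]
        push_cast at hm ⊢
        field_simp
      simp only [hG, h3, hVL, mul_zero, ite_self]
    rw [h2, add_zero]
    simp only [Matrix.mulVec, dotProduct, wsgdMatrix, Matrix.of_apply, gridValues]
    refine Finset.sum_congr rfl fun j _ => ?_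
    have h4 := node_mem_Ioo hL j
    have h5 : V (((j : ℕ) + 1 : ℝ) * h) = v (((j : ℕ) + 1 : ℝ) * h) :=
      indicator_of_mem (Ioo_subset_Icc_self h4) v
    simp only [hG, h5, ite_mul, zero_mul]
    rfl
  have h2 : ∑ j ∈ Finset.range m, G j = ∑ j ∈ Finset.range ((i : ℕ) + 2), G j := by
    refine (Finset.sum_subset (Finset.range_subset_range.2 (by omega)) fun j _ hj => ?_).symm
    rw [Finset.mem_range] at hj
    exact if_neg (by omega)
  rw [h1, h2, Finset.sum_range_succ _ ((i : ℕ) + 2), ← Finset.sum_range_reflect]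
  have h3 : ((i : ℕ) + 1 : ℝ) * h - ((((i : ℕ) + 2 : ℕ) : ℝ) - 1) * h = 0 := by
    push_cast
    ring
  rw [h3, hV0, mul_zero, add_zero]
  refine Finset.sum_congr rfl fun k hk => ?_
  rw [Finset.mem_range] at hk
  simp only [hG]
  rw [if_pos (by omega), show (i : ℕ) + 1 - ((i : ℕ) + 2 - 1 - k) = k by omega]
  congr 2
  have : (((i : ℕ) + 2 - 1 - k : ℕ) : ℝ) = (i : ℕ) + 1 - (k : ℝ) := by
    rw [show (i : ℕ) + 2 - 1 - k = (i : ℕ) + 1 - k by omega, Nat.cast_sub (by omega)]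
    push_cast
    ring
  rw [this]
  ring

theorem node_rev {L : ℝ} {m : ℕ} (i : Fin (m - 1)) :
    (((Fin.rev i : Fin (m - 1)) : ℕ) + 1 : ℝ) * (L / m) = L - ((i : ℕ) + 1 : ℝ) * (L / m) := by
  have hi := i.2
  have hm : (m : ℝ) ≠ 0 := by exact_mod_cast (by omega : m ≠ 0)
  have h1 : ((Fin.rev i : Fin (m - 1)) : ℕ) + 1 + ((i : ℕ) + 1) = m := by
    rw [Fin.val_rev]
    omega
  have h2 : (((Fin.rev i : Fin (m - 1)) : ℕ) + 1 : ℝ) = m - ((i : ℕ) + 1) := by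
    rw [eq_sub_iff_add_eq]
    exact_mod_cast h1
  rw [h2]
  field_simp

/-- A Toeplitz matrix is transposed by reversing the order of the nodes, that is by x ↦ L - x. With
the same reflection of the derivatives, the right-sided estimates reduce to the left-sided ones. -/
theorem wsgdMatrix_transpose_mulVec_gridValues (γ L : ℝ) (v : ℝ → ℝ) {m : ℕ} (i : Fin (m - 1)) :
    ((wsgdMatrix γ m)ᵀ *ᵥ gridValues L m v) i =
      (wsgdMatrix γ m *ᵥ gridValues L m fun x => v (L - x)) (Fin.rev i) := by
  simp only [Matrix.mulVec, dotProduct]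
  rw [← Equiv.sum_comp Fin.revPerm]
  refine Finset.sum_congr rfl fun j _ => ?_
  have h1 : gridValues L m (fun x => v (L - x)) j = gridValues L m v (Fin.rev j) := by
    simp only [gridValues]
    rw [node_rev]
  rw [h1]
  change wsgdMatrix γ m (Fin.rev j) i * gridValues L m v (Fin.rev j) =
    wsgdMatrix γ m (Fin.rev i) j * gridValues L m v (Fin.rev j)
  have hi := i.2
  have hj := j.2
  congr 1
  simp only [wsgdMatrix, Matrix.of_apply, Fin.val_rev]
  rw [show m - 1 - ((j : ℕ) + 1) + 1 - i = m - 1 - ((i : ℕ) + 1) + 1 - j by omega]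
  exact if_congr (by omega) rfl rfl

theorem rightRL_eq_leftRL (L γ : ℝ) (v : ℝ → ℝ) (x : ℝ) :
    rightRL L γ v x = leftRL 0 γ (fun y => v (L - y)) (L - x) := by
  have h1 : (fun y => ∫ ξ in y..L, (ξ - y) ^ (((⌊γ⌋₊ + 1 : ℕ) : ℝ) - γ - 1) * v ξ) = fun y =>
      (fun z => ∫ ξ in (0 : ℝ)..z, (z - ξ) ^ (((⌊γ⌋₊ + 1 : ℕ) : ℝ) - γ - 1) * v (L - ξ)) (L - y) := by
    ext y
    have := intervalIntegral.integral_comp_sub_left (a := 0) (b := L - y)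
      (fun ξ => (ξ - y) ^ (((⌊γ⌋₊ + 1 : ℕ) : ℝ) - γ - 1) * v ξ) L
    rw [sub_sub_cancel, sub_zero] at this
    rw [← this]
    refine intervalIntegral.integral_congr fun ξ _ => ?_
    rw [sub_right_comm]
  have h2 := congrFun (iteratedDeriv_comp_const_sub (n := ⌊γ⌋₊ + 1)
    (f := fun z => ∫ ξ in (0 : ℝ)..z, (z - ξ) ^ (((⌊γ⌋₊ + 1 : ℕ) : ℝ) - γ - 1) * v (L - ξ))
    (s := L)) x
  rw [rightRL, leftRL, h1, h2, smul_eq_mul, ← mul_assoc]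
  congr 1
  rw [div_mul_eq_mul_div, ← mul_pow]
  norm_num

theorem zeroExt_comp_sub (L : ℝ) (v : ℝ → ℝ) :
    zeroExt L (fun y => v (L - y)) = fun x => zeroExt L v (L - x) := by
  ext x
  by_cases hx : x ∈ Icc 0 L
  · rw [zeroExt, zeroExt, indicator_of_mem hx,
      indicator_of_mem (show L - x ∈ Icc 0 L from ⟨by linarith [hx.2], by linarith [hx.1]⟩)]
  · rw [zeroExt, zeroExt, indicator_of_notMem hx, indicator_of_notMem fun h =>
      hx ⟨by linarith [h.2], by linarith [h.1]⟩]

/-- Reflection changes ξ to -ξ, and the translation by L contributes only a phase. -/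
theorem norm_fourier_zeroExt_comp_sub (L : ℝ) (v : ℝ → ℝ) (ξ : ℝ) :
    ‖𝓕 (zeroExt L fun y => v (L - y)) ξ‖ = ‖𝓕 (zeroExt L v) (-ξ)‖ := by
  rw [zeroExt_comp_sub, Real.fourier_real_eq_integral_exp_smul,
    Real.fourier_real_eq_integral_exp_smul]
  have h1 := integral_sub_left_eq_self
    (fun x : ℝ => Complex.exp (((-2 * Real.pi * (L - x) * ξ : ℝ) : ℂ) * Complex.I) • zeroExt L v x)
    volume L
  simp only [sub_sub_cancel] at h1
  rw [h1]
  have h2 : ∀ x : ℝ,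
      Complex.exp (((-2 * Real.pi * (L - x) * ξ : ℝ) : ℂ) * Complex.I) • zeroExt L v x =
      Complex.exp (((-2 * Real.pi * L * ξ : ℝ) : ℂ) * Complex.I) *
        Complex.exp (((-2 * Real.pi * x * -ξ : ℝ) : ℂ) * Complex.I) • zeroExt L v x := by
    intro x
    rw [smul_eq_mul, smul_eq_mul, ← mul_assoc, ← Complex.exp_add]
    congr 2
    push_cast
    ring
  simp only [h2]
  rw [integral_const_mul, norm_mul, Complex.norm_exp_ofReal_mul_I, one_mul]

theorem IsRegularFunction.comp_sub {L p : ℝ} {v : ℝ → ℝ} (h : IsRegularFunction L p v) :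
    IsRegularFunction L p fun y => v (L - y) where
  continuousOn := h.continuousOn.comp (by fun_prop)
    fun x hx => ⟨by linarith [hx.2], by linarith [hx.1]⟩
  left := by simpa using h.right
  right := by simpa using h.left
  integrable := by
    simp only [norm_fourier_zeroExt_comp_sub]
    simpa using h.integrable.comp_neg

theorem integral_norm_fourier_comp_sub (L p : ℝ) (v : ℝ → ℝ) :
    ∫ ξ : ℝ, |ξ| ^ p * ‖𝓕 (zeroExt L fun y => v (L - y)) ξ‖ =
      ∫ ξ : ℝ, |ξ| ^ p * ‖𝓕 (zeroExt L v) ξ‖ := by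
  simp only [norm_fourier_zeroExt_comp_sub]
  have := integral_neg_eq_self (fun ξ : ℝ => |ξ| ^ p * ‖𝓕 (zeroExt L v) ξ‖) volume
  simpa using this

theorem leftRL_consistency {γ : ℝ} (h0 : 0 < γ) (h2 : γ < 2) (h1 : γ ≠ 1) :
    ∃ C : ℝ, 0 < C ∧ ∀ (L : ℝ) (v : ℝ → ℝ), 0 < L → IsRegularFunction L (γ + 2) v →
      ∀ (m : ℕ) (i : Fin (m - 1)),
        |leftRL 0 γ v (((i : ℕ) + 1 : ℝ) * (L / m)) -
          (wsgdMatrix γ m *ᵥ gridValues L m v) i / (L / m) ^ γ| ≤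
            C * (L / m) ^ 2 * ∫ ξ : ℝ, |ξ| ^ (γ + 2) * ‖𝓕 (zeroExt L v) ξ‖ := by
  obtain ⟨C, hC, hbound⟩ := leftRL_sub_wsgd_le h0 h2 h1
  refine ⟨C, hC, fun L v hL h m i => ?_⟩
  have hm : (0 : ℝ) < m := by exact_mod_cast (by have := i.2; omega : 0 < m)
  have hh : 0 < L / m := by positivity
  rw [wsgdMatrix_mulVec_gridValues γ hL h.left h.right]
  refine hbound L v h _ (node_mem_Ioo hL i) _ hh _ fun k hk => ?_
  have hk' : ((i : ℕ) + 3 : ℝ) ≤ k := by exact_mod_cast hk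
  refine indicator_of_notMem (fun h' => ?_) _
  have h3 := h'.1
  rw [← sub_mul] at h3
  nlinarith

/-! ### Symmetric Taylor estimates -/

/-- One step up the Taylor ladder: differentiating each symmetric difference below gives the one of
lower order for the derivative. The mean value theorem is used without gaining factorials, whence
the uniform constant 2B. -/
theorem abs_le_of_abs_deriv_le {φ φ' : ℝ → ℝ} {h M : ℝ} {k : ℕ} (hM : 0 ≤ M)
    (hc : ContinuousOn φ (Icc 0 h)) (h0 : φ 0 = 0) (hd : ∀ s ∈ Ioo 0 h, HasDerivAt φ (φ' s) s)
    (hb : ∀ s ∈ Ioo 0 h, |φ' s| ≤ M * s ^ k) {s : ℝ} (hs : s ∈ Icc 0 h) :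
    |φ s| ≤ M * s ^ (k + 1) := by
  rcases hs.1.eq_or_lt with rfl | hs0
  · simp [h0]
  obtain ⟨c, hc', hcd⟩ := exists_hasDerivAt_eq_slope φ φ' hs0
    (hc.mono (Icc_subset_Icc_right hs.2)) fun y hy => hd y ⟨hy.1, hy.2.trans_le hs.2⟩
  rw [h0, sub_zero, sub_zero, eq_div_iff hs0.ne'] at hcd
  rw [← hcd, abs_mul, abs_of_pos hs0, pow_succ, ← mul_assoc]
  refine mul_le_mul_of_nonneg_right ((hb c ⟨hc'.1, hc'.2.trans_le hs.2⟩).trans ?_) hs0.le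
  have := hc'.1.le
  have := hc'.2.le
  gcongr

section SymmetricTaylor

variable {x h B : ℝ} {f f₁ f₂ f₃ f₄ : ℝ → ℝ}

theorem continuousOn_comp_add (hf : ContinuousOn f (Icc (x - h) (x + h))) :
    ContinuousOn (fun s => f (x + s)) (Icc 0 h) :=
  hf.comp (by fun_prop) fun s hs => ⟨by linarith [hs.1, hs.2], by linarith [hs.2]⟩

theorem continuousOn_comp_sub (hf : ContinuousOn f (Icc (x - h) (x + h))) :
    ContinuousOn (fun s => f (x - s)) (Icc 0 h) :=
  hf.comp (by fun_prop) fun s hs => ⟨by linarith [hs.2], by linarith [hs.1, hs.2]⟩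

theorem hasDerivAt_comp_add (hd : ∀ y ∈ Ioo (x - h) (x + h), HasDerivAt f (f₁ y) y) {s : ℝ}
    (hs : s ∈ Ioo 0 h) : HasDerivAt (fun s => f (x + s)) (f₁ (x + s)) s :=
  HasDerivAt.comp_const_add x s (hd _ ⟨by linarith [hs.1, hs.2], by linarith [hs.2]⟩)

theorem hasDerivAt_comp_sub (hd : ∀ y ∈ Ioo (x - h) (x + h), HasDerivAt f (f₁ y) y) {s : ℝ}
    (hs : s ∈ Ioo 0 h) : HasDerivAt (fun s => f (x - s)) (-f₁ (x - s)) s :=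
  HasDerivAt.comp_const_sub x s (hd _ ⟨by linarith [hs.2], by linarith [hs.1, hs.2]⟩)

theorem symmetric_difference_bound_one (hB : 0 ≤ B) (hf : ContinuousOn f (Icc (x - h) (x + h)))
    (hd : ∀ y ∈ Ioo (x - h) (x + h), HasDerivAt f (f₁ y) y)
    (hb : ∀ y ∈ Ioo (x - h) (x + h), |f₁ y| ≤ B) {s : ℝ} (hs : s ∈ Icc 0 h) :
    |f (x + s) - f (x - s)| ≤ 2 * B * s := by
  have := abs_le_of_abs_deriv_le (φ := fun s => f (x + s) - f (x - s))
    (φ' := fun s => f₁ (x + s) - -f₁ (x - s)) (k := 0) (M := 2 * B) (by positivity)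
    ((continuousOn_comp_add hf).sub (continuousOn_comp_sub hf)) (by simp)
    (fun s hs => (hasDerivAt_comp_add hd hs).sub (hasDerivAt_comp_sub hd hs)) (fun s hs => by
      have h1 := hb (x + s) ⟨by linarith [hs.1, hs.2], by linarith [hs.2]⟩
      have h2 := hb (x - s) ⟨by linarith [hs.2], by linarith [hs.1, hs.2]⟩
      rw [sub_neg_eq_add, pow_zero, mul_one]
      exact (abs_add_le _ _).trans (by linarith)) hs
  simpa using this

theorem symmetric_difference_bound_two (hB : 0 ≤ B) (hf : ContinuousOn f (Icc (x - h) (x + h)))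
    (hf₁ : ContinuousOn f₁ (Icc (x - h) (x + h)))
    (hd : ∀ y ∈ Ioo (x - h) (x + h), HasDerivAt f (f₁ y) y)
    (hd₁ : ∀ y ∈ Ioo (x - h) (x + h), HasDerivAt f₁ (f₂ y) y)
    (hb : ∀ y ∈ Ioo (x - h) (x + h), |f₂ y| ≤ B) {s : ℝ} (hs : s ∈ Icc 0 h) :
    |f (x + s) + f (x - s) - 2 * f x| ≤ 2 * B * s ^ 2 := by
  refine abs_le_of_abs_deriv_le (φ := fun s => f (x + s) + f (x - s) - 2 * f x)
    (φ' := fun s => f₁ (x + s) + -f₁ (x - s)) (k := 1) (M := 2 * B) (by positivity)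
    (((continuousOn_comp_add hf).add (continuousOn_comp_sub hf)).sub continuousOn_const)
    (by simp; ring)
    (fun s hs => ((hasDerivAt_comp_add hd hs).add (hasDerivAt_comp_sub hd hs)).sub_const _)
    (fun s hs => ?_) hs
  rw [← sub_eq_add_neg, pow_one]
  exact symmetric_difference_bound_one hB hf₁ hd₁ hb (Ioo_subset_Icc_self hs)

theorem symmetric_difference_bound_three (hB : 0 ≤ B) (hf : ContinuousOn f (Icc (x - h) (x + h)))
    (hf₁ : ContinuousOn f₁ (Icc (x - h) (x + h))) (hf₂ : ContinuousOn f₂ (Icc (x - h) (x + h)))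
    (hd : ∀ y ∈ Ioo (x - h) (x + h), HasDerivAt f (f₁ y) y)
    (hd₁ : ∀ y ∈ Ioo (x - h) (x + h), HasDerivAt f₁ (f₂ y) y)
    (hd₂ : ∀ y ∈ Ioo (x - h) (x + h), HasDerivAt f₂ (f₃ y) y)
    (hb : ∀ y ∈ Ioo (x - h) (x + h), |f₃ y| ≤ B) {s : ℝ} (hs : s ∈ Icc 0 h) :
    |f (x + s) - f (x - s) - s * (2 * f₁ x)| ≤ 2 * B * s ^ 3 := by
  refine abs_le_of_abs_deriv_le (φ := fun s => f (x + s) - f (x - s) - s * (2 * f₁ x))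
    (φ' := fun s => f₁ (x + s) - -f₁ (x - s) - 1 * (2 * f₁ x)) (k := 2) (M := 2 * B) (by positivity)
    (((continuousOn_comp_add hf).sub (continuousOn_comp_sub hf)).sub (by fun_prop))
    (by simp)
    (fun s hs => ((hasDerivAt_comp_add hd hs).sub (hasDerivAt_comp_sub hd hs)).sub
      ((hasDerivAt_id s).mul_const _))
    (fun s hs => ?_) hs
  rw [sub_neg_eq_add, one_mul]
  exact symmetric_difference_bound_two hB hf₁ hf₂ hd₁ hd₂ hb (Ioo_subset_Icc_self hs)

theorem symmetric_difference_bound_four (hB : 0 ≤ B) (hf : ContinuousOn f (Icc (x - h) (x + h)))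
    (hf₁ : ContinuousOn f₁ (Icc (x - h) (x + h))) (hf₂ : ContinuousOn f₂ (Icc (x - h) (x + h)))
    (hf₃ : ContinuousOn f₃ (Icc (x - h) (x + h)))
    (hd : ∀ y ∈ Ioo (x - h) (x + h), HasDerivAt f (f₁ y) y)
    (hd₁ : ∀ y ∈ Ioo (x - h) (x + h), HasDerivAt f₁ (f₂ y) y)
    (hd₂ : ∀ y ∈ Ioo (x - h) (x + h), HasDerivAt f₂ (f₃ y) y)
    (hd₃ : ∀ y ∈ Ioo (x - h) (x + h), HasDerivAt f₃ (f₄ y) y)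
    (hb : ∀ y ∈ Ioo (x - h) (x + h), |f₄ y| ≤ B) {s : ℝ} (hs : s ∈ Icc 0 h) :
    |f (x + s) + f (x - s) - 2 * f x - s ^ 2 * f₂ x| ≤ 2 * B * s ^ 4 := by
  refine abs_le_of_abs_deriv_le (φ := fun s => f (x + s) + f (x - s) - 2 * f x - s ^ 2 * f₂ x)
    (φ' := fun s => f₁ (x + s) + -f₁ (x - s) - 2 * s * f₂ x) (k := 3) (M := 2 * B) (by positivity)
    ((((continuousOn_comp_add hf).add (continuousOn_comp_sub hf)).sub continuousOn_const).sub
      (by fun_prop))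
    (by simp; ring)
    (fun s hs => (((hasDerivAt_comp_add hd hs).add (hasDerivAt_comp_sub hd hs)).sub_const _).sub
      (by simpa using (hasDerivAt_pow 2 s).mul_const (f₂ x)))
    (fun s hs => ?_) hs
  rw [← sub_eq_add_neg, show 2 * s * f₂ x = s * (2 * f₂ x) by ring]
  exact symmetric_difference_bound_three hB hf₁ hf₂ hf₃ hd₁ hd₂ hd₃ hb (Ioo_subset_Icc_self hs)

end SymmetricTaylor

theorem hasDerivAt_iteratedDerivWithin {a b : ℝ} {v : ℝ → ℝ} {n : ℕ}
    (hv : ContDiffOn ℝ n v (Icc a b)) {k : ℕ} (hk : k < n) {y : ℝ} (hy : y ∈ Ioo a b) :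
    HasDerivAt (iteratedDerivWithin k v (Icc a b))
      (iteratedDerivWithin (k + 1) v (Icc a b) y) y := by
  have hu : UniqueDiffOn ℝ (Icc a b) := uniqueDiffOn_Icc (hy.1.trans hy.2)
  have h1 := (hv.differentiableOn_iteratedDerivWithin (by exact_mod_cast hk) hu) y
    (Ioo_subset_Icc_self hy)
  rw [iteratedDerivWithin_succ]
  exact h1.hasDerivWithinAt.hasDerivAt (Icc_mem_nhds hy.1 hy.2)

theorem continuousOn_iteratedDerivWithin_Icc {a b : ℝ} (hab : a < b) {v : ℝ → ℝ} {n : ℕ}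
    (hv : ContDiffOn ℝ n v (Icc a b)) {k : ℕ} (hk : k ≤ n) :
    ContinuousOn (iteratedDerivWithin k v (Icc a b)) (Icc a b) :=
  hv.continuousOn_iteratedDerivWithin (by exact_mod_cast hk) (uniqueDiffOn_Icc hab)

/-! ### The local case of order two -/

theorem iteratedDeriv_two_eq_of_eventuallyEq {L : ℝ} {v F : ℝ → ℝ}
    (hv : ContDiffOn ℝ 4 v (Icc 0 L)) {x : ℝ} (hx : x ∈ Ioo 0 L) (hF : F =ᶠ[nhds x] v) :
    iteratedDeriv 2 F x = iteratedDerivWithin 2 v (Icc 0 L) x := by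
  have hv' : ContDiffOn ℝ (4 : ℕ) v (Icc 0 L) := hv
  have h3 : deriv v =ᶠ[nhds x] iteratedDerivWithin 1 v (Icc 0 L) := by
    filter_upwards [Ioo_mem_nhds hx.1 hx.2] with y hy
    have := hasDerivAt_iteratedDerivWithin hv' (k := 0) (by norm_num) hy
    rw [iteratedDerivWithin_zero] at this
    exact this.deriv
  rw [hF.iteratedDeriv_eq, iteratedDeriv_succ, iteratedDeriv_one, h3.deriv_eq]
  exact (hasDerivAt_iteratedDerivWithin hv' (k := 1) (by norm_num) hx).deriv

/-- For γ = 2 the definition takes n = 3 and the kernel exponent is 0, so this is the third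
derivative of an antiderivative. -/
theorem leftRL_two {L : ℝ} {v : ℝ → ℝ} (hv : ContDiffOn ℝ 4 v (Icc 0 L)) {x : ℝ}
    (hx : x ∈ Ioo 0 L) : leftRL 0 2 v x = iteratedDerivWithin 2 v (Icc 0 L) x := by
  have hfloor : ⌊(2 : ℝ)⌋₊ = 2 := by norm_num
  have h2 : deriv (fun y => ∫ ξ in (0 : ℝ)..y, v ξ) =ᶠ[nhds x] v := by
    filter_upwards [Ioo_mem_nhds hx.1 hx.2] with y hy
    refine (intervalIntegral.integral_hasDerivAt_right ?_ ?_ ?_).deriv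
    · refine ContinuousOn.intervalIntegrable (hv.continuousOn.mono ?_)
      rw [uIcc_of_le hy.1.le]
      exact Icc_subset_Icc_right hy.2.le
    · exact (hv.continuousOn.mono Ioo_subset_Icc_self).stronglyMeasurableAtFilter isOpen_Ioo _ hy
    · exact hv.continuousOn.continuousAt (Icc_mem_nhds hy.1 hy.2)
  rw [leftRL, hfloor]
  norm_num
  rw [iteratedDeriv_succ', iteratedDeriv_two_eq_of_eventuallyEq hv hx h2]

theorem rightRL_two {L : ℝ} {v : ℝ → ℝ} (hv : ContDiffOn ℝ 4 v (Icc 0 L)) {x : ℝ}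
    (hx : x ∈ Ioo 0 L) : rightRL L 2 v x = iteratedDerivWithin 2 v (Icc 0 L) x := by
  have hfloor : ⌊(2 : ℝ)⌋₊ = 2 := by norm_num
  have h2 : deriv (fun y => -∫ ξ in y..L, v ξ) =ᶠ[nhds x] v := by
    filter_upwards [Ioo_mem_nhds hx.1 hx.2] with y hy
    have h3 : HasDerivAt (fun y => ∫ ξ in y..L, v ξ) (-v y) y := by
      refine intervalIntegral.integral_hasDerivAt_left ?_ ?_ ?_
      · refine ContinuousOn.intervalIntegrable (hv.continuousOn.mono ?_)
        rw [uIcc_of_le hy.2.le]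
        exact Icc_subset_Icc_left hy.1.le
      · exact (hv.continuousOn.mono Ioo_subset_Icc_self).stronglyMeasurableAtFilter isOpen_Ioo _ hy
      · exact hv.continuousOn.continuousAt (Icc_mem_nhds hy.1 hy.2)
    simpa using h3.fun_neg.deriv
  have h4 : iteratedDeriv 3 (fun y => ∫ ξ in y..L, v ξ) x =
      -iteratedDerivWithin 2 v (Icc 0 L) x := by
    rw [← iteratedDeriv_two_eq_of_eventuallyEq hv hx h2, ← iteratedDeriv_succ', ← Pi.neg_def,
      iteratedDeriv_neg]
    simp
  rw [rightRL, hfloor]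
  norm_num
  rw [h4]
  norm_num

theorem wsgd_two : wsgd 2 0 = 1 ∧ wsgd 2 1 = -2 ∧ wsgd 2 2 = 1 ∧ ∀ k, wsgd 2 (k + 3) = 0 := by
  have h3 : ∀ k, grunwald 2 (k + 3) = 0 := by
    intro k
    induction k with
    | zero => simp [grunwald]; norm_num
    | succ k ih => rw [show k + 1 + 3 = (k + 3) + 1 by ring, grunwald_succ, ih, mul_zero]
  refine ⟨by simp [wsgd, grunwald], by norm_num [wsgd, grunwald], by norm_num [wsgd, grunwald],
    fun k => ?_⟩
  change wsgd 2 ((k + 2) + 1) = 0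
  rw [wsgd_succ, h3]
  norm_num

theorem wsgdMatrix_two_mulVec_gridValues {L : ℝ} (hL : 0 < L) {v : ℝ → ℝ} (h0 : v 0 = 0)
    (hvL : v L = 0) {m : ℕ} (i : Fin (m - 1)) :
    (wsgdMatrix 2 m *ᵥ gridValues L m v) i =
      v (((i : ℕ) + 1 : ℝ) * (L / m) + L / m) + v (((i : ℕ) + 1 : ℝ) * (L / m) - L / m) -
        2 * v (((i : ℕ) + 1 : ℝ) * (L / m)) := by
  obtain ⟨h1, h2, h3, h4⟩ := wsgd_two
  have hi := i.2
  have hm : (0 : ℝ) < m := by exact_mod_cast (by omega : 0 < m)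
  have hh : 0 < L / m := by positivity
  rw [wsgdMatrix_mulVec_gridValues 2 hL h0 hvL, add_comm (i : ℕ) 3, Finset.sum_range_add,
    Finset.sum_eq_zero (s := Finset.range (i : ℕ)) (fun k _ => by rw [add_comm 3 k, h4, zero_mul])]
  simp only [Finset.sum_range_succ, Finset.sum_range_zero, h1, h2, h3]
  have hL' : L = m * (L / m) := by field_simp
  have him : ((i : ℕ) + 2 : ℝ) ≤ m := by exact_mod_cast (by omega : (i : ℕ) + 2 ≤ m)
  set h := L / m with hhdef
  have hx : ((i : ℕ) + 1 : ℝ) * h ∈ Icc 0 L := ⟨by positivity, by rw [hL']; gcongr; linarith⟩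
  have hx1 : ((i : ℕ) + 1 : ℝ) * h + h ∈ Icc 0 L := ⟨by positivity, by
    rw [hL']
    calc _ = ((i : ℕ) + 2 : ℝ) * h := by ring
      _ ≤ _ := by gcongr⟩
  have hx2 : ((i : ℕ) + 1 : ℝ) * h - h ∈ Icc 0 L := ⟨by
    calc (0 : ℝ) ≤ (i : ℕ) * h := by positivity
      _ = _ := by ring, by linarith [hx.2]⟩
  push_cast
  rw [show ((i : ℕ) + 1 : ℝ) * h - (0 - 1) * h = ((i : ℕ) + 1 : ℝ) * h + h by ring,
    show ((i : ℕ) + 1 : ℝ) * h - (1 - 1) * h = ((i : ℕ) + 1 : ℝ) * h by ring,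
    show ((i : ℕ) + 1 : ℝ) * h - (2 - 1) * h = ((i : ℕ) + 1 : ℝ) * h - h by ring,
    indicator_of_mem hx, indicator_of_mem hx1, indicator_of_mem hx2]
  ring

theorem wsgdMatrix_two_transpose_mulVec_gridValues {L : ℝ} (hL : 0 < L) {v : ℝ → ℝ}
    (h0 : v 0 = 0) (hvL : v L = 0) {m : ℕ} (i : Fin (m - 1)) :
    ((wsgdMatrix 2 m)ᵀ *ᵥ gridValues L m v) i =
      v (((i : ℕ) + 1 : ℝ) * (L / m) + L / m) + v (((i : ℕ) + 1 : ℝ) * (L / m) - L / m) -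
        2 * v (((i : ℕ) + 1 : ℝ) * (L / m)) := by
  rw [wsgdMatrix_transpose_mulVec_gridValues,
    wsgdMatrix_two_mulVec_gridValues hL (by simpa using hvL)
    (by simpa using h0), node_rev,
    show L - (L - ((i : ℕ) + 1 : ℝ) * (L / m) + L / m) = ((i : ℕ) + 1 : ℝ) * (L / m) - L / m by ring,
    show L - (L - ((i : ℕ) + 1 : ℝ) * (L / m) - L / m) = ((i : ℕ) + 1 : ℝ) * (L / m) + L / m by ring,
    sub_sub_cancel]
  ring

theorem second_difference_bound {L B : ℝ} {v : ℝ → ℝ} (hv : ContDiffOn ℝ 4 v (Icc 0 L))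
    (hB : ∀ x ∈ Icc 0 L, |iteratedDerivWithin 4 v (Icc 0 L) x| ≤ B) {x h : ℝ} (hh : 0 < h)
    (h1 : 0 ≤ x - h) (h2 : x + h ≤ L) :
    |iteratedDerivWithin 2 v (Icc 0 L) x - (v (x + h) + v (x - h) - 2 * v x) / h ^ 2| ≤
      2 * B * h ^ 2 := by
  have hv' : ContDiffOn ℝ (4 : ℕ) v (Icc 0 L) := hv
  have hsub : Icc (x - h) (x + h) ⊆ Icc 0 L := Icc_subset_Icc h1 h2
  have hsub' : Ioo (x - h) (x + h) ⊆ Ioo 0 L := Ioo_subset_Ioo h1 h2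
  have hB0 : 0 ≤ B := (abs_nonneg _).trans (hB x ⟨by linarith, by linarith⟩)
  have hL : 0 < L := by linarith
  have hc : ∀ k ≤ 4, ContinuousOn (iteratedDerivWithin k v (Icc 0 L)) (Icc (x - h) (x + h)) :=
    fun k hk => (continuousOn_iteratedDerivWithin_Icc hL hv' hk).mono hsub
  have hd : ∀ k < 4, ∀ y ∈ Ioo (x - h) (x + h), HasDerivAt (iteratedDerivWithin k v (Icc 0 L))
      (iteratedDerivWithin (k + 1) v (Icc 0 L) y) y :=
    fun k hk y hy => hasDerivAt_iteratedDerivWithin hv' hk (hsub' hy)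
  have h3 := symmetric_difference_bound_four hB0 (hc 0 (by norm_num)) (hc 1 (by norm_num))
    (hc 2 (by norm_num)) (hc 3 (by norm_num)) (hd 0 (by norm_num)) (hd 1 (by norm_num))
    (hd 2 (by norm_num)) (hd 3 (by norm_num))
    (fun y hy => hB y (Ioo_subset_Icc_self (hsub' hy))) (right_mem_Icc.2 hh.le)
  rw [iteratedDerivWithin_zero] at h3
  have h4 : iteratedDerivWithin 2 v (Icc 0 L) x - (v (x + h) + v (x - h) - 2 * v x) / h ^ 2 =
      -(v (x + h) + v (x - h) - 2 * v x - h ^ 2 * iteratedDerivWithin 2 v (Icc 0 L) x) / h ^ 2 := by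
    field_simp
    ring
  rw [h4, abs_div, abs_neg, abs_of_pos (by positivity : 0 < h ^ 2), div_le_iff₀ (by positivity)]
  exact h3.trans_eq (by ring)

/-! ### Consistency of the Crank-Nicolson scheme -/

/-- After factoring out -c_γ the error is the sum of the left and right errors. For γ < 2 the right
one is the left error of the reflected function at the reversed index; for γ = 2 both are the error
of the central second difference. -/
theorem rieszDeriv_consistency {γ L T : ℝ} (h0 : 0 < γ) (h2 : γ ≤ 2) (h1 : γ ≠ 1) (hL : 0 < L)
    {u : ℝ → ℝ → ℝ} (hu : SpaceRegular γ L T u) (hu0 : ∀ t ∈ Icc 0 T, u 0 t = 0)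
    (huL : ∀ t ∈ Icc 0 T, u L t = 0) :
    ∃ C : ℝ, 0 ≤ C ∧ ∀ t ∈ Icc 0 T, ∀ (m : ℕ) (i : Fin (m - 1)),
      |rieszDeriv L γ (fun x => u x t) (((i : ℕ) + 1 : ℝ) * (L / m)) +
        rieszConst γ / (L / m) ^ γ *
          ((wsgdMatrix γ m + (wsgdMatrix γ m)ᵀ) *ᵥ gridValues L m fun x => u x t) i| ≤
        C * (L / m) ^ 2 := by
  obtain ⟨hcont, hlt, heq⟩ := hu
  suffices h : ∃ C : ℝ, 0 ≤ C ∧ ∀ t ∈ Icc 0 T, ∀ (m : ℕ) (i : Fin (m - 1)),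
      |leftRL 0 γ (fun x => u x t) (((i : ℕ) + 1 : ℝ) * (L / m)) -
        (wsgdMatrix γ m *ᵥ gridValues L m fun x => u x t) i / (L / m) ^ γ| ≤ C * (L / m) ^ 2 ∧
      |rightRL L γ (fun x => u x t) (((i : ℕ) + 1 : ℝ) * (L / m)) -
        ((wsgdMatrix γ m)ᵀ *ᵥ gridValues L m fun x => u x t) i / (L / m) ^ γ| ≤
          C * (L / m) ^ 2 by
    obtain ⟨C, hC, hbound⟩ := h
    refine ⟨|rieszConst γ| * (C + C), by positivity, fun t ht m i => ?_⟩
    obtain ⟨hl, hr⟩ := hbound t ht m i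
    have h3 := (abs_add_le _ _).trans (add_le_add hl hr)
    have h4 := mul_le_mul_of_nonneg_left h3 (abs_nonneg (rieszConst γ))
    rw [← abs_mul] at h4
    rw [Matrix.add_mulVec, Pi.add_apply, rieszDeriv, ← abs_neg]
    refine (le_of_eq ?_).trans (h4.trans_eq (by ring))
    congr 1
    ring
  rcases h2.lt_or_eq with h | rfl
  · obtain ⟨B, hB⟩ := hlt h.ne
    obtain ⟨C, hC, hbound⟩ := leftRL_consistency h0 h h1
    refine ⟨C * |B|, by positivity, fun t ht m i => ?_⟩
    have hreg : IsRegularFunction L (γ + 2) (fun x => u x t) :=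
      ⟨hcont t ht, hu0 t ht, huL t ht, (hB t ht).1⟩
    have hle : C * (L / m) ^ 2 * ∫ ξ : ℝ, |ξ| ^ (γ + 2) * ‖𝓕 (zeroExt L fun x => u x t) ξ‖ ≤
        C * |B| * (L / m) ^ 2 := by
      have := ((hB t ht).2).trans (le_abs_self B)
      calc _ ≤ C * (L / m) ^ 2 * |B| := by gcongr
        _ = _ := by ring
    refine ⟨(hbound L _ hL hreg m i).trans hle, ?_⟩
    have h3 := hbound L _ hL hreg.comp_sub m (Fin.rev i)
    rw [integral_norm_fourier_comp_sub L (γ + 2) (fun x => u x t), node_rev] at h3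
    rw [rightRL_eq_leftRL, wsgdMatrix_transpose_mulVec_gridValues]
    exact h3.trans hle
  · obtain ⟨B, hB⟩ := heq rfl
    refine ⟨2 * |B|, by positivity, fun t ht m i => ?_⟩
    obtain ⟨hv, hvB⟩ := hB t ht
    have hi := i.2
    have hm : (0 : ℝ) < m := by exact_mod_cast (by omega : 0 < m)
    have hx := node_mem_Ioo hL i
    have him : ((i : ℕ) + 2 : ℝ) ≤ m := by exact_mod_cast (by omega : (i : ℕ) + 2 ≤ m)
    have hbound := second_difference_bound hv
      (fun x hx => (hvB x hx).trans (le_abs_self B)) (x := ((i : ℕ) + 1 : ℝ) * (L / m))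
      (h := L / m) (by positivity) (by
        calc (0 : ℝ) ≤ (i : ℕ) * (L / m) := by positivity
          _ = _ := by ring) (by
        calc _ = ((i : ℕ) + 2 : ℝ) * (L / m) := by ring
          _ ≤ m * (L / m) := by gcongr
          _ = L := by field_simp)
    rw [leftRL_two hv hx, rightRL_two hv hx,
      wsgdMatrix_two_mulVec_gridValues hL (hu0 t ht) (huL t ht),
      wsgdMatrix_two_transpose_mulVec_gridValues hL (hu0 t ht) (huL t ht), Real.rpow_two]
    exact ⟨hbound, hbound⟩

/-- With a the midpoint of a time step and s half its length, the quantity splits into φ(a) minus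
its endpoint mean (at most B's²), the endpoint mean of g' minus g'(a) (at most Bs²), and g'(a) minus
the central quotient (at most Bs²). -/
theorem crankNicolson_time_bound {T B B' : ℝ} {g φ : ℝ → ℝ} (hg : ContDiffOn ℝ 3 g (Icc 0 T))
    (hgB : ∀ t ∈ Icc 0 T, |iteratedDerivWithin 3 g (Icc 0 T) t| ≤ B)
    (hφ : ContDiffOn ℝ 2 φ (Icc 0 T))
    (hφB : ∀ t ∈ Icc 0 T, |iteratedDerivWithin 2 φ (Icc 0 T) t| ≤ B') {a s : ℝ} (hs : 0 < s)
    (h1 : 0 ≤ a - s) (h2 : a + s ≤ T) :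
    |φ a - (g (a + s) - g (a - s)) / (2 * s) +
      ((iteratedDerivWithin 1 g (Icc 0 T) (a + s) - φ (a + s)) +
        (iteratedDerivWithin 1 g (Icc 0 T) (a - s) - φ (a - s))) / 2| ≤ (2 * B + B') * s ^ 2 := by
  have hg' : ContDiffOn ℝ (3 : ℕ) g (Icc 0 T) := hg
  have hφ' : ContDiffOn ℝ (2 : ℕ) φ (Icc 0 T) := hφ
  have hsub : Icc (a - s) (a + s) ⊆ Icc 0 T := Icc_subset_Icc h1 h2
  have hsub' : Ioo (a - s) (a + s) ⊆ Ioo 0 T := Ioo_subset_Ioo h1 h2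
  have ha : a ∈ Icc 0 T := ⟨by linarith, by linarith⟩
  have hT : 0 < T := by linarith
  have hB0 : 0 ≤ B := (abs_nonneg _).trans (hgB a ha)
  have hB0' : 0 ≤ B' := (abs_nonneg _).trans (hφB a ha)
  have hs' : s ∈ Icc 0 s := right_mem_Icc.2 hs.le
  have hcg : ∀ k ≤ 3, ContinuousOn (iteratedDerivWithin k g (Icc 0 T)) (Icc (a - s) (a + s)) :=
    fun k hk => (continuousOn_iteratedDerivWithin_Icc hT hg' hk).mono hsub
  have hdg : ∀ k < 3, ∀ y ∈ Ioo (a - s) (a + s), HasDerivAt (iteratedDerivWithin k g (Icc 0 T))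
      (iteratedDerivWithin (k + 1) g (Icc 0 T) y) y :=
    fun k hk y hy => hasDerivAt_iteratedDerivWithin hg' hk (hsub' hy)
  have hcφ : ∀ k ≤ 2, ContinuousOn (iteratedDerivWithin k φ (Icc 0 T)) (Icc (a - s) (a + s)) :=
    fun k hk => (continuousOn_iteratedDerivWithin_Icc hT hφ' hk).mono hsub
  have hdφ : ∀ k < 2, ∀ y ∈ Ioo (a - s) (a + s), HasDerivAt (iteratedDerivWithin k φ (Icc 0 T))
      (iteratedDerivWithin (k + 1) φ (Icc 0 T) y) y :=
    fun k hk y hy => hasDerivAt_iteratedDerivWithin hφ' hk (hsub' hy)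
  have e1 := symmetric_difference_bound_three hB0 (hcg 0 (by norm_num)) (hcg 1 (by norm_num))
    (hcg 2 (by norm_num)) (hdg 0 (by norm_num)) (hdg 1 (by norm_num)) (hdg 2 (by norm_num))
    (fun y hy => hgB y (Ioo_subset_Icc_self (hsub' hy))) hs'
  have e2 := symmetric_difference_bound_two hB0 (hcg 1 (by norm_num)) (hcg 2 (by norm_num))
    (hdg 1 (by norm_num)) (hdg 2 (by norm_num))
    (fun y hy => hgB y (Ioo_subset_Icc_self (hsub' hy))) hs'
  have e3 := symmetric_difference_bound_two hB0' (hcφ 0 (by norm_num)) (hcφ 1 (by norm_num))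
    (hdφ 0 (by norm_num)) (hdφ 1 (by norm_num))
    (fun y hy => hφB y (Ioo_subset_Icc_self (hsub' hy))) hs'
  rw [iteratedDerivWithin_zero] at e1 e3
  have e1' : |(g (a + s) - g (a - s)) / (2 * s) - iteratedDerivWithin 1 g (Icc 0 T) a| ≤
      B * s ^ 2 := by
    have h3 : (g (a + s) - g (a - s)) / (2 * s) - iteratedDerivWithin 1 g (Icc 0 T) a =
        (g (a + s) - g (a - s) - s * (2 * iteratedDerivWithin 1 g (Icc 0 T) a)) / (2 * s) := by
      field_simp
    rw [h3, abs_div, abs_of_pos (by positivity : 0 < 2 * s), div_le_iff₀ (by positivity)]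
    exact e1.trans_eq (by ring)
  rw [abs_le] at e1' e2 e3 ⊢
  constructor <;> linarith [e1'.1, e1'.2, e2.1, e2.2, e3.1, e3.2]

/-- The discretisation of `-(Kα ∂^α/∂|x|^α + Kβ ∂^β/∂|x|^β)` with step `h = L / m`. -/
noncomputable def spaceOperator (α β Kα Kβ L : ℝ) (m : ℕ) : Matrix (Fin (m - 1)) (Fin (m - 1)) ℝ :=
  (Kα * (rieszConst α / (L / m) ^ α)) • (wsgdMatrix α m + (wsgdMatrix α m)ᵀ) +
    (Kβ * (rieszConst β / (L / m) ^ β)) • (wsgdMatrix β m + (wsgdMatrix β m)ᵀ)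

theorem matD_eq_smul_spaceOperator (α β Kα Kβ L : ℝ) (m : ℕ) (τ : ℝ) :
    matD α β Kα Kβ L m τ = (τ / 2) • spaceOperator α β Kα Kβ L m := by
  rw [matD, spaceOperator, smul_add (τ / 2), smul_smul, smul_smul]
  congr 2 <;> rw [mu] <;> ring

/-- By the equation, ∂ₜu - f is the continuous space operator, so the expression is its
discretisation error. The form with ∂ₜu is the one that the time estimate can absorb. -/
theorem spaceOperator_consistency {α β Kα Kβ L T : ℝ} (hα0 : 0 < α) (hα1 : α < 1) (hβ1 : 1 < β)
    (hβ2 : β ≤ 2) (hL : 0 < L) (hT : 0 < T) {f : ℝ → ℝ → ℝ} {ψ : ℝ → ℝ} {u : ℝ → ℝ → ℝ}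
    (hu : IsSolution α β Kα Kβ L T f ψ u) (hspaceα : Kα ≠ 0 → SpaceRegular α L T u)
    (hspaceβ : SpaceRegular β L T u) (htime : TimeRegular 3 L T u) (hf : TimeRegular 2 L T f) :
    ∃ C : ℝ, 0 ≤ C ∧ ∀ (m : ℕ) (i : Fin (m - 1)), ∀ t ∈ Icc 0 T,
      |iteratedDerivWithin 1 (fun s => u (((i : ℕ) + 1 : ℝ) * (L / m)) s) (Icc 0 T) t -
        f (((i : ℕ) + 1 : ℝ) * (L / m)) t +
        (spaceOperator α β Kα Kβ L m *ᵥ gridValues L m fun x => u x t) i| ≤ C * (L / m) ^ 2 := by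
  obtain ⟨Cα, hCα, hα⟩ : ∃ C : ℝ, 0 ≤ C ∧ ∀ t ∈ Icc 0 T, ∀ (m : ℕ) (i : Fin (m - 1)),
      |Kα * (rieszDeriv L α (fun x => u x t) (((i : ℕ) + 1 : ℝ) * (L / m)) +
        rieszConst α / (L / m) ^ α *
          ((wsgdMatrix α m + (wsgdMatrix α m)ᵀ) *ᵥ gridValues L m fun x => u x t) i)| ≤
        C * (L / m) ^ 2 := by
    by_cases hK : Kα = 0
    · exact ⟨0, le_rfl, fun t _ m i => by simp [hK]⟩
    · obtain ⟨C, hC, h⟩ := rieszDeriv_consistency hα0 (by linarith) hα1.ne hL (hspaceα hK)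
        hu.left_boundary hu.right_boundary
      refine ⟨|Kα| * C, by positivity, fun t ht m i => ?_⟩
      rw [abs_mul, mul_assoc]
      exact mul_le_mul_of_nonneg_left (h t ht m i) (abs_nonneg _)
  obtain ⟨Cβ, hCβ, hβ⟩ := rieszDeriv_consistency (by linarith) hβ2 hβ1.ne' hL hspaceβ
    hu.left_boundary hu.right_boundary
  refine ⟨Cα + |Kβ| * Cβ, by positivity, fun m i => ?_⟩
  set x : ℝ := ((i : ℕ) + 1 : ℝ) * (L / m) with hx
  have hxm := node_mem_Ioo hL i
  obtain ⟨Bu, hBu⟩ := htime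
  obtain ⟨Bf, hBf⟩ := hf
  set q : ℝ → ℝ := fun t => iteratedDerivWithin 1 (fun s => u x s) (Icc 0 T) t - f x t +
    (spaceOperator α β Kα Kβ L m *ᵥ gridValues L m fun x => u x t) i with hq
  have hpos : ∀ t ∈ Ioc 0 T, |q t| ≤ (Cα + |Kβ| * Cβ) * (L / m) ^ 2 := by
    intro t ht
    have htI := Ioc_subset_Icc_self ht
    have h1 := (hu.equation x hxm t ht).derivWithin (uniqueDiffOn_Icc hT t htI)
    have h2 := hα t htI m i
    have h3 : |Kβ * (rieszDeriv L β (fun x => u x t) x + rieszConst β / (L / m) ^ β *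
          ((wsgdMatrix β m + (wsgdMatrix β m)ᵀ) *ᵥ gridValues L m fun x => u x t) i)| ≤
        |Kβ| * Cβ * (L / m) ^ 2 := by
      rw [abs_mul, mul_assoc]
      exact mul_le_mul_of_nonneg_left (hβ t htI m i) (abs_nonneg _)
    have h4 := (abs_add_le _ _).trans (add_le_add h2 h3)
    rw [← hx] at h4
    simp only [hq]
    rw [iteratedDerivWithin_one, h1, spaceOperator, Matrix.add_mulVec, Matrix.smul_mulVec,
      Matrix.smul_mulVec, Pi.add_apply, Pi.smul_apply, Pi.smul_apply, smul_eq_mul, smul_eq_mul]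
    refine (le_of_eq ?_).trans (h4.trans_eq (by ring))
    congr 1
    ring
  have hcont : ContinuousOn q (Icc 0 T) := by
    have hu' : ContDiffOn ℝ (3 : ℕ) (fun s => u x s) (Icc 0 T) := (hBu x hxm).1
    refine ((continuousOn_iteratedDerivWithin_Icc hT hu' (by norm_num)).sub
      (hBf x hxm).1.continuousOn).add ?_
    simp only [Matrix.mulVec, dotProduct]
    refine continuousOn_finsetSum _ fun j _ => continuousOn_const.mul ?_
    exact (hBu _ (node_mem_Ioo hL j)).1.continuousOn
  intro t ht
  -- The equation is assumed only for t > 0. The residual involves just node values of u, ∂ₜu and f,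
  -- so it is continuous in t and the bound extends to t = 0, which the first time step needs.
  have hclos : t ∈ closure (Ioc 0 T) := by rwa [closure_Ioc hT.ne]
  exact ContinuousWithinAt.closure_le hclos ((hcont t ht).mono Ioc_subset_Icc_self).abs
    continuousWithinAt_const hpos

theorem crankNicolson_error_bound {α β Kα Kβ L T : ℝ} (hα0 : 0 < α) (hα1 : α < 1) (hβ1 : 1 < β)
    (hβ2 : β ≤ 2) (hKα : 0 ≤ Kα) (hKβ : 0 < Kβ) (hL : 0 < L) (hT : 0 < T) {f : ℝ → ℝ → ℝ}
    {ψ : ℝ → ℝ} {u : ℝ → ℝ → ℝ} (hu : IsSolution α β Kα Kβ L T f ψ u)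
    (hspaceα : Kα ≠ 0 → SpaceRegular α L T u) (hspaceβ : SpaceRegular β L T u)
    (htime : TimeRegular 3 L T u) (hf : TimeRegular 2 L T f) :
    ∃ C : ℝ, 0 < C ∧ ∀ m N : ℕ, 0 < m → 0 < N → ∀ U : ℕ → Fin (m - 1) → ℝ,
      IsCrankNicolson α β Kα Kβ L T f ψ m N U → ∀ n : ℕ, n ≤ N →
        ‖U n - gridValues L m (fun x => u x (n * (T / N)))‖ ≤
          C * ((T / N) ^ 2 + (L / m) ^ 2) := by
  obtain ⟨C₁, hC₁, hstab⟩ := norm_le_of_crankNicolson hα0 hα1 hβ1 hβ2 hKα hKβ hL hT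
  obtain ⟨C₂, hC₂, hcons⟩ := spaceOperator_consistency hα0 hα1 hβ1 hβ2 hL hT hu hspaceα hspaceβ
    htime hf
  obtain ⟨Bu, hBu⟩ := htime
  obtain ⟨Bf, hBf⟩ := hf
  -- Time error plus space error; the 1 makes the constant positive.
  set C₃ : ℝ := 2 * |Bu| + |Bf| + C₂ + 1 with hC₃
  have hC₃0 : 0 < C₃ := by positivity
  refine ⟨C₁ * C₃, by positivity, fun m N hm hN U hU n hn => ?_⟩
  have hNR : (0 : ℝ) < N := by exact_mod_cast hN
  set τ : ℝ := T / N with hτ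
  have hτ0 : 0 < τ := by positivity
  have hNτ : N * τ = T := by rw [hτ]; field_simp
  set w : ℕ → Fin (m - 1) → ℝ := fun n => gridValues L m fun x => u x (n * τ) with hw
  set F : ℕ → Fin (m - 1) → ℝ := fun n => gridValues L m fun x => f x (((n : ℝ) + 1 / 2) * τ)
    with hF
  set S := spaceOperator α β Kα Kβ L m with hS
  -- The truncation error per unit time: the defect of the exact solution in the scheme, divided by
  -- τ.
  set ρ : ℕ → Fin (m - 1) → ℝ := fun n =>
    F n - τ⁻¹ • (w (n + 1) - w n) - (1 / 2 : ℝ) • (S *ᵥ (w (n + 1) + w n)) with hρ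
  have hD : matD α β Kα Kβ L m τ = (τ / 2) • S := matD_eq_smul_spaceOperator _ _ _ _ _ _ _
  rw [mul_assoc]
  refine hstab m N hm hN (fun n => U n - w n) ρ (C₃ * (τ ^ 2 + (L / m) ^ 2)) ?_ ?_ ?_
    (by positivity) n hn
  · rw [hU.1, sub_eq_zero]
    ext i
    simp only [hw, gridValues, Nat.cast_zero, zero_mul]
    exact (hu.initial _ (Ioo_subset_Icc_self (node_mem_Ioo hL i))).symm
  · intro n hn
    have h1 : (1 + matD α β Kα Kβ L m τ) *ᵥ U (n + 1) =
        (1 - matD α β Kα Kβ L m τ) *ᵥ U n + τ • F n := hU.2 n hn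
    rw [← hτ]
    rw [Matrix.mulVec_sub, Matrix.mulVec_sub, h1, hD]
    ext i
    simp only [hρ, Matrix.add_mulVec, Matrix.sub_mulVec, Matrix.one_mulVec, Matrix.smul_mulVec,
      Matrix.mulVec_add, Pi.sub_apply, Pi.add_apply, Pi.smul_apply, smul_eq_mul]
    field_simp
    ring
  · intro n hn i
    have hx := node_mem_Ioo hL i
    set x : ℝ := ((i : ℕ) + 1 : ℝ) * (L / m) with hxdef
    have hnN : (n : ℝ) + 1 ≤ N := by exact_mod_cast hn
    have hle : ((n : ℝ) + 1) * τ ≤ T := by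
      rw [← hNτ]
      gcongr
    have ht1 : ((n : ℝ) + 1 / 2) * τ + τ / 2 = ((n + 1 : ℕ) : ℝ) * τ := by push_cast; ring
    have ht0 : ((n : ℝ) + 1 / 2) * τ - τ / 2 = (n : ℝ) * τ := by ring
    have hn0 : 0 ≤ (n : ℝ) * τ := by positivity
    have hb := crankNicolson_time_bound (hBu x hx).1
      (fun t ht => ((hBu x hx).2 t ht).trans (le_abs_self Bu)) (hBf x hx).1
      (fun t ht => ((hBf x hx).2 t ht).trans (le_abs_self Bf)) (a := ((n : ℝ) + 1 / 2) * τ)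
      (s := τ / 2) (by positivity) (by rw [ht0]; exact hn0) (by rw [ht1]; push_cast; exact hle)
    rw [ht0, ht1] at hb
    have hp0 := hcons m i ((n : ℝ) * τ) ⟨hn0, by linarith⟩
    have hp1 := hcons m i (((n + 1 : ℕ) : ℝ) * τ) ⟨by positivity, by push_cast; exact hle⟩
    rw [← hxdef, ← hS] at hp0 hp1
    have hρi : ρ n i = f x (((n : ℝ) + 1 / 2) * τ) -
        (u x (((n + 1 : ℕ) : ℝ) * τ) - u x ((n : ℝ) * τ)) / (2 * (τ / 2)) -
        1 / 2 * ((S *ᵥ w (n + 1)) i + (S *ᵥ w n) i) := by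
      simp only [hρ, Matrix.mulVec_add, Pi.sub_apply, Pi.add_apply, Pi.smul_apply, smul_eq_mul]
      simp only [hF, hw, gridValues]
      rw [← hxdef]
      field_simp
    have hb' : (2 * |Bu| + |Bf|) * (τ / 2) ^ 2 ≤ (2 * |Bu| + |Bf|) * τ ^ 2 := by
      gcongr
      linarith
    have hfin : (2 * |Bu| + |Bf|) * τ ^ 2 + C₂ * (L / m) ^ 2 ≤ C₃ * (τ ^ 2 + (L / m) ^ 2) := by
      have h1 : 0 ≤ (C₂ + 1) * τ ^ 2 := by positivity
      have h2 : 0 ≤ (2 * |Bu| + |Bf| + 1) * (L / m) ^ 2 := by positivity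
      rw [hC₃]
      linarith
    rw [hρi]
    -- The residual equals the quantity bounded in `hb` minus the mean of those in `hp0` and `hp1`.
    rw [abs_le] at hb hp0 hp1 ⊢
    constructor <;> linarith [hb.1, hb.2, hp0.1, hp0.2, hp1.1, hp1.2]

end RieszFADE

open RieszFADE in
theorem theorem3 (α β Kα Kβ L T : ℝ)
    (hα0 : 0 < α) (hα1 : α < 1) (hβ1 : 1 < β) (hβ2 : β ≤ 2)
    (hKα : 0 ≤ Kα) (hKβ : 0 < Kβ) (hL : 0 < L) (hT : 0 < T)
    (f : ℝ → ℝ → ℝ) (ψ : ℝ → ℝ) (u : ℝ → ℝ → ℝ)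
    (hu : IsSolution α β Kα Kβ L T f ψ u)
    (hspaceα : Kα ≠ 0 → SpaceRegular α L T u) (hspaceβ : SpaceRegular β L T u)
    (htime : TimeRegular 3 L T u) (hf : TimeRegular 2 L T f) :
    -- the scheme determines the numerical solution, whatever the step sizes
    (∀ m N : ℕ, 0 < m → 0 < N → IsUnit (1 + matD α β Kα Kβ L m (T / N))) ∧
    -- the error estimate in the maximum norm
    (∃ C : ℝ, 0 < C ∧ ∀ m N : ℕ, 0 < m → 0 < N → ∀ U : ℕ → Fin (m - 1) → ℝ,
      IsCrankNicolson α β Kα Kβ L T f ψ m N U →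
        ∀ n : ℕ, n ≤ N →
          ‖U n - gridValues L m (fun x => u x (n * (T / N)))‖ ≤
            C * ((T / N) ^ 2 + (L / m) ^ 2)) ∧
    -- unconditional convergence as the step sizes tend to zero independently
    (∀ ε : ℝ, 0 < ε → ∃ δ : ℝ, 0 < δ ∧ ∀ m N : ℕ, 0 < m → 0 < N →
      L / m < δ → T / N < δ → ∀ U : ℕ → Fin (m - 1) → ℝ,
        IsCrankNicolson α β Kα Kβ L T f ψ m N U →
          ∀ n : ℕ, n ≤ N → ‖U n - gridValues L m (fun x => u x (n * (T / N)))‖ < ε) := by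
  refine ⟨fun m N hm hN => isUnit_one_add_of_form_nonneg
    (dotProduct_matD_nonneg hα0 hα1 hβ1 hβ2 hKα hKβ.le hL.le (by positivity) m), ?_⟩
  obtain ⟨C, hC, hbound⟩ := crankNicolson_error_bound hα0 hα1 hβ1 hβ2 hKα hKβ hL hT hu hspaceα
    hspaceβ htime hf
  refine ⟨⟨C, hC, hbound⟩, fun ε hε => ⟨min 1 (ε / (2 * C)), by positivity, ?_⟩⟩
  intro m N hm hN hh hτ U hU n hn
  refine (hbound m N hm hN U hU n hn).trans_lt ?_
  -- The 1 in the minimum gives y² ≤ y, so each square takes at most half of ε / C.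
  have hsq : ∀ y : ℝ, 0 ≤ y → y < min 1 (ε / (2 * C)) → y ^ 2 < ε / (2 * C) := fun y hy h => by
    nlinarith [h.trans_le (min_le_left _ _), h.trans_le (min_le_right _ _)]
  calc C * ((T / N) ^ 2 + (L / m) ^ 2) < C * (ε / (2 * C) + ε / (2 * C)) :=
        mul_lt_mul_of_pos_left
          (add_lt_add (hsq _ (by positivity) hτ) (hsq _ (by positivity) hh)) hC
    _ = ε := by
        field_simp
        norm_num
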